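/- Link diagrams are diagrams of unoriented links on the sphere, and $\det$ denotes the determinant of a link, $\det(L)=|V_L(-1)|=|\Delta_L(-1)|$. For a crossing $c$ of a diagram $D$, rotate $D$ so that the over-strand of $c$ has negative slope, i.e. $c$ is the elementary tangle $-1$ with ends NW, NE, SW, SE. The smoothing $D^c_0$ is obtained by replacing $c$ by the tangle $0$ (two arcs NW–NE and SW–SE), and $D^c_\infty$ by replacing $c$ by the tangle $\infty$ (two arcs NW–SW and NE–SE). The rational extension $D^{c\leftarrow -1/2}$ is obtained by replacing $c$ by two crossings $-1$ placed one above the other (SW and SE of the upper one joined to NW and NE of the lower one), and $D^{c\leftarrow -2}$ by replacing $c$ by two crossings $-1$ placed side by side (NE and SE of the left one joined to NW and SW of the right one). The set $\mathcal Q$ of quasi-alternating links is the smallest set of links that contains the unknot and contains every link with a diagram $D$ that has a crossing $c$ such that the links of $D^c_0$ and $D^c_\infty$ are in $\mathcal Q$ and $\det(D)=\det(D^c_0)+\det(D^c_\infty)$; then $D$ is called quasi-alternating at $c$, and $c$ a quasi-alternating crossing of $D$. A dealternator of $D$ is a crossing whose change makes $D$ alternating; $D$ is almost alternating if it has a dealternator.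 **Theorem.** Let $D$ be an almost alternating diagram of a quasi-alternating link, and let $c$ be a dealternator of $D$. 1. If $\det(D^c_0)>\det(D^c_\infty)$, then $D^{c\leftarrow -1/2}$ is quasi-alternating at each of the two crossings of the inserted tangle (in particular at $c$). 2. If $\det(D^c_0)<\det(D^c_\infty)$, then $D^{c\leftarrow -2}$ is quasi-alternating at each of the two crossings of the inserted tangle (in particular at $c$). -/

import Mathlib

open scoped BigOperators

/-- The number of orbits of the group of permutations of `X` generated by `S`. -/
noncomputable def orbitCount {X : Type} (S : Set (Equiv.Perm X)) : ℕ :=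
  Nat.card (MulAction.orbitRel.Quotient (Subgroup.closure S) X)

/-- Conjugates of fixed point free involutions are fixed point free involutions. -/
theorem permCongr_permCongr_apply {X Y : Type} (π : X ≃ Y) (e : Equiv.Perm X)
    (h : ∀ x, e (e x) = x) (y : Y) : π.permCongr e (π.permCongr e y) = y := by
  simp [Equiv.permCongr_apply, h]

theorem permCongr_apply_ne {X Y : Type} (π : X ≃ Y) (e : Equiv.Perm X)
    (h : ∀ x, e x ≠ x) (y : Y) : π.permCongr e y ≠ y := fun hy => by
  rw [Equiv.permCongr_apply] at hy
  exact h _ ((Equiv.eq_symm_apply _).2 hy)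

theorem sumCongr_sumCongr_apply {X Y : Type} (e : Equiv.Perm X) (f : Equiv.Perm Y)
    (he : ∀ x, e (e x) = x) (hf : ∀ y, f (f y) = y) (z : X ⊕ Y) :
    Equiv.sumCongr e f (Equiv.sumCongr e f z) = z := by
  rcases z with z | z <;> simp [he, hf]

theorem sumCongr_apply_ne {X Y : Type} (e : Equiv.Perm X) (f : Equiv.Perm Y)
    (he : ∀ x, e x ≠ x) (hf : ∀ y, f y ≠ y) (z : X ⊕ Y) : Equiv.sumCongr e f z ≠ z := by
  rcases z with z | z <;> simp [he, hf]

/-- The pairing `0-1`, `2-3` of the four ends of a crossing. -/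
def pairA : Equiv.Perm (Fin 4) := Equiv.swap 0 1 * Equiv.swap 2 3

/-- The pairing `1-2`, `3-0` of the four ends of a crossing. -/
def pairB : Equiv.Perm (Fin 4) := Equiv.swap 1 2 * Equiv.swap 3 0

/-- A link diagram on a closed oriented surface, as a combinatorial map (for diagrams on the
sphere see `LinkDiagram.Planar`). The underlying graph has
* a 4-valent vertex for each `x : C`, a crossing, with half-edges `(x, 0), (x, 1), (x, 2), (x, 3)`
  in counterclockwise order, such that `(x, 1), (x, 3)` belong to the over-strand and
  `(x, 0), (x, 2)` to the under-strand;
* a 2-valent vertex for each `b : B`, a marked point on the link away from the crossings, with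
  half-edges `(b, 0), (b, 1)`. (Marked points carry no information; they can be added and deleted,
  but a circle without crossings has at least one.)
The half-edges are joined in pairs by `edge`. -/
structure LinkDiagram where
  C : Type
  B : Type
  [fintypeC : Fintype C]
  [decC : DecidableEq C]
  [fintypeB : Fintype B]
  [decB : DecidableEq B]
  edge : Equiv.Perm ((C × Fin 4) ⊕ (B × Fin 2))
  edge_edge : ∀ d, edge (edge d) = d
  edge_ne : ∀ d, edge d ≠ d

namespace LinkDiagram

attribute [instance] fintypeC decC fintypeB decB

/-- The half-edges. -/
abbrev Dart (D : LinkDiagram) : Type := (D.C × Fin 4) ⊕ (D.B × Fin 2)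

/-- The counterclockwise rotation of the half-edges around each vertex. -/
def rot (D : LinkDiagram) : Equiv.Perm D.Dart :=
  Equiv.sumCongr (Equiv.prodCongrRight fun _ => finRotate 4)
    (Equiv.prodCongrRight fun _ => Equiv.swap 0 1)

/-- Whether a half-edge is an end of an over-strand at a crossing. -/
def isOver (D : LinkDiagram) : D.Dart → Bool
  | Sum.inl (_, i) => decide (i = 1 ∨ i = 3)
  | Sum.inr _ => false

/-- The diagram lies on the sphere: `V - E + F = 2 K`, where `V, E, F, K` are the numbers of
vertices, edges, faces and connected components (orbits of the half-edges under the rotation, the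
edge involution, their product, and the two together), that is, each connected component of the
map has genus zero. The relative position of the connected components is not recorded, since the
link does not depend on it. -/
def Planar (D : LinkDiagram) : Prop :=
  orbitCount {D.rot} + orbitCount {D.rot * D.edge} =
    orbitCount {D.edge} + 2 * orbitCount {D.rot, D.edge}

/-! ### Kauffman bracket and determinant -/

/-- The pairing of the half-edges in a Kauffman state: a crossing `x` with `s x = true` is replaced
by its `A`-smoothing (which merges the two regions swept when the over-strand is turned
counterclockwise, so it joins `0-1` and `2-3`), the others by their `B`-smoothing. -/
def statePairing (D : LinkDiagram) (s : D.C → Bool) : Equiv.Perm D.Dart :=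
  Equiv.sumCongr (Equiv.prodCongrRight fun x => if s x then pairA else pairB)
    (Equiv.prodCongrRight fun _ => Equiv.swap 0 1)

/-- The number of circles of a Kauffman state. -/
noncomputable def stateLoops (D : LinkDiagram) (s : D.C → Bool) : ℕ :=
  orbitCount {D.edge, D.statePairing s}

/-- The value at `A` of the Kauffman bracket, normalized to be `1` on the circle. -/
noncomputable def bracket (D : LinkDiagram) (A : ℂ) : ℂ :=
  ∑ s : D.C → Bool,
    (∏ x, if s x then A else A⁻¹) * (-A ^ 2 - (A⁻¹) ^ 2) ^ (D.stateLoops s - 1)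

/-- The determinant `|V(-1)| = |Δ(-1)|`, with `V` the Jones and `Δ` the Alexander polynomial.
`V(-1)` is the bracket at `t = A ^ (-4) = -1` times the writhe factor `(-A ^ 3) ^ (-w)`, which has
absolute value one. -/
noncomputable def det (D : LinkDiagram) : ℝ :=
  ‖D.bracket (Complex.exp (Real.pi / 4 * Complex.I))‖

/-! ### Smoothings, crossing changes, extensions

A crossing is looked at as the elementary tangle `-1`, the one whose over-strand has negative
slope: its half-edges `0, 1, 2, 3` are the ends `NE, NW, SW, SE`. -/

/-- The positions of the half-edges of a smoothed crossing on the two arcs replacing it, each of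
which gets a marked point. For the smoothing `0` (`infinite = false`) the arcs are `NE-NW` and
`SW-SE`; for the smoothing `∞` they are `NW-SW` and `SE-NE`. -/
def arcEquiv (infinite : Bool) : Fin 4 ≃ Fin 2 × Fin 2 :=
  (if infinite then (finRotate 4).symm else Equiv.refl (Fin 4)).trans
    (finProdFinEquiv (m := 2) (n := 2)).symm

/-- The half-edges of `D` as half-edges of a smoothing of `D` at `c`. -/
def smoothDart (D : LinkDiagram) (c : D.C) (infinite : Bool) :
    D.Dart ≃ ({x : D.C // x ≠ c} × Fin 4) ⊕ ((D.B ⊕ Fin 2) × Fin 2) where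
  toFun
    | Sum.inl (x, i) =>
        if h : x = c then
          Sum.inr (Sum.inr (arcEquiv infinite i).1, (arcEquiv infinite i).2)
        else Sum.inl (⟨x, h⟩, i)
    | Sum.inr (b, j) => Sum.inr (Sum.inl b, j)
  invFun
    | Sum.inl (x, i) => Sum.inl (x.1, i)
    | Sum.inr (Sum.inl b, j) => Sum.inr (b, j)
    | Sum.inr (Sum.inr q, j) => Sum.inl (c, (arcEquiv infinite).symm (q, j))
  left_inv := by
    rintro (⟨x, i⟩ | ⟨b, j⟩)
    · by_cases h : x = c
      · subst h; simp
      · simp [h]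
    · rfl
  right_inv := by
    rintro (⟨⟨x, hx⟩, i⟩ | ⟨b | q, j⟩)
    · simp [hx]
    · rfl
    · simp

/-- The smoothing of `D` at `c`: the crossing is replaced by two arcs, each with a marked point. -/
def smooth (D : LinkDiagram) (c : D.C) (infinite : Bool) : LinkDiagram where
  C := {x : D.C // x ≠ c}
  B := D.B ⊕ Fin 2
  edge := (D.smoothDart c infinite).permCongr D.edge
  edge_edge := permCongr_permCongr_apply _ _ D.edge_edge
  edge_ne := permCongr_apply_ne _ _ D.edge_ne

/-- `D` with `c` replaced by the tangle `0`. -/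
abbrev smoothZero (D : LinkDiagram) (c : D.C) : LinkDiagram := D.smooth c false

/-- `D` with `c` replaced by the tangle `∞`. -/
abbrev smoothInfty (D : LinkDiagram) (c : D.C) : LinkDiagram := D.smooth c true

/-- The relabelling `i ↦ i + 1` of the half-edges of `c`. -/
def shiftAt (D : LinkDiagram) (c : D.C) : Equiv.Perm D.Dart :=
  Equiv.sumCongr
    (Equiv.prodCongrRight fun x => if x = c then finRotate 4 else Equiv.refl (Fin 4))
    (Equiv.refl _)

/-- The crossing change at `c`: the cyclic order at `c` is kept, and over and under are
exchanged. -/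
def changeCrossing (D : LinkDiagram) (c : D.C) : LinkDiagram where
  C := D.C
  B := D.B
  edge := (D.shiftAt c).permCongr D.edge
  edge_edge := permCongr_permCongr_apply _ _ D.edge_edge
  edge_ne := permCongr_apply_ne _ _ D.edge_ne

/-- Placing of half-edges when the crossing `c` is replaced by a tangle with the two crossings
`some c` and `none`: the ends `i` of the tangle with `moved i` are at `none`, the others at
`some c`; `Sum.inr i` is the inner half-edge of the tangle in position `i` (at `some c` if
`moved i`, at `none` otherwise). -/
def extendDart (D : LinkDiagram) (c : D.C) (moved : Fin 4 → Bool) :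
    D.Dart ⊕ Fin 4 ≃ (Option D.C × Fin 4) ⊕ (D.B × Fin 2) where
  toFun
    | Sum.inl (Sum.inl (x, i)) =>
        if x = c ∧ moved i then Sum.inl (none, i) else Sum.inl (some x, i)
    | Sum.inl (Sum.inr q) => Sum.inr q
    | Sum.inr i => if moved i then Sum.inl (some c, i) else Sum.inl (none, i)
  invFun
    | Sum.inl (some x, i) => if x = c ∧ moved i then Sum.inr i else Sum.inl (Sum.inl (x, i))
    | Sum.inl (none, i) => if moved i then Sum.inl (Sum.inl (c, i)) else Sum.inr i
    | Sum.inr q => Sum.inl (Sum.inr q)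
  left_inv := by
    rintro ((⟨x, i⟩ | q) | i)
    · by_cases h : x = c <;> by_cases h' : moved i <;> simp [h, h']
    · rfl
    · by_cases h' : moved i <;> simp [h']
  right_inv := by
    rintro (⟨_ | x, i⟩ | q)
    · by_cases h' : moved i <;> simp [h']
    · by_cases h : x = c <;> by_cases h' : moved i <;> simp [h, h']
    · rfl

/-- `D` with `c` replaced by a tangle with the two crossings `some c` and `none`, whose four inner
half-edges are joined by `f`. -/
def extend (D : LinkDiagram) (c : D.C) (moved : Fin 4 → Bool) (f : Equiv.Perm (Fin 4))
    (hf : ∀ i, f (f i) = i) (hf' : ∀ i, f i ≠ i) : LinkDiagram where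
  C := Option D.C
  B := D.B
  edge := (D.extendDart c moved).permCongr (Equiv.sumCongr D.edge f)
  edge_edge := permCongr_permCongr_apply _ _ (sumCongr_sumCongr_apply _ _ D.edge_edge hf)
  edge_ne := permCongr_apply_ne _ _ (sumCongr_apply_ne _ _ D.edge_ne hf')

/-- The extension of `c` by the rational tangle `-1/2`: two crossings `-1` one above the other,
`some c` on top and `none` below. The ends `SW` and `SE` of the tangle (`2` and `3`) are at `none`;
`SW`, `SE` of the top crossing are joined to `NW`, `NE` of the bottom crossing. -/
def extendNegHalf (D : LinkDiagram) (c : D.C) : LinkDiagram :=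
  D.extend c (fun i => decide (i = 2 ∨ i = 3)) pairB (by decide) (by decide)

/-- The extension of `c` by the rational tangle `-2`: two crossings `-1` side by side, `some c` on
the left and `none` on the right. The ends `NE` and `SE` of the tangle (`0` and `3`) are at `none`;
`NE`, `SE` of the left crossing are joined to `NW`, `SW` of the right crossing. -/
def extendNegTwo (D : LinkDiagram) (c : D.C) : LinkDiagram :=
  D.extend c (fun i => decide (i = 0 ∨ i = 3)) pairA (by decide) (by decide)

/-! ### Alternating and almost alternating diagrams -/

/-- `Joined d d'`: leaving a vertex through the half-edge `d` and passing through marked points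
only, one arrives at a vertex through the half-edge `d'`. -/
inductive Joined (D : LinkDiagram) : D.Dart → D.Dart → Prop
  | edge (d : D.Dart) : Joined D d (D.edge d)
  | pass (d : D.Dart) (b : D.B) (j : Fin 2) :
      Joined D d (Sum.inr (b, j)) → Joined D d (D.edge (Sum.inr (b, j + 1)))

/-- Over- and under-passages alternate along the link. -/
def Alternating (D : LinkDiagram) : Prop :=
  ∀ (x y : D.C) (i j : Fin 4), D.Joined (Sum.inl (x, i)) (Sum.inl (y, j)) →
    D.isOver (Sum.inl (x, i)) ≠ D.isOver (Sum.inl (y, j))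

/-- The crossing change at `c` makes the diagram alternating. -/
def IsDealternator (D : LinkDiagram) (c : D.C) : Prop := (D.changeCrossing c).Alternating

end LinkDiagram

/-! ### Reidemeister moves -/

/-- A tangle diagram with set of ends `E`. -/
structure TangleDiagram (E : Type) where
  C : Type
  B : Type
  [fintypeC : Fintype C]
  [decC : DecidableEq C]
  [fintypeB : Fintype B]
  [decB : DecidableEq B]
  edge : Equiv.Perm (((C × Fin 4) ⊕ (B × Fin 2)) ⊕ E)
  edge_edge : ∀ d, edge (edge d) = d
  edge_ne : ∀ d, edge d ≠ d

namespace TangleDiagram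

attribute [instance] fintypeC decC fintypeB decB

/-- The half-edges of the diagram obtained by gluing two tangles along their ends. The end `e` of
both tangles becomes a marked point, with its half-edge `0` in `N` and its half-edge `1` in `T`. -/
def glueDart {E : Type} (N T : TangleDiagram E) :
    (((N.C × Fin 4) ⊕ (N.B × Fin 2)) ⊕ E) ⊕ (((T.C × Fin 4) ⊕ (T.B × Fin 2)) ⊕ E) ≃
      ((N.C ⊕ T.C) × Fin 4) ⊕ (((N.B ⊕ T.B) ⊕ E) × Fin 2) where
  toFun
    | Sum.inl (Sum.inl (Sum.inl (x, i))) => Sum.inl (Sum.inl x, i)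
    | Sum.inl (Sum.inl (Sum.inr (b, j))) => Sum.inr (Sum.inl (Sum.inl b), j)
    | Sum.inl (Sum.inr e) => Sum.inr (Sum.inr e, 0)
    | Sum.inr (Sum.inl (Sum.inl (x, i))) => Sum.inl (Sum.inr x, i)
    | Sum.inr (Sum.inl (Sum.inr (b, j))) => Sum.inr (Sum.inl (Sum.inr b), j)
    | Sum.inr (Sum.inr e) => Sum.inr (Sum.inr e, 1)
  invFun
    | Sum.inl (Sum.inl x, i) => Sum.inl (Sum.inl (Sum.inl (x, i)))
    | Sum.inl (Sum.inr x, i) => Sum.inr (Sum.inl (Sum.inl (x, i)))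
    | Sum.inr (Sum.inl (Sum.inl b), j) => Sum.inl (Sum.inl (Sum.inr (b, j)))
    | Sum.inr (Sum.inl (Sum.inr b), j) => Sum.inr (Sum.inl (Sum.inr (b, j)))
    | Sum.inr (Sum.inr e, j) => if j = 0 then Sum.inl (Sum.inr e) else Sum.inr (Sum.inr e)
  left_inv := by
    rintro (((⟨x, i⟩ | ⟨b, j⟩) | e) | ((⟨x, i⟩ | ⟨b, j⟩) | e)) <;> simp
  right_inv := by
    rintro (⟨x | x, i⟩ | ⟨(b | b) | e, j⟩)
    · rfl
    · rfl
    · rfl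
    · rfl
    · fin_cases j <;> rfl

/-- The diagram obtained by gluing two tangles along their ends. -/
def glue {E : Type} [Fintype E] [DecidableEq E] (N T : TangleDiagram E) : LinkDiagram where
  C := N.C ⊕ T.C
  B := (N.B ⊕ T.B) ⊕ E
  edge := (glueDart N T).permCongr (Equiv.sumCongr N.edge T.edge)
  edge_edge := permCongr_permCongr_apply _ _ (sumCongr_sumCongr_apply _ _ N.edge_edge T.edge_edge)
  edge_ne := permCongr_apply_ne _ _ (sumCongr_apply_ne _ _ N.edge_ne T.edge_ne)

/-- One strand, without crossings. -/
def strand : TangleDiagram (Fin 2) where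
  C := Empty
  B := Empty
  edge := Equiv.swap (Sum.inr 0) (Sum.inr 1)
  edge_edge := by decide
  edge_ne := by decide

/-- The half-edge `i` of the crossing `x` of a tangle whose crossings are indexed by `Fin m`. -/
def cr {m n : ℕ} (x : Fin m) (i : Fin 4) :
    ((Fin m × Fin 4) ⊕ (Empty × Fin 2)) ⊕ Fin n := Sum.inl (Sum.inl (x, i))

/-- The end `e` of a tangle whose ends are indexed by `Fin n`. -/
def en {m n : ℕ} (e : Fin n) :
    ((Fin m × Fin 4) ⊕ (Empty × Fin 2)) ⊕ Fin n := Sum.inr e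

/-- One strand with a kink that bounds a monogon; the sign of the crossing depends on the
parity of `o`. -/
def kink (o : Fin 4) : TangleDiagram (Fin 2) where
  C := Fin 1
  B := Empty
  edge := Equiv.swap (en 0) (cr 0 o) * Equiv.swap (cr 0 (1 + o)) (cr 0 (2 + o)) *
    Equiv.swap (cr 0 (3 + o)) (en 1)
  edge_edge := by revert o; decide
  edge_ne := by revert o; decide

/-- Two strands, `0-1` and `2-3`, without crossings. -/
def twoStrands : TangleDiagram (Fin 4) where
  C := Fin 0
  B := Empty
  edge := Equiv.swap (en 0) (en 1) * Equiv.swap (en 2) (en 3)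
  edge_edge := by decide
  edge_ne := by decide

/-- Two strands that cross twice and bound a bigon, the strand `0-1` above the strand `2-3`. The
strand `2-3` runs from west to east; the half-edges `0, 1, 2, 3` of the western crossing `0` and
the eastern crossing `1` point west, south, east, north. -/
def bigon : TangleDiagram (Fin 4) where
  C := Fin 2
  B := Empty
  edge := Equiv.swap (en 2) (cr 0 0) * Equiv.swap (cr 0 2) (cr 1 0) * Equiv.swap (cr 1 2) (en 3) *
    Equiv.swap (en 0) (cr 0 3) * Equiv.swap (cr 0 1) (cr 1 1) * Equiv.swap (cr 1 3) (en 1)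
  edge_edge := by decide
  edge_ne := by decide

/-- The braid `σ₁ σ₂ σ₁` on three strands running from the bottom ends `0, 1, 2` to the top ends
`3, 4, 5`, with crossings `0, 1, 2` from bottom to top; the half-edges `o, 1 + o, 2 + o, 3 + o` of
each crossing point to `SW`, `SE`, `NE`, `NW`. (An odd `o` gives the inverse generators.) -/
def triangleLeft (o : Fin 4) : TangleDiagram (Fin 6) where
  C := Fin 3
  B := Empty
  edge := Equiv.swap (en 0) (cr 0 o) * Equiv.swap (en 1) (cr 0 (1 + o)) *
    Equiv.swap (cr 0 (3 + o)) (cr 2 o) * Equiv.swap (cr 0 (2 + o)) (cr 1 o) *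
    Equiv.swap (en 2) (cr 1 (1 + o)) * Equiv.swap (cr 1 (3 + o)) (cr 2 (1 + o)) *
    Equiv.swap (cr 1 (2 + o)) (en 5) * Equiv.swap (cr 2 (3 + o)) (en 3) *
    Equiv.swap (cr 2 (2 + o)) (en 4)
  edge_edge := by revert o; decide
  edge_ne := by revert o; decide

/-- The braid `σ₂ σ₁ σ₂`, with the same conventions. -/
def triangleRight (o : Fin 4) : TangleDiagram (Fin 6) where
  C := Fin 3
  B := Empty
  edge := Equiv.swap (en 1) (cr 0 o) * Equiv.swap (en 2) (cr 0 (1 + o)) *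
    Equiv.swap (en 0) (cr 1 o) * Equiv.swap (cr 0 (3 + o)) (cr 1 (1 + o)) *
    Equiv.swap (cr 0 (2 + o)) (cr 2 (1 + o)) * Equiv.swap (cr 1 (2 + o)) (cr 2 o) *
    Equiv.swap (cr 1 (3 + o)) (en 3) * Equiv.swap (cr 2 (3 + o)) (en 4) *
    Equiv.swap (cr 2 (2 + o)) (en 5)
  edge_edge := by revert o; decide
  edge_ne := by revert o; decide

end TangleDiagram

namespace LinkDiagram

/-- An isomorphism of diagrams: a bijection of the half-edges that respects the cyclic orders, the
edges and the over-strands. -/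
def IsIso (D D' : LinkDiagram) : Prop :=
  ∃ f : D.Dart ≃ D'.Dart, (∀ d, f (D.rot d) = D'.rot (f d)) ∧
    (∀ d, f (D.edge d) = D'.edge (f d)) ∧ ∀ d, D'.isOver (f d) = D.isOver d

/-- The half-edges of `D` and of a new marked point. The half-edge `d` changes places with the
half-edge `0` of the new point. -/
def subdivideDart (D : LinkDiagram) (d : D.Dart) :
    D.Dart ⊕ Fin 2 ≃ (D.C × Fin 4) ⊕ (Option D.B × Fin 2) :=
  (Equiv.swap (Sum.inl d) (Sum.inr 0)).trans
    { toFun := fun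
        | Sum.inl (Sum.inl q) => Sum.inl q
        | Sum.inl (Sum.inr (b, j)) => Sum.inr (some b, j)
        | Sum.inr j => Sum.inr (none, j)
      invFun := fun
        | Sum.inl q => Sum.inl (Sum.inl q)
        | Sum.inr (some b, j) => Sum.inl (Sum.inr (b, j))
        | Sum.inr (none, j) => Sum.inr j
      left_inv := by rintro ((q | ⟨b, j⟩) | j) <;> rfl
      right_inv := by rintro (q | ⟨_ | b, j⟩) <;> rfl }

/-- `D` with a new marked point on the edge that contains the half-edge `d`: its half-edge `1` is
joined to `d` and its half-edge `0` to the other half of that edge. -/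
def subdivide (D : LinkDiagram) (d : D.Dart) : LinkDiagram where
  C := D.C
  B := Option D.B
  edge := (D.subdivideDart d).permCongr (Equiv.sumCongr D.edge (Equiv.swap 0 1))
  edge_edge := permCongr_permCongr_apply _ _ (sumCongr_sumCongr_apply _ _ D.edge_edge (by decide))
  edge_ne := permCongr_apply_ne _ _ (sumCongr_apply_ne _ _ D.edge_ne (by decide))

/-- The elementary moves: isomorphisms, adding a marked point, and the Reidemeister moves. -/
inductive Move : LinkDiagram → LinkDiagram → Prop
  | iso {D D' : LinkDiagram} (h : D.IsIso D') : Move D D'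
  | subdivide (D : LinkDiagram) (d : D.Dart) : Move D (D.subdivide d)
  | reidemeister1 (N : TangleDiagram (Fin 2)) (o : Fin 4) :
      Move (N.glue (TangleDiagram.kink o)) (N.glue TangleDiagram.strand)
  | reidemeister2 (N : TangleDiagram (Fin 4)) :
      Move (N.glue TangleDiagram.bigon) (N.glue TangleDiagram.twoStrands)
  | reidemeister3 (N : TangleDiagram (Fin 6)) (o : Fin 4) :
      Move (N.glue (TangleDiagram.triangleLeft o)) (N.glue (TangleDiagram.triangleRight o))

/-- Two diagrams represent the same link: they are connected by finitely many elementary moves and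
their inverses through diagrams on the sphere. -/
def SameLink : LinkDiagram → LinkDiagram → Prop :=
  Relation.EqvGen fun D D' => D.Planar ∧ D'.Planar ∧ Move D D'

/-! ### Quasi-alternating links -/

/-- The circle without crossings, with one marked point. -/
def circle : LinkDiagram where
  C := Empty
  B := Unit
  edge := Equiv.swap (Sum.inr ((), 0)) (Sum.inr ((), 1))
  edge_edge := by decide
  edge_ne := by decide

/-- The link represented by the diagram is quasi-alternating. This is the smallest class of links
that contains the unknot and the link of every diagram `D` on the sphere with a crossing `c`, such
that the links of both smoothings at `c` are in the class and the determinant is additive. -/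
inductive LinkIsQuasiAlternating : LinkDiagram → Prop
  | unknot : LinkIsQuasiAlternating circle
  | crossing (D : LinkDiagram) (c : D.C) (planar : D.Planar)
      (zero : LinkIsQuasiAlternating (D.smoothZero c))
      (infty : LinkIsQuasiAlternating (D.smoothInfty c))
      (add : D.det = (D.smoothZero c).det + (D.smoothInfty c).det) :
      LinkIsQuasiAlternating D
  | sameLink (D D' : LinkDiagram) (h : SameLink D D') (hD : LinkIsQuasiAlternating D) :
      LinkIsQuasiAlternating D'

/-- `D` is a diagram on the sphere and `c` is a quasi-alternating crossing of it. -/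
def IsQuasiAlternatingAt (D : LinkDiagram) (c : D.C) : Prop :=
  D.Planar ∧ LinkIsQuasiAlternating (D.smoothZero c) ∧ LinkIsQuasiAlternating (D.smoothInfty c) ∧
    D.det = (D.smoothZero c).det + (D.smoothInfty c).det

end LinkDiagram

/-! ### Orbits of permutation groups, transpositions, and the genus of a combinatorial map -/

section Orbits

variable {X Y : Type}

/-! Put `A = exp(iπ/4)`. Then `-A^2 - A^(-2) = 0`, so in the bracket only the states with a single
circle survive; these are the spanning trees of the checkerboard graph. For an alternating diagram
they all contribute the same power of `A`, because all spanning trees have equally many edges, so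
the determinant counts them (`IsAltColoring.det_eq_card`). Both smoothings of a dealternator `c` are
alternating, and comparing their tree states inside one colouring of `D` also fixes their relative
phase: with `q = det(D_0)` and `p = det(D_∞)` there is a unit `u` such that the brackets of `D_0`
and `D_∞` are `q u A^2` and `p u` (`IsDealtColoring.bracket_smooth`). The skein relation gives `⟨D⟩
= (q - p) u A^3`, so `det(D) = |p - q|`.

Suppose `q > p`, and let `E` be the extension by `-1/2`. At either new crossing one smoothing gives
back `D` up to marked points (`splices_double`), and the other gives `D_0` with a kink
(`sameLink_smooth_double`). The skein relation yields `⟨E⟩ = ⟨D_0⟩ + A^(-1)⟨D⟩ = (2q - p) u A^2`: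
the two terms have the same phase, so `det(E) = q + (q - p) = det(D_0) + det(D)`. The link of `D` is
quasi-alternating by hypothesis, and so is that of `D_0`, which is alternating with nonzero
determinant. The case `p > q` is the same with `⟨E⟩ = ⟨D_∞⟩ + A⟨D⟩ = (2p - q) u`.

That a planar alternating diagram of nonzero determinant represents a quasi-alternating link is
`IsAltColoring.linkIsQuasiAlternating`. If both smoothings at some crossing have tree states,
induction applies, as the determinant is additive. Otherwise there is only one tree state; no two
chords of its circle interlace, so some chord is isolated, and its crossing is a kink that the first
Reidemeister move removes.

Planarity is handled by permutations. The genus of a pair of permutations is nonnegative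
(`le_mapDefect`), hence splitting a vertex keeps planarity; the same principle, applied to
half-edges of one colour, gives the edge count of spanning trees. Smoothing and gluing create marked
points, and `Splices` records their removal in a form compatible with further smoothings. -/

/-- Two points are linked by `S` if they are in the same orbit of the group generated by `S`. -/
def linkedSetoid (S : Set (Equiv.Perm X)) : Setoid X :=
  MulAction.orbitRel (Subgroup.closure S) X

theorem orbitCount_eq_card (S : Set (Equiv.Perm X)) :
    orbitCount S = Nat.card (Quotient (linkedSetoid S)) := rfl

theorem linked_apply {S : Set (Equiv.Perm X)} {σ : Equiv.Perm X} (hσ : σ ∈ S) (x : X) :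
    linkedSetoid S x (σ x) := by
  refine Setoid.symm' _ ?_
  exact ⟨⟨σ, Subgroup.subset_closure hσ⟩, rfl⟩

/-- Being linked is the least equivalence relation containing all pairs `x, σ x`; inverses of
generators are covered by symmetry. This replaces the group by its generators throughout. -/
theorem linkedSetoid_le {S : Set (Equiv.Perm X)} {t : Setoid X}
    (h : ∀ σ ∈ S, ∀ x, t x (σ x)) : linkedSetoid S ≤ t := by
  have key : ∀ g ∈ Subgroup.closure S, ∀ y, t (g y) y := fun g hg => by
    induction hg using Subgroup.closure_induction with
    | mem σ hσ => exact fun y => t.symm (h σ hσ y)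
    | one => exact fun y => t.refl y
    | mul f g _ _ hf hg => exact fun y => t.trans (hf (g y)) (hg y)
    | inv f _ hf => exact fun y => by simpa using t.symm (hf (f⁻¹ y))
  rintro x y ⟨⟨g, hg⟩, rfl⟩
  exact key g hg y

theorem linked_self (σ : Equiv.Perm X) (x : X) : linkedSetoid {σ} x (σ x) :=
  linked_apply (Set.mem_singleton σ) x

theorem linkedSetoid_mono {S T : Set (Equiv.Perm X)}
    (h : ∀ σ ∈ S, ∀ x, linkedSetoid T x (σ x)) {x y : X} (hxy : linkedSetoid S x y) :
    linkedSetoid T x y := linkedSetoid_le h hxy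

theorem linked_map {S : Set (Equiv.Perm X)} {T : Set (Equiv.Perm Y)} (f : X → Y)
    (h : ∀ σ ∈ S, ∀ x, linkedSetoid T (f x) (f (σ x))) {x y : X} (hxy : linkedSetoid S x y) :
    linkedSetoid T (f x) (f y) :=
  linkedSetoid_le (t := (linkedSetoid T).comap f) h hxy

/-- On a finite set, an injection mapping `U` into itself maps it onto itself, so forward stability
already gives stability under inverses. -/
theorem mem_of_linked {S : Set (Equiv.Perm X)} [Finite X] {U : Set X}
    (h : ∀ σ ∈ S, ∀ x ∈ U, σ x ∈ U) {x y : X} (hxy : linkedSetoid S x y) (hx : x ∈ U) :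
    y ∈ U := by
  have key : linkedSetoid S ≤ Setoid.ker (· ∈ U) := linkedSetoid_le fun σ hσ z => by
    rw [Setoid.ker_def, eq_iff_iff]
    refine ⟨h σ hσ z, fun hz => ?_⟩
    obtain ⟨⟨w, hw⟩, hwz⟩ : ∃ w : U, (⟨σ w, h σ hσ w w.2⟩ : U) = ⟨σ z, hz⟩ :=
      Finite.surjective_of_injective (f := fun w : U => (⟨σ w, h σ hσ w w.2⟩ : U))
        (fun a b hab => Subtype.ext (σ.injective (congrArg Subtype.val hab))) ⟨σ z, hz⟩
    have : w = z := σ.injective (congrArg Subtype.val hwz)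
    exact this ▸ hw
  have := key hxy
  rw [Setoid.ker_def, eq_iff_iff] at this
  exact this.1 hx

/-- The maps need to be mutually inverse only up to linking, so that sets of different sizes can be
compared, such as a diagram and its subdivision or all half-edges and those of one colour. -/
theorem orbitCount_congr {S : Set (Equiv.Perm X)} {T : Set (Equiv.Perm Y)} (f : X → Y)
    (g : Y → X) (hf : ∀ σ ∈ S, ∀ x, linkedSetoid T (f x) (f (σ x)))
    (hg : ∀ τ ∈ T, ∀ y, linkedSetoid S (g y) (g (τ y)))
    (hgf : ∀ x, linkedSetoid S (g (f x)) x) (hfg : ∀ y, linkedSetoid T (f (g y)) y) :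
    orbitCount S = orbitCount T := by
  refine Nat.card_congr ⟨Quotient.map f fun _ _ h => linked_map f hf h,
    Quotient.map g fun _ _ h => linked_map g hg h, ?_, ?_⟩
  · rintro ⟨x⟩
    exact Quotient.sound (hgf x)
  · rintro ⟨y⟩
    exact Quotient.sound (hfg y)

theorem orbitCount_conj_single (e : X ≃ Y) {σ : Equiv.Perm X} {τ : Equiv.Perm Y}
    (h : ∀ x, e (σ x) = τ (e x)) : orbitCount {σ} = orbitCount {τ} := by
  refine orbitCount_congr e e.symm ?_ ?_ (fun x => by simp) (fun y => by simp)
  · rintro _ rfl x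
    exact h x ▸ linked_self _ _
  · rintro _ rfl y
    obtain ⟨x, rfl⟩ := e.surjective y
    rw [← h, Equiv.symm_apply_apply, Equiv.symm_apply_apply]
    exact linked_self _ _

theorem linked_pair_left (α β : Equiv.Perm X) (x : X) : linkedSetoid {α, β} x (α x) :=
  linked_apply (by simp) x

theorem linked_pair_right (α β : Equiv.Perm X) (x : X) : linkedSetoid {α, β} x (β x) :=
  linked_apply (by simp) x

theorem orbitCount_conj_pair (e : X ≃ Y) {σ σ' : Equiv.Perm X} {τ τ' : Equiv.Perm Y}
    (h : ∀ x, e (σ x) = τ (e x)) (h' : ∀ x, e (σ' x) = τ' (e x)) :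
    orbitCount {σ, σ'} = orbitCount {τ, τ'} := by
  refine orbitCount_congr e e.symm ?_ ?_ (fun x => by simp) (fun y => by simp)
  · rintro _ (rfl | rfl) x
    · exact h x ▸ linked_pair_left _ _ _
    · exact h' x ▸ linked_pair_right _ _ _
  · rintro _ (rfl | rfl) y <;> obtain ⟨x, rfl⟩ := e.surjective y
    · rw [← h, Equiv.symm_apply_apply, Equiv.symm_apply_apply]
      exact linked_pair_left _ _ _
    · rw [← h', Equiv.symm_apply_apply, Equiv.symm_apply_apply]
      exact linked_pair_right _ _ _

theorem orbitCount_pair_one (σ : Equiv.Perm X) : orbitCount {1, σ} = orbitCount {σ} := by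
  refine orbitCount_congr id id ?_ ?_ (fun x => Setoid.refl' _ x) (fun x => Setoid.refl' _ x)
  · rintro τ (rfl | rfl) x
    · exact Setoid.refl' _ x
    · exact linked_self _ x
  · rintro τ rfl x
    exact linked_apply (by simp) x

theorem orbitCount_one : orbitCount {(1 : Equiv.Perm X)} = Nat.card X := by
  refine Nat.card_congr ⟨Quotient.lift id fun a b h => ?_, Quotient.mk _, ?_, fun x => rfl⟩
  · have : linkedSetoid {(1 : Equiv.Perm X)} ≤ ⊥ := linkedSetoid_le fun σ hσ x => by
      rw [Set.mem_singleton_iff.1 hσ]; rfl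
    exact this h
  · rintro ⟨x⟩
    rfl

theorem orbitCount_eq_one_iff [Nonempty X] {S : Set (Equiv.Perm X)} :
    orbitCount S = 1 ↔ ∀ x y, linkedSetoid S x y := by
  rw [orbitCount_eq_card, Nat.card_eq_one_iff_unique]
  constructor
  · rintro ⟨h, -⟩ x y
    exact Quotient.exact (h.elim (Quotient.mk _ x) (Quotient.mk _ y))
  · refine fun h => ⟨⟨?_⟩, Nonempty.map (Quotient.mk _) inferInstance⟩
    rintro ⟨x⟩ ⟨y⟩
    exact Quotient.sound (h x y)

theorem orbitCount_pos [Finite X] [Nonempty X] (S : Set (Equiv.Perm X)) : 0 < orbitCount S := by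
  rw [orbitCount_eq_card]
  have : Nonempty (Quotient (linkedSetoid S)) := Nonempty.map (Quotient.mk _) inferInstance
  exact Nat.card_pos

/-- Merging two classes of an equivalence relation. -/
theorem card_quotient_merge [Finite X] {r r' : Setoid X} {a b : X} (hab : ¬ r a b) (hr : r ≤ r')
    (hab' : r' a b) (hmin : ∀ t : Setoid X, r ≤ t → t a b → r' ≤ t) :
    Nat.card (Quotient r) = Nat.card (Quotient r') + 1 := by
  classical
  -- `f` redirects the class of `b` to the class of `a`: its kernel is `r'`, and its range omits
  -- exactly the class of `b`.
  set f : X → Quotient r := fun x =>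
    if (Quotient.mk r x) = Quotient.mk r b then Quotient.mk r a else Quotient.mk r x with hf
  have hne : Quotient.mk r a ≠ Quotient.mk r b := fun h => hab (Quotient.exact h)
  have hker : r' = Setoid.ker f := by
    apply le_antisymm
    · refine hmin _ (fun x y hxy => ?_) ?_
      · have : Quotient.mk r x = Quotient.mk r y := Quotient.sound hxy
        rw [Setoid.ker_def, hf]
        simp only [this]
      · rw [Setoid.ker_def, hf]
        simp
    · intro x y hxy
      rw [Setoid.ker_def, hf] at hxy
      simp only at hxy
      split_ifs at hxy with h1 h2 h2
      · exact hr (Quotient.exact (h1.trans h2.symm))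
      · exact r'.trans (hr (Quotient.exact h1)) (r'.trans (r'.symm hab') (hr (Quotient.exact hxy)))
      · exact r'.trans (hr (Quotient.exact hxy)) (r'.trans hab' (hr (Quotient.exact h2.symm)))
      · exact hr (Quotient.exact hxy)
  have hrange : Set.range f = {Quotient.mk r b}ᶜ := by
    ext q
    constructor
    · rintro ⟨x, rfl⟩
      simp only [hf, Set.mem_compl_iff, Set.mem_singleton_iff]
      split_ifs with h
      · exact hne
      · exact h
    · induction q using Quotient.inductionOn with
      | h x =>
        intro h
        exact ⟨x, if_neg h⟩
  rw [hker, Nat.card_congr (Setoid.quotientKerEquivRange f), hrange]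
  have := Set.ncard_add_ncard_compl ({Quotient.mk r b} : Set (Quotient r))
  rw [Set.ncard_singleton, ← Nat.card_coe_set_eq ({Quotient.mk r b}ᶜ : Set (Quotient r))] at this
  omega

variable [DecidableEq X] [Finite X]

/-- Multiplying by a transposition of two points in different cycles joins the cycles. -/
theorem linked_swap_mul {σ : Equiv.Perm X} {a b : X} (h : ¬ linkedSetoid {σ} a b) :
    linkedSetoid {Equiv.swap a b * σ} a b := by
  obtain ⟨m, hm, hper⟩ : ∃ m, 0 < m ∧ (σ ^ m) a = a :=
    ⟨orderOf σ, orderOf_pos σ, by simp [pow_orderOf_eq_one]⟩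
  classical
  have hex : ∃ m, 0 < m ∧ (σ ^ m) a = a := ⟨m, hm, hper⟩
  obtain ⟨hm, hper⟩ := Nat.find_spec hex
  have hmin : ∀ i, 0 < i → i < Nat.find hex → (σ ^ i) a ≠ a := fun i hi hlt he =>
    Nat.find_min hex hlt ⟨hi, he⟩
  generalize Nat.find hex = n at *
  have hlink : ∀ i : ℕ, linkedSetoid {σ} a ((σ ^ i) a) := by
    intro i
    induction i with
    | zero => exact Setoid.refl' _ a
    | succ i ih =>
      rw [pow_succ', Equiv.Perm.mul_apply]
      exact Setoid.trans' _ ih (linked_self _ _)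
  -- Before its first return to `a` the `σ`-orbit of `a` meets neither `a` nor `b`, so the
  -- transposition does not alter it. The returning step, number `n`, is then redirected to `b`.
  have hpow : ∀ i, i < n → linkedSetoid {Equiv.swap a b * σ} a ((σ ^ i) a) := by
    intro i
    induction i with
    | zero => exact fun _ => Setoid.refl' _ a
    | succ i ih =>
      intro hi
      refine Setoid.trans' _ (ih (by omega)) ?_
      have h1 := linked_self (Equiv.swap a b * σ) ((σ ^ i) a)
      rw [Equiv.Perm.mul_apply, ← Equiv.Perm.mul_apply, ← Equiv.Perm.mul_apply, mul_assoc,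
        ← pow_succ', Equiv.Perm.mul_apply, Equiv.swap_apply_of_ne_of_ne (hmin _ (by omega) hi)] at h1
      · exact h1
      · intro hb
        exact h (hb ▸ hlink (i + 1))
  obtain ⟨k, rfl⟩ : ∃ k, n = k + 1 := ⟨n - 1, by omega⟩
  refine Setoid.trans' _ (hpow k (by omega)) ?_
  have h1 := linked_self (Equiv.swap a b * σ) ((σ ^ k) a)
  rwa [Equiv.Perm.mul_apply, ← Equiv.Perm.mul_apply, ← Equiv.Perm.mul_apply, mul_assoc,
        ← pow_succ', Equiv.Perm.mul_apply, hper, Equiv.swap_apply_left] at h1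

-- The transposition changes the image of `x` only when it is `a` or `b`, and `t` identifies these
-- two.
omit [Finite X] in
theorem linked_of_swap_mul {σ : Equiv.Perm X} {T : Set (Equiv.Perm X)} {a b : X}
    (hσ : σ ∈ T) (t : Setoid X) (h : linkedSetoid T ≤ t) (hab : t a b) (x : X) :
    t x ((Equiv.swap a b * σ) x) := by
  refine t.trans (h (linked_apply hσ x)) ?_
  rw [Equiv.Perm.mul_apply]
  rcases eq_or_ne (σ x) a with ha | ha
  · rw [ha, Equiv.swap_apply_left]
    exact hab
  rcases eq_or_ne (σ x) b with hb | hb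
  · rw [hb, Equiv.swap_apply_right]
    exact t.symm hab
  rw [Equiv.swap_apply_of_ne_of_ne ha hb]

theorem orbitCount_swap_mul_of_not_linked {σ : Equiv.Perm X} {a b : X}
    (h : ¬ linkedSetoid {σ} a b) :
    orbitCount {σ} = orbitCount {Equiv.swap a b * σ} + 1 := by
  refine card_quotient_merge h (linkedSetoid_le ?_) (linked_swap_mul h) fun t hr hab =>
    linkedSetoid_le ?_
  · rintro τ rfl x
    have h1 := linked_of_swap_mul (T := {Equiv.swap a b * τ}) (a := a) (b := b) (Set.mem_singleton _) _ le_rfl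
      (linked_swap_mul h) x
    rwa [← mul_assoc, Equiv.swap_mul_self, one_mul] at h1
  · rintro τ rfl x
    exact linked_of_swap_mul (Set.mem_singleton _) t hr hab x

/-- The part of a cycle before its return to `a` or arrival at `b` is closed under
`swap a b * σ` . -/
theorem not_linked_of_arc {σ : Equiv.Perm X} {a b c d : X} {k : ℕ} (hk : (σ ^ k) a = b)
    (hc : ∃ i < k, (σ ^ i) a = c) (hd : ∀ i < k, (σ ^ i) a ≠ d)
    (hb : ∀ i, 0 < i → i < k → (σ ^ i) a ≠ b ∧ (σ ^ i) a ≠ a) :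
    ¬ linkedSetoid {Equiv.swap a b * σ} c d := by
  intro h
  have key := mem_of_linked (U := {x | ∃ i < k, (σ ^ i) a = x}) ?_ h hc
  · obtain ⟨i, hi, he⟩ := key
    exact hd i hi he
  · rintro τ rfl x ⟨i, hi, rfl⟩
    rw [Equiv.Perm.mul_apply, ← Equiv.Perm.mul_apply σ, ← pow_succ']
    by_cases hik : i + 1 = k
    · rw [hik, hk, Equiv.swap_apply_right]
      exact ⟨0, by omega, rfl⟩
    · have := hb (i + 1) (by omega) (by omega)
      rw [Equiv.swap_apply_of_ne_of_ne this.2 this.1]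
      exact ⟨i + 1, by omega, rfl⟩

omit [DecidableEq X] in
theorem exists_pow_of_linked {σ : Equiv.Perm X} {a b : X} (h : linkedSetoid {σ} a b) :
    ∃ k : ℕ, (σ ^ k) a = b :=
  mem_of_linked (U := {x | ∃ k : ℕ, (σ ^ k) a = x})
    (by rintro τ rfl x ⟨k, rfl⟩; exact ⟨k + 1, by rw [pow_succ', Equiv.Perm.mul_apply]⟩) h ⟨0, rfl⟩

theorem not_linked_swap_mul {σ : Equiv.Perm X} {a b : X} (hab : a ≠ b)
    (h : linkedSetoid {σ} a b) : ¬ linkedSetoid {Equiv.swap a b * σ} a b := by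
  classical
  have hex := exists_pow_of_linked h
  have hk := Nat.find_spec hex
  have hmin : ∀ i < Nat.find hex, (σ ^ i) a ≠ b := fun i hi => Nat.find_min hex hi
  generalize Nat.find hex = k at *
  have hk0 : k ≠ 0 := by
    rintro rfl
    exact hab hk
  refine not_linked_of_arc hk ⟨0, by omega, rfl⟩ hmin fun i hi hik => ⟨hmin i hik, fun he => ?_⟩
  -- An early return to `a` would shorten the way from `a` to `b`, against the minimality of `k`.
  apply hmin (k - i) (by omega)
  rw [← hk]
  conv_rhs => rw [show k = k - i + i by omega, pow_add, Equiv.Perm.mul_apply, he]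

theorem orbitCount_swap_mul_of_linked {σ : Equiv.Perm X} {a b : X} (hab : a ≠ b)
    (h : linkedSetoid {σ} a b) :
    orbitCount {Equiv.swap a b * σ} = orbitCount {σ} + 1 := by
  have := orbitCount_swap_mul_of_not_linked (not_linked_swap_mul hab h)
  rwa [← mul_assoc, Equiv.swap_mul_self, one_mul] at this

/-- The number `2 k - V - F` for the map with vertex permutation `α`, where `k` counts the
components and `F` the faces. -/
noncomputable def mapDefect (α β : Equiv.Perm X) : ℤ :=
  2 * orbitCount {α, β} - orbitCount {α} - orbitCount {α * β}

/-- Joining the vertices of `a` and `b` produces the least coarsening of the components that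
identifies `a` and `b`. These are the hypotheses of `card_quotient_merge`. -/
theorem linked_swap_pair {α β : Equiv.Perm X} {a b : X} (h : ¬ linkedSetoid {α} a b) :
    linkedSetoid {α, β} ≤ linkedSetoid {Equiv.swap a b * α, β} ∧
      linkedSetoid {Equiv.swap a b * α, β} a b ∧
      ∀ t : Setoid X, linkedSetoid {α, β} ≤ t → t a b →
        linkedSetoid {Equiv.swap a b * α, β} ≤ t := by
  have hab : linkedSetoid {Equiv.swap a b * α, β} a b :=
    linkedSetoid_mono (S := {Equiv.swap a b * α}) (by rintro τ rfl x; exact linked_pair_left _ _ x)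
      (linked_swap_mul h)
  refine ⟨linkedSetoid_le ?_, hab, fun t ht htab => linkedSetoid_le ?_⟩
  · rintro τ (rfl | rfl) x
    · have h1 := linked_of_swap_mul (T := {Equiv.swap a b * τ, β}) (σ := Equiv.swap a b * τ)
        (a := a) (b := b) (by simp) _ le_rfl hab x
      rwa [← mul_assoc, Equiv.swap_mul_self, one_mul] at h1
    · exact linked_pair_right _ _ x
  · rintro τ (rfl | rfl) x
    · exact linked_of_swap_mul (by simp) t ht htab x
    · exact ht (linked_pair_right _ _ x)

/-- Joining two vertices across a common face removes one vertex and cuts that face in two. A face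
lies in a single component, so the components stay the same. -/
theorem mapDefect_swap_mul_of_linked {α β : Equiv.Perm X} {a b : X} (hab : a ≠ b)
    (h : ¬ linkedSetoid {α} a b) (h' : linkedSetoid {α * β} a b) :
    mapDefect (Equiv.swap a b * α) β = mapDefect α β := by
  have h1 := orbitCount_swap_mul_of_not_linked h
  have h2 := orbitCount_swap_mul_of_linked hab h'
  obtain ⟨h3, h4, h5⟩ := linked_swap_pair (β := β) h
  have h6 : linkedSetoid {Equiv.swap a b * α, β} = linkedSetoid {α, β} := by
    refine le_antisymm (h5 _ le_rfl (linkedSetoid_mono ?_ h')) h3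
    rintro τ rfl x
    rw [Equiv.Perm.mul_apply]
    exact Setoid.trans' _ (linked_pair_right α β x) (linked_pair_left α β _)
  have h7 : orbitCount {Equiv.swap a b * α, β} = orbitCount {α, β} := by
    rw [orbitCount_eq_card, orbitCount_eq_card, h6]
  rw [← mul_assoc] at h2
  unfold mapDefect
  rw [h2, h7, h1]
  push_cast
  ring

/-- When `a` and `b` lie on different faces, vertices and faces both drop by one while the
components drop by at most one, so `2 k - V - F` cannot decrease. -/
theorem mapDefect_le_swap_mul {α β : Equiv.Perm X} {a b : X}
    (h : ¬ linkedSetoid {α} a b) : mapDefect α β ≤ mapDefect (Equiv.swap a b * α) β := by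
  have hab : a ≠ b := fun e => h (e ▸ Setoid.refl' _ a)
  by_cases h' : linkedSetoid {α * β} a b
  · exact (mapDefect_swap_mul_of_linked hab h h').ge
  have h1 := orbitCount_swap_mul_of_not_linked h
  have h2 := orbitCount_swap_mul_of_not_linked h'
  obtain ⟨h3, h4, h5⟩ := linked_swap_pair (β := β) h
  have h6 : orbitCount {α, β} ≤ orbitCount {Equiv.swap a b * α, β} + 1 := by
    by_cases h7 : linkedSetoid {α, β} a b
    · have h6 : linkedSetoid {Equiv.swap a b * α, β} = linkedSetoid {α, β} :=
        le_antisymm (h5 _ le_rfl h7) h3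
      rw [orbitCount_eq_card, orbitCount_eq_card, h6]
      omega
    · exact (card_quotient_merge h7 h3 h4 h5).le
  rw [← mul_assoc] at h2
  unfold mapDefect
  rw [h1, h2]
  push_cast
  have : (orbitCount {α, β} : ℤ) ≤ orbitCount {Equiv.swap a b * α, β} + 1 := by exact_mod_cast h6
  linarith

omit [DecidableEq X] [Finite X] in
theorem mapDefect_one (β : Equiv.Perm X) :
    mapDefect 1 β = orbitCount {β} - Nat.card X := by
  unfold mapDefect
  rw [orbitCount_pair_one, orbitCount_one, one_mul]
  ring

omit [DecidableEq X] in
theorem orbitCount_le_card (S : Set (Equiv.Perm X)) : orbitCount S ≤ Nat.card X :=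
  Nat.card_le_card_of_surjective _ (Quotient.mk_surjective (s := linkedSetoid S))

/-- The genus of a map is nonnegative. -/
theorem le_mapDefect (α β : Equiv.Perm X) : orbitCount {β} - Nat.card X ≤ mapDefect α β := by
  induction hn : Nat.card X - orbitCount {α} using Nat.strong_induction_on generalizing α with
  | _ n ih =>
    by_cases h1 : α = 1
    · rw [h1, mapDefect_one]
    -- Detach a point from its cycle: the number of cycles rises and the defect does not. The
    -- process ends at the identity, where the defect equals the bound.
    · obtain ⟨a, ha⟩ : ∃ a, a ≠ α a := by
        by_contra! hc
        exact h1 (Equiv.ext fun x => (hc x).symm)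
      have hl : linkedSetoid {α} a (α a) := linked_self α a
      have h2 := orbitCount_swap_mul_of_linked ha hl
      have h3 := mapDefect_le_swap_mul (β := β) (not_linked_swap_mul ha hl)
      rw [← mul_assoc, Equiv.swap_mul_self, one_mul] at h3
      have h4 := orbitCount_le_card {Equiv.swap a (α a) * α}
      exact (ih _ (by omega) _ rfl).trans h3

/-- If a map is planar then so is the map obtained by splitting a vertex. -/
theorem mapDefect_eq_of_swap_mul {α β : Equiv.Perm X} {a b : X} (h : ¬ linkedSetoid {α} a b)
    (hp : mapDefect (Equiv.swap a b * α) β = orbitCount {β} - Nat.card X) :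
    mapDefect α β = orbitCount {β} - Nat.card X :=
  le_antisymm (hp ▸ mapDefect_le_swap_mul h) (le_mapDefect α β)

end Orbits


/-! ### Fixed point free involutions -/

section Involutions

variable {X : Type}

theorem linked_involution_iff {e : Equiv.Perm X} (he : ∀ x, e (e x) = x) {x y : X} :
    linkedSetoid {e} x y ↔ y = x ∨ y = e x := by
  constructor
  · intro h
    have : linkedSetoid {e} ≤ (⟨fun x y => y = x ∨ y = e x, fun x => Or.inl rfl, ?_, ?_⟩ : Setoid X) :=
      linkedSetoid_le ?_
    · exact this h
    · rintro x y (rfl | rfl)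
      · exact Or.inl rfl
      · exact Or.inr (he x).symm
    · rintro x y z (rfl | rfl) (rfl | rfl)
      · exact Or.inl rfl
      · exact Or.inr rfl
      · exact Or.inr rfl
      · exact Or.inl (he x)
    · rintro σ rfl x
      exact Or.inr rfl
  · rintro (rfl | rfl)
    · exact Setoid.refl' _ _
    · exact linked_self e x

theorem card_eq_two_mul_orbitCount [Finite X] {e : Equiv.Perm X} (he : ∀ x, e (e x) = x)
    (hne : ∀ x, e x ≠ x) : Nat.card X = 2 * orbitCount {e} := by
  classical
  rw [orbitCount_eq_card, Nat.card_congr (Equiv.sigmaFiberEquiv (Quotient.mk (linkedSetoid {e}))).symm]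
  have := Fintype.ofFinite (Quotient (linkedSetoid {e}))
  rw [Nat.card_sigma]
  have hq : ∀ q : Quotient (linkedSetoid {e}),
      Nat.card {x // Quotient.mk (linkedSetoid {e}) x = q} = 2 := by
    rintro ⟨x⟩
    have hs : {y | Quotient.mk (linkedSetoid {e}) y = Quotient.mk _ x} = {x, e x} := by
      ext y
      rw [Set.mem_ofPred_eq, Quotient.eq, Setoid.comm', linked_involution_iff he]
      rfl
    have h2 := Set.ncard_pair (hne x).symm
    rw [← hs] at h2
    exact h2
  rw [Finset.sum_congr rfl fun q _ => hq q, Finset.sum_const, Finset.card_univ, smul_eq_mul,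
    Nat.card_eq_fintype_card, mul_comm]

end Involutions

/-! ### Smoothings: the skein relation and planarity -/

namespace LinkDiagram

variable (D : LinkDiagram)

theorem card_dart : (Nat.card D.Dart : ℤ) = 2 * orbitCount {D.edge} := by
  exact_mod_cast card_eq_two_mul_orbitCount D.edge_edge D.edge_ne

/-- There are `2 E` half-edges, so `V - E + F = 2 K` says that the defect is `-E`, the least value
allowed by `le_mapDefect`. -/
theorem planar_iff_mapDefect :
    D.Planar ↔ mapDefect D.rot D.edge = orbitCount {D.edge} - Nat.card D.Dart := by
  rw [card_dart, mapDefect, Planar]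
  omega

/-- The pairing of the half-edges of a crossing in the smoothings `0` and `∞`. -/
def smoothPairing (infinite : Bool) : Equiv.Perm (Fin 4) := if infinite then pairB else pairA

theorem smoothPairing_not_eq (b : Bool) : smoothPairing (!b) = if b then pairA else pairB := by
  cases b <;> rfl

/-- The half-edges of `D` as half-edges of a smoothing. -/
def smoothEquiv (c : D.C) (b : Bool) : D.Dart ≃ (D.smooth c b).Dart := D.smoothDart c b

/-- The marked point on an arc replacing the crossing. -/
def arcMark (c : D.C) (b : Bool) (q : Fin 2) : (D.smooth c b).B := Sum.inr q

/-- A marked point of `D` in the smoothing. -/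
def oldMark (c : D.C) (b : Bool) (q : D.B) : (D.smooth c b).B := Sum.inl q

/-- A crossing of `D` in the smoothing. -/
def oldCrossing {c x : D.C} (h : x ≠ c) (b : Bool) : (D.smooth c b).C := ⟨x, h⟩

theorem smoothEquiv_self (c : D.C) (b : Bool) (i : Fin 4) : D.smoothEquiv c b (Sum.inl (c, i)) =
    Sum.inr (D.arcMark c b (arcEquiv b i).1, (arcEquiv b i).2) := by
  exact dif_pos rfl

theorem smoothEquiv_of_ne {c x : D.C} (h : x ≠ c) (b : Bool) (i : Fin 4) :
    D.smoothEquiv c b (Sum.inl (x, i)) = Sum.inl (D.oldCrossing h b, i) := by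
  exact dif_neg h

theorem smoothEquiv_inr (c : D.C) (b : Bool) (q : D.B) (j : Fin 2) :
    D.smoothEquiv c b (Sum.inr (q, j)) = Sum.inr (D.oldMark c b q, j) := rfl

theorem smooth_edge (c : D.C) (b : Bool) (d : D.Dart) :
    (D.smooth c b).edge (D.smoothEquiv c b d) = D.smoothEquiv c b (D.edge d) := by
  change (D.smoothDart c b).permCongr D.edge (D.smoothDart c b d) = _
  rw [Equiv.permCongr_apply, Equiv.symm_apply_apply]
  rfl

theorem arcEquiv_smoothPairing (b : Bool) (i : Fin 4) :
    arcEquiv b (smoothPairing b i) = ((arcEquiv b i).1, Equiv.swap 0 1 (arcEquiv b i).2) := by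
  revert b i; decide

theorem rot_inl (x : D.C) (i : Fin 4) : D.rot (Sum.inl (x, i)) = Sum.inl (x, i + 1) := by
  simp [rot]

theorem rot_inr (b : D.B) (j : Fin 2) : D.rot (Sum.inr (b, j)) = Sum.inr (b, j + 1) := by
  fin_cases j <;> rfl

theorem statePairing_inl (s : D.C → Bool) (x : D.C) (i : Fin 4) :
    D.statePairing s (Sum.inl (x, i)) = Sum.inl (x, smoothPairing (!s x) i) := by
  simp [statePairing, smoothPairing_not_eq]

theorem statePairing_inr (s : D.C → Bool) (b : D.B) (j : Fin 2) :
    D.statePairing s (Sum.inr (b, j)) = Sum.inr (b, j + 1) := by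
  fin_cases j <;> rfl

theorem swap_zero_one (j : Fin 2) : Equiv.swap 0 1 j = j + 1 := by
  revert j; decide

theorem smooth_statePairing {c : D.C} {b : Bool} {s : D.C → Bool} (hs : s c = !b)
    (d : D.Dart) : (D.smooth c b).statePairing (fun x => s x.1) (D.smoothEquiv c b d) =
      D.smoothEquiv c b (D.statePairing s d) := by
  rcases d with ⟨x, i⟩ | ⟨q, j⟩
  · rw [statePairing_inl]
    by_cases h : x = c
    · subst h
      rw [hs, Bool.not_not, smoothEquiv_self, smoothEquiv_self, arcEquiv_smoothPairing, swap_zero_one]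
      exact statePairing_inr _ _ _ _
    · rw [smoothEquiv_of_ne _ h, smoothEquiv_of_ne _ h]
      exact statePairing_inl _ _ _ _
  · rw [statePairing_inr, smoothEquiv_inr, smoothEquiv_inr]
    exact statePairing_inr _ _ _ _

theorem stateLoops_smooth {c : D.C} {b : Bool} {s : D.C → Bool} (hs : s c = !b) :
    (D.smooth c b).stateLoops (fun x => s x.1) = D.stateLoops s := by
  exact (orbitCount_conj_pair (D.smoothEquiv c b) (fun d => (D.smooth_edge c b d).symm)
    fun d => (D.smooth_statePairing hs d).symm).symm

/-- The states of a diagram in terms of the states of its smoothings. -/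
def stateEquiv (c : D.C) : (D.C → Bool) ≃ Bool × ({x // x ≠ c} → Bool) :=
  Equiv.funSplitAt c Bool

theorem stateEquiv_symm_self (c : D.C) (p : Bool × ({x // x ≠ c} → Bool)) :
    (D.stateEquiv c).symm p c = p.1 := by
  simp [stateEquiv]

theorem stateEquiv_symm_of_ne (c : D.C) (p : Bool × ({x // x ≠ c} → Bool)) :
    (fun x : {x // x ≠ c} => (D.stateEquiv c).symm p x.1) = p.2 := by
  ext x
  simp [stateEquiv, x.2]

theorem prod_state (c : D.C) (s : D.C → Bool) (A : ℂ) :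
    (∏ x, if s x then A else A⁻¹) =
      (if s c then A else A⁻¹) * ∏ x : {x // x ≠ c}, if s x.1 then A else A⁻¹ := by
  rw [Fintype.prod_eq_mul_prod_subtype_ne _ c]

/-- The skein relation of the Kauffman bracket. -/
theorem bracket_skein (c : D.C) (A : ℂ) : D.bracket A =
    A * (D.smoothZero c).bracket A + A⁻¹ * (D.smoothInfty c).bracket A := by
  have key : ∀ p : Bool × ({x // x ≠ c} → Bool),
      (∏ x, if (D.stateEquiv c).symm p x then A else A⁻¹) *
        (-A ^ 2 - (A⁻¹) ^ 2) ^ (D.stateLoops ((D.stateEquiv c).symm p) - 1) =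
      (if p.1 then A else A⁻¹) * ((∏ x, if p.2 x then A else A⁻¹) *
        (-A ^ 2 - (A⁻¹) ^ 2) ^ ((D.smooth c (!p.1)).stateLoops p.2 - 1)) := by
    intro p
    have h := D.stateLoops_smooth (c := c) (b := !p.1) (s := (D.stateEquiv c).symm p)
      (by rw [stateEquiv_symm_self, Bool.not_not])
    have h2 := D.stateEquiv_symm_of_ne c p
    rw [prod_state D c, stateEquiv_symm_self, ← h, mul_assoc]
    conv_rhs => rw [← h2]
    rfl
  rw [bracket, ← Equiv.sum_comp (D.stateEquiv c).symm]
  simp only [key]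
  rw [Fintype.sum_prod_type, Fintype.sum_bool]
  simp only [← Finset.mul_sum, if_true, Bool.false_eq_true, if_false]
  rfl

/-- The rotation of `D` with the vertex `c` split into the two marked points of a smoothing. -/
def splitRot (c : D.C) (b : Bool) : Equiv.Perm D.Dart :=
  Equiv.sumCongr (Equiv.prodCongrRight fun x => if x = c then smoothPairing b else finRotate 4)
    (Equiv.prodCongrRight fun _ => Equiv.swap 0 1)

theorem smooth_rot (c : D.C) (b : Bool) (d : D.Dart) :
    (D.smooth c b).rot (D.smoothEquiv c b d) = D.smoothEquiv c b (D.splitRot c b d) := by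
  rcases d with ⟨x, i⟩ | ⟨q, j⟩
  · by_cases h : x = c
    · subst h
      have : D.splitRot x b (Sum.inl (x, i)) = Sum.inl (x, smoothPairing b i) := by simp [splitRot]
      rw [this, smoothEquiv_self, smoothEquiv_self, arcEquiv_smoothPairing, swap_zero_one]
      exact rot_inr _ _ _
    · have : D.splitRot c b (Sum.inl (x, i)) = Sum.inl (x, i + 1) := by simp [splitRot, h]
      rw [this, smoothEquiv_of_ne _ h, smoothEquiv_of_ne _ h]
      exact rot_inl _ _ _
  · have : D.splitRot c b (Sum.inr (q, j)) = Sum.inr (q, j + 1) := by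
      simp [splitRot, swap_zero_one]
    rw [this, smoothEquiv_inr, smoothEquiv_inr]
    exact rot_inr _ _ _

/-- A corner between the two arcs of a smoothing. -/
def splitCorner (b : Bool) : Fin 4 := if b then 1 else 0

/-- A single transposition merges the two 2-cycles at `c` into the 4-cycle of the crossing.
Smoothing is thereby the splitting of a vertex, and the results on `mapDefect` apply. -/
theorem rot_eq_swap_mul_splitRot (c : D.C) (b : Bool) :
    D.rot = Equiv.swap (Sum.inl (c, splitCorner b)) (Sum.inl (c, splitCorner b + 2)) *
      D.splitRot c b := by
  ext1 d
  rw [Equiv.Perm.mul_apply]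
  rcases d with ⟨x, i⟩ | ⟨q, j⟩
  · by_cases h : x = c
    · subst h
      have h1 : D.splitRot x b (Sum.inl (x, i)) = Sum.inl (x, smoothPairing b i) := by
        simp [splitRot]
      have h2 : Equiv.swap (Sum.inl (x, splitCorner b) : D.Dart) (Sum.inl (x, splitCorner b + 2))
          (Sum.inl (x, smoothPairing b i)) = Sum.inl (x, Equiv.swap (splitCorner b)
            (splitCorner b + 2) (smoothPairing b i)) := by
        rw [Equiv.swap_apply_def, Equiv.swap_apply_def]
        simp only [Sum.inl.injEq, Prod.mk.injEq, true_and]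
        split_ifs <;> rfl
      rw [h1, h2, rot_inl]
      clear h1 h2
      congr 2
      revert b i; decide
    · have : D.splitRot c b (Sum.inl (x, i)) = Sum.inl (x, i + 1) := by simp [splitRot, h]
      rw [this, rot_inl, Equiv.swap_apply_of_ne_of_ne] <;> simp [h]
  · have : D.splitRot c b (Sum.inr (q, j)) = Sum.inr (q, j + 1) := by
      simp [splitRot, swap_zero_one]
    rw [this, rot_inr, Equiv.swap_apply_of_ne_of_ne] <;> simp

theorem not_linked_splitRot (c : D.C) (b : Bool) : ¬ linkedSetoid {D.splitRot c b}
    (Sum.inl (c, splitCorner b)) (Sum.inl (c, splitCorner b + 2)) := by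
  intro h
  have := mem_of_linked (U := {Sum.inl (c, splitCorner b),
    Sum.inl (c, smoothPairing b (splitCorner b))}) ?_ h (by simp)
  · revert this
    cases b <;> simp [splitCorner, smoothPairing, pairA, pairB] <;> decide
  · rintro σ rfl x (rfl | rfl)
    · right
      simp [splitRot]
    · left
      have : smoothPairing b (smoothPairing b (splitCorner b)) = splitCorner b := by
        clear h; revert b; decide
      simp [splitRot, this]

theorem planar_smooth_iff_splitRot (c : D.C) (b : Bool) : (D.smooth c b).Planar ↔
    mapDefect (D.splitRot c b) D.edge = orbitCount {D.edge} - Nat.card D.Dart := by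
  have hr := fun d => (D.smooth_rot c b d).symm
  have he := fun d => (D.smooth_edge c b d).symm
  have hre : ∀ d, D.smoothEquiv c b ((D.splitRot c b * D.edge) d) =
      ((D.smooth c b).rot * (D.smooth c b).edge) (D.smoothEquiv c b d) := fun d => by
    rw [Equiv.Perm.mul_apply, hr, he, Equiv.Perm.mul_apply]
  rw [planar_iff_mapDefect, mapDefect, mapDefect, orbitCount_conj_pair _ hr he,
    orbitCount_conj_single _ hr, orbitCount_conj_single _ hre, orbitCount_conj_single _ he,
    Nat.card_congr (D.smoothEquiv c b)]

theorem Planar.smooth {D : LinkDiagram} (h : D.Planar) (c : D.C) (b : Bool) :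
    (D.smooth c b).Planar := by
  rw [planar_iff_mapDefect, D.rot_eq_swap_mul_splitRot c b] at h
  rw [planar_smooth_iff_splitRot]
  exact mapDefect_eq_of_swap_mul (D.not_linked_splitRot c b) h

end LinkDiagram


/-! ### Permutations that exchange two colours -/

section ColorClasses

variable {X : Type} {o : X → Bool}

/-- The restriction of a permutation to the points of colour `true`. -/
def onColor (o : X → Bool) (σ : Equiv.Perm X) (h : ∀ x, o (σ x) = o x) :
    Equiv.Perm {x // o x = true} := σ.subtypePerm fun x => by rw [h]

theorem onColor_apply (σ : Equiv.Perm X) (h : ∀ x, o (σ x) = o x) (x : {x // o x = true}) :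
    ((onColor o σ h x : {x // o x = true}) : X) = σ x := rfl

theorem color_mul {r e : Equiv.Perm X} (hr : ∀ x, o (r x) = !o x) (he : ∀ x, o (e x) = !o x)
    (x : X) : o ((r * e) x) = o x := by
  rw [Equiv.Perm.mul_apply, hr, he, Bool.not_not]

theorem color_inv {r : Equiv.Perm X} (hr : ∀ x, o (r x) = !o x) (x : X) :
    o (r⁻¹ x) = !o x := by
  have := hr (r⁻¹ x)
  rw [show r (r⁻¹ x) = x from r.apply_symm_apply x] at this
  rw [this, Bool.not_not]

/-- The projection to the points of colour `true` along a permutation that exchanges colours. -/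
def toColor {r : Equiv.Perm X} (hr : ∀ x, o (r x) = !o x) (x : X) : {x // o x = true} :=
  if h : o x = true then ⟨x, h⟩ else ⟨r x, by rw [hr]; simpa using h⟩

theorem toColor_of_true {r : Equiv.Perm X} (hr : ∀ x, o (r x) = !o x) {x : X} (h : o x = true) :
    toColor hr x = ⟨x, h⟩ := dif_pos h

theorem toColor_of_false {r : Equiv.Perm X} (hr : ∀ x, o (r x) = !o x) {x : X}
    (h : o x = false) : toColor hr x = ⟨r x, by rw [hr, h]; rfl⟩ := dif_neg (by simp [h])

/-- Every orbit meets the colour `true`, since `r` exchanges colours. On that colour the even words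
in `r` and `e` act, and as `e` is an involution they are generated by `r * r` and `r * e`. -/
theorem orbitCount_pair_onColor {r e : Equiv.Perm X} (hr : ∀ x, o (r x) = !o x)
    (he : ∀ x, o (e x) = !o x) (hee : ∀ x, e (e x) = x) :
    orbitCount {r, e} =
      orbitCount {onColor o (r * r) (color_mul hr hr), onColor o (r * e) (color_mul hr he)} := by
  refine orbitCount_congr (toColor hr) Subtype.val ?_ ?_ ?_ ?_
  · rintro σ (rfl | rfl) x <;> cases h : o x
    · rw [toColor_of_false hr h, toColor_of_true hr (by rw [hr, h]; rfl)]
    · rw [toColor_of_true hr h, toColor_of_false hr (by rw [hr, h]; rfl)]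
      exact linked_pair_left _ _ (⟨x, h⟩ : {x // o x = true})
    · have h2 : o (σ x) = true := by rw [he, h]; rfl
      rw [toColor_of_false hr h, toColor_of_true hr h2]
      refine Setoid.symm' _ ?_
      convert linked_pair_right _ _ (⟨σ x, h2⟩ : {x // o x = true}) using 1
      refine Subtype.ext ?_
      rw [onColor_apply, Equiv.Perm.mul_apply, hee]
    · rw [toColor_of_true hr h, toColor_of_false hr (by rw [he, h]; rfl)]
      exact linked_pair_right _ _ (⟨x, h⟩ : {x // o x = true})
  · rintro σ (rfl | rfl) x
    · exact Setoid.trans' _ (linked_pair_left r e _) (linked_pair_left _ _ _)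
    · exact Setoid.trans' _ (linked_pair_right r e _) (linked_pair_left _ _ _)
  · intro x
    cases h : o x
    · rw [toColor_of_false hr h]
      exact Setoid.symm' _ (linked_pair_left _ _ _)
    · rw [toColor_of_true hr h]
  · intro x
    rw [toColor_of_true hr x.2]

theorem orbitCount_onColor_mul_self {r : Equiv.Perm X} (hr : ∀ x, o (r x) = !o x) :
    orbitCount {r} = orbitCount {onColor o (r * r) (color_mul hr hr)} := by
  refine orbitCount_congr (toColor hr) Subtype.val ?_ ?_ ?_ ?_
  · rintro σ rfl x
    cases h : o x
    · rw [toColor_of_false hr h, toColor_of_true hr (by rw [hr, h]; rfl)]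
    · rw [toColor_of_true hr h, toColor_of_false hr (by rw [hr, h]; rfl)]
      exact linked_self _ (⟨x, h⟩ : {x // o x = true})
  · rintro σ rfl x
    exact Setoid.trans' _ (linked_self r _) (linked_self _ _)
  · intro x
    cases h : o x
    · rw [toColor_of_false hr h]
      exact Setoid.symm' _ (linked_self _ _)
    · rw [toColor_of_true hr h]
  · intro x
    rw [toColor_of_true hr x.2]

theorem orbitCount_eq_card_color {e : Equiv.Perm X} (he : ∀ x, o (e x) = !o x)
    (hee : ∀ x, e (e x) = x) : orbitCount {e} = Nat.card {x // o x = true} := by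
  rw [orbitCount_onColor_mul_self he, ← orbitCount_one]
  congr 2
  ext1 x
  exact Subtype.ext (hee x)

/-- The cycles of `r * e` are monochromatic. Conjugation by `e` carries those of colour `false` to
the colour `true`, where they become the cycles of `r⁻¹ * e` run backwards. -/
theorem orbitCount_eq_add_onColor {r e : Equiv.Perm X} (hr : ∀ x, o (r x) = !o x)
    (he : ∀ x, o (e x) = !o x) (hee : ∀ x, e (e x) = x) [Finite X] :
    orbitCount {r * e} = orbitCount {onColor o (r * e) (color_mul hr he)} +
      orbitCount {onColor o (r⁻¹ * e) (color_mul (color_inv hr) he)} := by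
  set α := onColor o (r * e) (color_mul hr he)
  set β := onColor o (r⁻¹ * e) (color_mul (color_inv hr) he)
  rw [orbitCount_eq_card, orbitCount_eq_card, orbitCount_eq_card, ← Nat.card_sum]
  have hec : ∀ x, o x = false → o (e x) = true := fun x h => by rw [he, h]; rfl
  let f : X → Quotient (linkedSetoid {α}) ⊕ Quotient (linkedSetoid {β}) := fun x =>
    if h : o x = true then Sum.inl (Quotient.mk _ ⟨x, h⟩)
    else Sum.inr (Quotient.mk _ ⟨e x, hec x (by simpa using h)⟩)
  have hf : linkedSetoid {r * e} ≤ Setoid.ker f := linkedSetoid_le fun σ hσ x => by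
    rw [Set.mem_singleton_iff.1 hσ, Setoid.ker_def]
    by_cases h : o x = true
    · have h2 : o ((r * e) x) = true := by rw [color_mul hr he, h]
      simp only [f, dif_pos h, dif_pos h2]
      exact congrArg Sum.inl (Quotient.sound (linked_self α ⟨x, h⟩))
    · have h2 : ¬ o ((r * e) x) = true := by rwa [color_mul hr he]
      simp only [f, dif_neg h, dif_neg h2]
      refine congrArg Sum.inr (Quotient.sound (Setoid.symm' _ ?_))
      have h3 : o (e ((r * e) x)) = true := hec _ (by simpa using h2)
      convert linked_self β ⟨_, h3⟩ using 1
      refine Subtype.ext ?_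
      rw [onColor_apply]
      simp [hee]
  have hg : ∀ x y, linkedSetoid {β} x y → linkedSetoid {r * e} (e x.1) (e y.1) := fun x y h => by
    refine linked_map (fun z : {x // o x = true} => e z.1) ?_ h
    rintro σ rfl z
    refine Setoid.symm' _ ?_
    convert linked_self (r * e) (e (β z).1) using 1
    simp [β, onColor_apply, hee]
  refine Nat.card_congr ⟨Quotient.lift f fun x y h => hf h, Sum.elim
    (Quotient.map Subtype.val fun x y h => linked_map Subtype.val
      (by rintro σ rfl z; exact linked_self (r * e) z.1) h)
    (Quotient.map (fun z => e z.1) hg), ?_, ?_⟩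
  · rintro ⟨x⟩
    change Sum.elim _ _ (f x) = _
    by_cases h : o x = true
    · simp only [f, dif_pos h]
      rfl
    · simp only [f, dif_neg h]
      exact congrArg (Quotient.mk _) (hee x)
  · rintro (⟨⟨x, h⟩⟩ | ⟨⟨x, h⟩⟩)
    · exact dif_pos h
    · refine (dif_neg (by rw [he, h]; simp)).trans ?_
      refine congrArg Sum.inr (congrArg (Quotient.mk _) (Subtype.ext (hee x)))

end ColorClasses

/-! ### Checkerboard colourings and the edge count of spanning trees -/

namespace LinkDiagram

variable {D : LinkDiagram}

/-- A 2-colouring of the half-edges that alternates along the edges and around the vertices. -/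
structure IsColoring (D : LinkDiagram) (o : D.Dart → Bool) : Prop where
  edge : ∀ d, o (D.edge d) = !o d
  rot : ∀ d, o (D.rot d) = !o d

variable {o : D.Dart → Bool}

theorem IsColoring.inl (h : D.IsColoring o) (x : D.C) (i : Fin 4) :
    o (Sum.inl (x, i)) = if i = 1 ∨ i = 3 then o (Sum.inl (x, 1)) else !o (Sum.inl (x, 1)) := by
  have h' : ∀ i : Fin 4, o (Sum.inl (x, i + 1)) = !o (Sum.inl (x, i)) := fun i => by
    rw [← rot_inl, h.rot]
  have h0 : o (Sum.inl (x, 1)) = !o (Sum.inl (x, 0)) := h' 0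
  have h1 : o (Sum.inl (x, 2)) = !o (Sum.inl (x, 1)) := h' 1
  have h2 : o (Sum.inl (x, 3)) = !o (Sum.inl (x, 2)) := h' 2
  fin_cases i
  · simp [h0]
  · simp
  · simp [h1]
  · simp [h1, h2]

theorem IsColoring.inr (h : D.IsColoring o) (b : D.B) (j : Fin 2) :
    o (Sum.inr (b, j + 1)) = !o (Sum.inr (b, j)) := by
  rw [← rot_inr, h.rot]

theorem IsColoring.smoothPairing (h : D.IsColoring o) (x : D.C) (b : Bool) (i : Fin 4) :
    o (Sum.inl (x, smoothPairing b i)) = !o (Sum.inl (x, i)) := by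
  rw [h.inl, h.inl x i]
  have : ∀ (w b : Bool) (i : Fin 4), (if LinkDiagram.smoothPairing b i = 1 ∨
    LinkDiagram.smoothPairing b i = 3 then w else !w) = !(if i = 1 ∨ i = 3 then w else !w) := by
    decide
  exact this _ b i

theorem IsColoring.statePairing (h : D.IsColoring o) (s : D.C → Bool) (d : D.Dart) :
    o (D.statePairing s d) = !o d := by
  rcases d with ⟨x, i⟩ | ⟨b, j⟩
  · rw [statePairing_inl, h.smoothPairing]
  · rw [statePairing_inr, h.inr]

theorem statePairing_statePairing (D : LinkDiagram) (s : D.C → Bool) (d : D.Dart) :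
    D.statePairing s (D.statePairing s d) = d := by
  rcases d with ⟨x, i⟩ | ⟨b, j⟩
  · rw [statePairing_inl, statePairing_inl]
    congr 2
    generalize s x = w
    revert w i; decide
  · rw [statePairing_inr, statePairing_inr]
    congr 2
    revert j; decide

/-- The half-turn of the crossings in `Y`. -/
def halfTurn (D : LinkDiagram) (Y : Finset D.C) : Equiv.Perm D.Dart :=
  Equiv.sumCongr
    (Equiv.prodCongrRight fun x => if x ∈ Y then Equiv.addRight (2 : Fin 4) else Equiv.refl _)
    (Equiv.refl _)

theorem halfTurn_inl (Y : Finset D.C) (x : D.C) (i : Fin 4) :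
    D.halfTurn Y (Sum.inl (x, i)) = Sum.inl (x, if x ∈ Y then i + 2 else i) := by
  by_cases h : x ∈ Y <;> simp [halfTurn, h]

theorem halfTurn_inr (Y : Finset D.C) (q : D.B × Fin 2) :
    D.halfTurn Y (Sum.inr q) = Sum.inr q := by
  simp [halfTurn]

theorem IsColoring.add_two (h : D.IsColoring o) (x : D.C) (i : Fin 4) :
    o (Sum.inl (x, i + 2)) = o (Sum.inl (x, i)) := by
  rw [show i + 2 = i + 1 + 1 by rw [add_assoc]; rfl, ← rot_inl, h.rot, ← rot_inl, h.rot,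
    Bool.not_not]

theorem IsColoring.halfTurn (h : D.IsColoring o) (Y : Finset D.C) (d : D.Dart) :
    o (D.halfTurn Y d) = o d := by
  rcases d with ⟨x, i⟩ | q
  · rw [halfTurn_inl]
    split_ifs
    · exact h.add_two x i
    · rfl
  · rw [halfTurn_inr]

/-- A half-edge of colour `true` at a crossing. -/
def colorEnd (o : D.Dart → Bool) (x : D.C) : Fin 4 := if o (Sum.inl (x, 1)) then 1 else 0

theorem IsColoring.color_colorEnd (h : D.IsColoring o) (x : D.C) :
    o (Sum.inl (x, colorEnd o x)) = true := by
  rw [h.inl, colorEnd]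
  cases hx : o (Sum.inl (x, 1)) <;> simp

theorem IsColoring.eq_colorEnd (h : D.IsColoring o) {x : D.C} {i : Fin 4}
    (hi : o (Sum.inl (x, i)) = true) : i = colorEnd o x ∨ i = colorEnd o x + 2 := by
  rw [h.inl] at hi
  rw [colorEnd]
  revert hi
  generalize o (Sum.inl (x, 1)) = w
  revert w i; decide

/-- The two half-edges of colour `true` at a crossing. -/
def IsColoring.endA (h : D.IsColoring o) (x : D.C) : {d // o d = true} :=
  ⟨Sum.inl (x, colorEnd o x), h.color_colorEnd x⟩

def IsColoring.endB (h : D.IsColoring o) (x : D.C) : {d // o d = true} :=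
  ⟨Sum.inl (x, colorEnd o x + 2), by rw [h.add_two, h.color_colorEnd x]⟩

theorem IsColoring.endA_ne_endB (h : D.IsColoring o) (x : D.C) : h.endA x ≠ h.endB x := fun he => by
  have h1 := congrArg Subtype.val he
  simp [IsColoring.endA, IsColoring.endB] at h1

theorem swap_endA_endB (h : D.IsColoring o) (x : D.C) (d : {d // o d = true}) :
    ((Equiv.swap (h.endA x) (h.endB x) d : {d // o d = true}) : D.Dart) =
      D.halfTurn {x} d.1 := by
  obtain ⟨⟨y, i⟩ | q, hd⟩ := d
  · by_cases hxy : y = x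
    · subst hxy
      rw [halfTurn_inl, if_pos (Finset.mem_singleton_self y)]
      rcases h.eq_colorEnd hd with rfl | rfl
      · exact congrArg Subtype.val (Equiv.swap_apply_left (h.endA y) (h.endB y))
      · refine (congrArg Subtype.val (Equiv.swap_apply_right (h.endA y) (h.endB y))).trans ?_
        rw [add_assoc, show (2 : Fin 4) + 2 = 0 by decide, add_zero]
        rfl
    · rw [halfTurn_inl, if_neg (by simpa using hxy), Equiv.swap_apply_of_ne_of_ne]
      · exact fun he => hxy (congrArg Prod.fst (Sum.inl.inj (Subtype.mk.inj he)))
      · exact fun he => hxy (congrArg Prod.fst (Sum.inl.inj (Subtype.mk.inj he)))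
  · rw [halfTurn_inr, Equiv.swap_apply_of_ne_of_ne]
    · exact fun he => Sum.inr_ne_inl (Subtype.mk.inj he)
    · exact fun he => Sum.inr_ne_inl (Subtype.mk.inj he)

theorem halfTurn_insert {Y : Finset D.C} {x : D.C} (hx : x ∉ Y) (d : D.Dart) :
    D.halfTurn (insert x Y) d = D.halfTurn {x} (D.halfTurn Y d) := by
  rcases d with ⟨y, i⟩ | q
  · rw [halfTurn_inl, halfTurn_inl, halfTurn_inl]
    by_cases h : y = x
    · subst h
      simp [hx]
    · simp [h]
  · rw [halfTurn_inr, halfTurn_inr, halfTurn_inr]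

/-- The half-turns on the half-edges of colour `true`. -/
def IsColoring.turn (h : D.IsColoring o) (Y : Finset D.C) : Equiv.Perm {d // o d = true} :=
  onColor o (D.halfTurn Y) (h.halfTurn Y)

theorem IsColoring.turn_insert (h : D.IsColoring o) {Y : Finset D.C} {x : D.C} (hx : x ∉ Y) :
    h.turn (insert x Y) = Equiv.swap (h.endA x) (h.endB x) * h.turn Y := by
  ext1 d
  refine Subtype.ext ?_
  rw [Equiv.Perm.mul_apply, swap_endA_endB]
  exact halfTurn_insert hx d.1

theorem IsColoring.not_linked_turn (h : D.IsColoring o) {Y : Finset D.C} {x : D.C} (hx : x ∉ Y) :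
    ¬ linkedSetoid {h.turn Y} (h.endA x) (h.endB x) := by
  intro hl
  refine h.endA_ne_endB x (mem_of_linked (U := {d | h.endA x = d}) ?_ hl rfl)
  rintro σ rfl _ rfl
  refine Subtype.ext ?_
  refine Eq.trans ?_ (onColor_apply _ _ _).symm
  exact ((D.halfTurn_inl Y x _).trans (by rw [if_neg hx]; rfl)).symm

/-- Each half-turn transposes the two ends of colour `true` at one crossing, and these pairs are
disjoint, so every crossing of `Y` costs one cycle. -/
theorem IsColoring.orbitCount_turn (h : D.IsColoring o) (Y : Finset D.C) :
    orbitCount {h.turn Y} + Y.card = Nat.card {d // o d = true} := by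
  induction Y using Finset.induction_on with
  | empty =>
    rw [Finset.card_empty, add_zero, ← orbitCount_one]
    congr 2
    ext1 d
    refine Subtype.ext ((onColor_apply _ _ _).trans ?_)
    obtain ⟨⟨x, i⟩ | q, hd⟩ := d
    · simp [halfTurn_inl]
    · simp [halfTurn_inr]
  | insert x Y hx ih =>
    have := orbitCount_swap_mul_of_not_linked (h.not_linked_turn hx)
    rw [← h.turn_insert hx] at this
    rw [Finset.card_insert_of_notMem hx]
    omega

/-- The circles of a state as cycles on the half-edges of colour `true`. -/
def IsColoring.statePerm (h : D.IsColoring o) (s : D.C → Bool) : Equiv.Perm {d // o d = true} :=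
  onColor o (D.statePairing s * D.edge) (color_mul (h.statePairing s) h.edge)

/-- The state pairing is an involution, so of the two generators in `orbitCount_pair_onColor` the
square is trivial: circles become the cycles of one permutation. -/
theorem IsColoring.stateLoops_eq (h : D.IsColoring o) (s : D.C → Bool) :
    D.stateLoops s = orbitCount {h.statePerm s} := by
  rw [stateLoops, Set.pair_comm, orbitCount_pair_onColor (h.statePairing s) h.edge D.edge_edge,
    ← orbitCount_pair_one (h.statePerm s)]
  congr 2
  ext1 d
  exact Subtype.ext (D.statePairing_statePairing s d.1)

/-- The regions of one colour as cycles on the half-edges of colour `true`. -/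
def IsColoring.regionPerm (h : D.IsColoring o) : Equiv.Perm {d // o d = true} :=
  onColor o (D.rot * D.edge) (color_mul h.rot h.edge)

/-- From an end of colour `false` both the rotation and the state pairing lead to an end of colour
`true`. They reach the same one or opposite ones, according to the smoothing and the colour of the
over-strand. -/
theorem IsColoring.statePairing_eq (h : D.IsColoring o) (s : D.C → Bool) {d : D.Dart}
    (hd : o d = false) : D.statePairing s d =
      D.halfTurn (Finset.univ.filter fun x => s x ≠ o (Sum.inl (x, 1))) (D.rot d) := by
  rcases d with ⟨x, i⟩ | ⟨b, j⟩
  · rw [statePairing_inl, rot_inl, halfTurn_inl]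
    congr 2
    rw [h.inl] at hd
    simp only [Finset.mem_filter, Finset.mem_univ, true_and]
    revert hd
    generalize o (Sum.inl (x, 1)) = w
    generalize s x = v
    revert v w i; decide
  · rw [statePairing_inr, rot_inr, halfTurn_inr]

theorem IsColoring.statePerm_eq (h : D.IsColoring o) (s : D.C → Bool) :
    h.statePerm s =
      h.turn (Finset.univ.filter fun x => s x ≠ o (Sum.inl (x, 1))) * h.regionPerm := by
  ext1 d
  refine Subtype.ext ?_
  refine h.statePairing_eq s ?_
  rw [h.edge, d.2]
  rfl

/-- Switching the smoothing at `x` cuts or joins circles along the chord whose ends are the two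
half-edges of colour `true` at `x`. -/
theorem IsColoring.statePerm_update (h : D.IsColoring o) (s : D.C → Bool) (x : D.C) :
    h.statePerm (Function.update s x (!s x)) =
      Equiv.swap (h.endA x) (h.endB x) * h.statePerm s := by
  ext1 d
  refine Subtype.ext ?_
  rw [Equiv.Perm.mul_apply, swap_endA_endB]
  change D.statePairing _ (D.edge d.1) = D.halfTurn {x} (D.statePairing s (D.edge d.1))
  generalize D.edge d.1 = d'
  rcases d' with ⟨y, i⟩ | ⟨b, j⟩
  · rw [statePairing_inl, statePairing_inl, halfTurn_inl]
    congr 2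
    by_cases hxy : y = x
    · subst hxy
      rw [Function.update_self, if_pos (Finset.mem_singleton_self y)]
      generalize s y = v
      revert v i; decide
    · rw [Function.update_of_ne hxy, if_neg (by simpa using hxy)]
  · rw [statePairing_inr, statePairing_inr, halfTurn_inr]

theorem rot_rot (D : LinkDiagram) (d : D.Dart) : D.rot (D.rot d) = D.halfTurn Finset.univ d := by
  rcases d with ⟨x, i⟩ | ⟨b, j⟩
  · rw [rot_inl, rot_inl, halfTurn_inl, if_pos (Finset.mem_univ x), add_assoc]
    rfl
  · rw [rot_inr, rot_inr, halfTurn_inr, add_assoc, show (1 : Fin 2) + 1 = 0 by decide, add_zero]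

theorem halfTurn_halfTurn (Y : Finset D.C) (d : D.Dart) :
    D.halfTurn Y (D.halfTurn Y d) = d := by
  rcases d with ⟨x, i⟩ | q
  · rw [halfTurn_inl, halfTurn_inl]
    split_ifs
    · rw [add_assoc, show (2 : Fin 4) + 2 = 0 by decide, add_zero]
    · rfl
  · rw [halfTurn_inr, halfTurn_inr]

/-- Euler's relation for `D`, read on the half-edges of colour `true`: these number `E`, the
half-turns have the vertices of `D` as cycles, and the faces of `D` are the cycles of `regionPerm`
together with those of its product with the half-turns. The components correspond. -/
theorem IsColoring.mapDefect_turn_univ (h : D.IsColoring o) (hp : D.Planar) :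
    mapDefect (h.turn Finset.univ) h.regionPerm =
      orbitCount {h.regionPerm} - Nat.card {d // o d = true} := by
  have h1 : onColor o (D.rot * D.rot) (color_mul h.rot h.rot) = h.turn Finset.univ := by
    ext1 d
    exact Subtype.ext (D.rot_rot d.1)
  have h2 : onColor o (D.rot⁻¹ * D.edge) (color_mul (color_inv h.rot) h.edge) =
      h.turn Finset.univ * h.regionPerm := by
    ext1 d
    refine Subtype.ext ?_
    change D.rot⁻¹ (D.edge d.1) = D.halfTurn Finset.univ (D.rot (D.edge d.1))
    rw [Equiv.Perm.inv_eq_iff_eq, ← rot_rot, rot_rot, rot_rot, halfTurn_halfTurn]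
  have hV := orbitCount_onColor_mul_self h.rot
  have hE : orbitCount {D.edge} = Nat.card {d // o d = true} :=
    orbitCount_eq_card_color h.edge D.edge_edge
  have hF := orbitCount_eq_add_onColor h.rot h.edge D.edge_edge
  have hK := orbitCount_pair_onColor h.rot h.edge D.edge_edge
  rw [h1] at hV hK
  rw [h2] at hF
  change orbitCount {D.rot * D.edge} = orbitCount {h.regionPerm} + _ at hF
  change _ = orbitCount {h.turn Finset.univ, h.regionPerm} at hK
  rw [Planar] at hp
  rw [mapDefect]
  omega

/-- Dropping the half-turn of one crossing splits a 2-cycle, which keeps the defect minimal by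
`mapDefect_eq_of_swap_mul`. The induction runs over the complement of `Y`, starting from all
crossings. -/
theorem IsColoring.mapDefect_turn (h : D.IsColoring o) (hp : D.Planar) (Y : Finset D.C) :
    mapDefect (h.turn Y) h.regionPerm =
      orbitCount {h.regionPerm} - Nat.card {d // o d = true} := by
  suffices ∀ Z : Finset D.C, mapDefect (h.turn Zᶜ) h.regionPerm =
      orbitCount {h.regionPerm} - Nat.card {d // o d = true} by
    simpa using this Yᶜ
  intro Z
  induction Z using Finset.induction_on with
  | empty => simpa using h.mapDefect_turn_univ hp
  | insert x Z hx ih =>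
    have hx' : x ∉ (insert x Z)ᶜ := by simp
    have hi : insert x (insert x Z)ᶜ = Zᶜ := by
      ext y
      by_cases hy : y = x
      · subst hy; simp [hx]
      · simp [hy]
    rw [← hi, h.turn_insert hx'] at ih
    exact mapDefect_eq_of_swap_mul (h.not_linked_turn hx') ih

/-- In terms of the checkerboard graph: spanning trees have the same number of edges. -/
theorem IsColoring.card_of_stateLoops_eq_one (h : D.IsColoring o) (hp : D.Planar)
    {s : D.C → Bool} (hs : D.stateLoops s = 1) :
    (Finset.univ.filter fun x => s x ≠ o (Sum.inl (x, 1))).card + 1 =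
      orbitCount {h.regionPerm} := by
  set Y := Finset.univ.filter fun x => s x ≠ o (Sum.inl (x, 1)) with hY
  have h1 := h.mapDefect_turn hp Y
  have h2 := h.orbitCount_turn Y
  have h3 := h.stateLoops_eq s
  rw [hs, h.statePerm_eq, ← hY] at h3
  have hne : Nonempty {d // o d = true} := by
    by_contra hne
    rw [not_nonempty_iff] at hne
    rw [orbitCount_eq_card] at h3
    have : IsEmpty (Quotient (linkedSetoid {h.turn Y * h.regionPerm})) :=
      ⟨fun q => Quotient.inductionOn q fun x => hne.elim x⟩
    rw [Nat.card_of_isEmpty] at h3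
    omega
  -- The circle is a cycle of the product of the two permutations, so a single circle forces a
  -- single component.
  have h4 : orbitCount {h.turn Y, h.regionPerm} = 1 := by
    rw [orbitCount_eq_one_iff]
    intro x y
    refine linkedSetoid_mono ?_ (orbitCount_eq_one_iff.1 h3.symm x y)
    rintro σ rfl z
    exact Setoid.trans' _ (linked_pair_right _ _ z) (linked_pair_left _ _ _)
  -- With `N` half-edges of colour `true` and `M` cycles of `regionPerm`, the relation reads `2 - (N
  -- - |Y|) - 1 = M - N`.
  rw [mapDefect, h4, ← h3] at h1
  push_cast at h1
  omega

theorem IsColoring.smooth (h : D.IsColoring o) (c : D.C) (b : Bool) :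
    (D.smooth c b).IsColoring (o ∘ (D.smoothEquiv c b).symm) := by
  refine ⟨fun d => ?_, fun d => ?_⟩ <;> obtain ⟨d, rfl⟩ := (D.smoothEquiv c b).surjective d
  · rw [smooth_edge, Function.comp_apply, Function.comp_apply, Equiv.symm_apply_apply,
      Equiv.symm_apply_apply, h.edge]
  · rw [smooth_rot, Function.comp_apply, Function.comp_apply, Equiv.symm_apply_apply,
      Equiv.symm_apply_apply]
    rcases d with ⟨x, i⟩ | ⟨q, j⟩
    · by_cases hx : x = c
      · subst hx
        rw [← h.smoothPairing x b i]
        simp [splitRot]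
      · rw [← h.rot, rot_inl]
        simp [splitRot, hx]
    · rw [← h.rot, rot_inr]
      simp [splitRot, swap_zero_one]

theorem smooth_color {c : D.C} {b : Bool} (x : (D.smooth c b).C) (i : Fin 4) :
    (o ∘ (D.smoothEquiv c b).symm) (Sum.inl (x, i)) = o (Sum.inl (x.1, i)) := rfl

end LinkDiagram


/-! ### The determinant as a count of tree states -/

namespace LinkDiagram

/-- The value of the variable of the bracket that gives the determinant. -/
noncomputable def bracketRoot : ℂ := Complex.exp (Real.pi / 4 * Complex.I)

theorem bracketRoot_ne_zero : bracketRoot ≠ 0 := Complex.exp_ne_zero _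

theorem norm_bracketRoot : ‖bracketRoot‖ = 1 := by
  rw [bracketRoot, show (Real.pi / 4 * Complex.I : ℂ) = ((Real.pi / 4 : ℝ) : ℂ) * Complex.I by
    push_cast; ring]
  exact Complex.norm_exp_ofReal_mul_I _

theorem bracketRoot_pow_four : bracketRoot ^ 4 = -1 := by
  rw [bracketRoot, ← Complex.exp_nat_mul, ← Complex.exp_pi_mul_I]
  congr 1
  push_cast
  ring

theorem inv_bracketRoot : bracketRoot⁻¹ = -bracketRoot ^ 3 := by
  refine inv_eq_of_mul_eq_one_left ?_
  linear_combination -bracketRoot_pow_four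

theorem bracketRoot_loop : -bracketRoot ^ 2 - (bracketRoot⁻¹) ^ 2 = 0 := by
  rw [inv_bracketRoot]
  linear_combination -bracketRoot ^ 2 * bracketRoot_pow_four

variable (D : LinkDiagram)

/-- The states with a single circle; they correspond to the spanning trees of the checkerboard
graph. -/
noncomputable def treeStates : Finset (D.C → Bool) := Finset.univ.filter fun s => D.stateLoops s = 1

theorem mem_treeStates {s : D.C → Bool} : s ∈ D.treeStates ↔ D.stateLoops s = 1 := by
  simp [treeStates]

theorem det_eq : D.det = ‖D.bracket bracketRoot‖ := rfl

/-- A loop has value zero and `0 ^ 0 = 1`, so only one-circle states survive. Without half-edges the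
truncated exponent `0 - 1` would let through a state without circles; `Nonempty` excludes this. -/
theorem bracket_root_eq_sum [Nonempty D.Dart] : D.bracket bracketRoot =
    ∑ s ∈ D.treeStates, ∏ x, if s x then bracketRoot else bracketRoot⁻¹ := by
  rw [bracket, bracketRoot_loop, treeStates, Finset.sum_filter]
  refine Finset.sum_congr rfl fun s _ => ?_
  have : 0 < D.stateLoops s := orbitCount_pos _
  split_ifs with h
  · rw [h, Nat.sub_self, pow_zero, mul_one]
  · rw [zero_pow (by omega), mul_zero]

/-- If all tree states have equally many `B`-smoothings, they contribute the same power of `A` and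
nothing cancels. -/
theorem bracket_root_of_card [Nonempty D.Dart] (m : ℤ)
    (h : ∀ s ∈ D.treeStates, ((Finset.univ.filter fun x => s x = false).card : ℤ) = m) :
    D.bracket bracketRoot =
      D.treeStates.card * bracketRoot ^ ((Fintype.card D.C : ℤ) - 2 * m) := by
  rw [bracket_root_eq_sum, ← nsmul_eq_mul]
  refine Finset.sum_eq_card_nsmul fun s hs => ?_
  rw [Finset.prod_ite, Finset.prod_const, Finset.prod_const, inv_pow, ← div_eq_mul_inv,
    ← zpow_natCast, ← zpow_natCast, ← zpow_sub₀ bracketRoot_ne_zero]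
  congr 1
  have h1 := Finset.card_filter_add_card_filter_not (s := Finset.univ) (fun x => s x = true)
  have h2 := h s hs
  simp only [Bool.not_eq_true] at h1 ⊢
  rw [Finset.card_univ] at h1
  omega

theorem card_treeStates_eq_add (c : D.C) :
    D.treeStates.card = (D.smoothZero c).treeStates.card + (D.smoothInfty c).treeStates.card := by
  have key : ∀ p : Bool × ({x // x ≠ c} → Bool),
      D.stateLoops ((D.stateEquiv c).symm p) = (D.smooth c (!p.1)).stateLoops p.2 := by
    intro p
    rw [← D.stateLoops_smooth (c := c) (b := !p.1) (s := (D.stateEquiv c).symm p)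
      (by rw [stateEquiv_symm_self, Bool.not_not])]
    exact congrArg (D.smooth c (!p.1)).stateLoops (D.stateEquiv_symm_of_ne c p)
  simp only [treeStates, Finset.card_filter]
  rw [← Equiv.sum_comp (D.stateEquiv c).symm]
  simp only [key]
  rw [Fintype.sum_prod_type, Fintype.sum_bool]
  rfl

theorem treeStates_smooth_nonempty {c : D.C} {b : Bool} {s : D.C → Bool} (hs : s ∈ D.treeStates)
    (hb : s c = !b) : (D.smooth c b).treeStates.Nonempty :=
  ⟨fun x => s x.1, by rw [mem_treeStates] at hs ⊢; rw [← hs, ← D.stateLoops_smooth hb]⟩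

theorem exists_state_of_smooth {c : D.C} {b : Bool} {s' : (D.smooth c b).C → Bool}
    (hs : s' ∈ (D.smooth c b).treeStates) :
    ∃ s : D.C → Bool, D.stateLoops s = 1 ∧ s c = (!b) ∧ ∀ x : {x // x ≠ c}, s x.1 = s' x := by
  refine ⟨(D.stateEquiv c).symm (!b, s'), ?_, D.stateEquiv_symm_self c _,
    congrFun (D.stateEquiv_symm_of_ne c (!b, s'))⟩
  rw [← D.stateLoops_smooth (D.stateEquiv_symm_self c (!b, s'))]
  refine (congrArg (D.smooth c b).stateLoops (D.stateEquiv_symm_of_ne c (!b, s'))).trans ?_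
  exact (mem_treeStates _).1 hs

theorem nonempty_dart_of_crossing (c : D.C) : Nonempty D.Dart := ⟨Sum.inl (c, 0)⟩

theorem nonempty_dart_smooth (c : D.C) (b : Bool) : Nonempty (D.smooth c b).Dart :=
  ⟨D.smoothEquiv c b (Sum.inl (c, 0))⟩

variable {D}

/-- A colouring for which all over-strands have the same colour; it shows that the diagram is
alternating. -/
structure IsAltColoring (D : LinkDiagram) (o : D.Dart → Bool) : Prop extends D.IsColoring o where
  color_over : ∀ x, o (Sum.inl (x, 1)) = true

variable {o : D.Dart → Bool}

theorem IsAltColoring.smooth (h : D.IsAltColoring o) (c : D.C) (b : Bool) :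
    (D.smooth c b).IsAltColoring (o ∘ (D.smoothEquiv c b).symm) :=
  ⟨h.toIsColoring.smooth c b, fun x => h.color_over x.1⟩

/-- The determinant of an alternating diagram is the number of spanning trees of the checkerboard
graph. -/
theorem IsAltColoring.det_eq_card (h : D.IsAltColoring o) (hp : D.Planar) [Nonempty D.Dart] :
    D.det = D.treeStates.card := by
  rw [det_eq, D.bracket_root_of_card (orbitCount {h.toIsColoring.regionPerm} - 1)]
  · rw [norm_mul, norm_zpow, norm_bracketRoot, one_zpow, mul_one, Complex.norm_natCast]
  · intro s hs
    have := h.toIsColoring.card_of_stateLoops_eq_one hp (D.mem_treeStates.1 hs)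
    simp only [h.color_over, ne_eq, Bool.not_eq_true] at this
    omega

theorem IsAltColoring.det_eq_add (h : D.IsAltColoring o) (hp : D.Planar) (c : D.C) :
    D.det = (D.smoothZero c).det + (D.smoothInfty c).det := by
  have := D.nonempty_dart_of_crossing c
  have := D.nonempty_dart_smooth c false
  have := D.nonempty_dart_smooth c true
  rw [h.det_eq_card hp, (h.smooth c false).det_eq_card (hp.smooth c false),
    (h.smooth c true).det_eq_card (hp.smooth c true), card_treeStates_eq_add D c]
  push_cast
  rfl

/-- A colouring that shows that the diagram is alternating after a change of the crossing `c`. -/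
structure IsDealtColoring (D : LinkDiagram) (o : D.Dart → Bool) (c : D.C) : Prop
    extends D.IsColoring o where
  color_over : ∀ x, o (Sum.inl (x, 1)) = decide (x ≠ c)

variable {c : D.C}

theorem IsDealtColoring.smooth (h : D.IsDealtColoring o c) (b : Bool) :
    (D.smooth c b).IsAltColoring (o ∘ (D.smoothEquiv c b).symm) :=
  ⟨h.toIsColoring.smooth c b, fun x => by
    rw [smooth_color, h.color_over]
    exact decide_eq_true x.2⟩

/-- Extend the tree state to `D` and apply the edge count there. Away from `c` the over-strands have
colour `true`, so the crossings counted are those with a `B`-smoothing. At `c` the over-strand has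
colour `false`, so `c` is counted exactly for the smoothing `0`, whence the extra summand. -/
theorem IsDealtColoring.card_eq (h : D.IsDealtColoring o c) (hp : D.Planar) {b : Bool}
    {s : (D.smooth c b).C → Bool} (hs : s ∈ (D.smooth c b).treeStates) :
    (Finset.univ.filter fun x => s x = false).card + (if b then 0 else 1) + 1 =
      orbitCount {h.toIsColoring.regionPerm} := by
  obtain ⟨t, ht, htc, hts⟩ := D.exists_state_of_smooth hs
  rw [← h.toIsColoring.card_of_stateLoops_eq_one hp ht, Finset.card_filter, Finset.card_filter,
    Fintype.sum_eq_add_sum_subtype_ne _ c, h.color_over, htc, add_comm (Finset.sum _ _)]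
  congr 2
  · cases b <;> simp
  · refine Finset.sum_congr rfl fun x _ => ?_
    have key : ∀ v w r : Bool, v = w → r = true →
        (if w = false then 1 else 0) = if v ≠ r then 1 else 0 := by decide
    exact key _ _ _ (hts x) ((h.color_over x.1).trans (decide_eq_true x.2))

/-- The brackets of the smoothings of a dealternator. -/
theorem IsDealtColoring.bracket_smooth (h : D.IsDealtColoring o c) (hp : D.Planar) :
    ∃ u : ℂ, ‖u‖ = 1 ∧
      (D.smoothZero c).bracket bracketRoot = (D.smoothZero c).det * (u * bracketRoot ^ 2) ∧
      (D.smoothInfty c).bracket bracketRoot = (D.smoothInfty c).det * u := by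
  have := D.nonempty_dart_smooth c false
  have := D.nonempty_dart_smooth c true
  set M := orbitCount {h.toIsColoring.regionPerm} with hM
  set n : ℤ := (Fintype.card {x // x ≠ c} : ℤ) with hn
  -- The numbers of `B`-smoothings are `M - 2` for the smoothing `0` and `M - 1` for `∞`; the
  -- exponents `n - 2 (M - 2)` and `n - 2 (M - 1)` differ by two, which is the factor `A ^ 2`.
  refine ⟨bracketRoot ^ (n - 2 * (M - 1)), by rw [norm_zpow, norm_bracketRoot, one_zpow], ?_, ?_⟩
  · rw [(h.smooth false).det_eq_card (hp.smooth c false),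
      bracket_root_of_card _ ((M : ℤ) - 2) fun s hs => ?_, ← zpow_natCast bracketRoot 2,
      ← zpow_add₀ bracketRoot_ne_zero]
    · rw [Complex.ofReal_natCast]
      congr 2
      push_cast
      change n - _ = _
      ring
    · have h1 : _ + 1 + 1 = M := h.card_eq hp (b := false) hs
      rw [← h1]
      push_cast
      ring
  · rw [(h.smooth true).det_eq_card (hp.smooth c true),
      bracket_root_of_card _ ((M : ℤ) - 1) fun s hs => ?_, Complex.ofReal_natCast]
    · rfl
    · have h1 : _ + 0 + 1 = M := h.card_eq hp (b := true) hs
      rw [← h1, if_pos rfl]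
      push_cast
      ring

end LinkDiagram


namespace LinkDiagram

/-! ### Isomorphisms that keep the numbering of the half-edges at the crossings -/

/-- An isomorphism of diagrams that keeps the numbering of the half-edges at the crossings. -/
structure LabelIso (D D' : LinkDiagram) where
  crossing : D.C ≃ D'.C
  dart : D.Dart ≃ D'.Dart
  dart_inl : ∀ x i, dart (Sum.inl (x, i)) = Sum.inl (crossing x, i)
  dart_rot : ∀ d, dart (D.rot d) = D'.rot (dart d)
  dart_edge : ∀ d, dart (D.edge d) = D'.edge (dart d)

namespace LabelIso

variable {D D' : LinkDiagram}

theorem exists_dart_inr (f : LabelIso D D') (q : D.B × Fin 2) : ∃ q', f.dart (Sum.inr q) = Sum.inr q' := by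
  rcases h : f.dart (Sum.inr q) with ⟨y, i⟩ | q'
  · obtain ⟨x, rfl⟩ := f.crossing.surjective y
    rw [← f.dart_inl] at h
    exact absurd (f.dart.injective h) Sum.inr_ne_inl
  · exact ⟨q', rfl⟩

theorem isIso (f : LabelIso D D') : D.IsIso D' := by
  refine ⟨f.dart, f.dart_rot, f.dart_edge, ?_⟩
  rintro (⟨x, i⟩ | q)
  · rw [f.dart_inl]
    rfl
  · obtain ⟨q', hq⟩ := f.exists_dart_inr q
    rw [hq]
    rfl

theorem planar_iff (f : LabelIso D D') : D.Planar ↔ D'.Planar := by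
  have h : ∀ d, f.dart ((D.rot * D.edge) d) = (D'.rot * D'.edge) (f.dart d) := fun d => by
    rw [Equiv.Perm.mul_apply, f.dart_rot, f.dart_edge, Equiv.Perm.mul_apply]
  rw [Planar, Planar, orbitCount_conj_single _ f.dart_rot, orbitCount_conj_single _ f.dart_edge,
    orbitCount_conj_single _ h, orbitCount_conj_pair _ f.dart_rot f.dart_edge]

theorem dart_statePairing (f : LabelIso D D') (s : D'.C → Bool) (d : D.Dart) :
    f.dart (D.statePairing (s ∘ f.crossing) d) = D'.statePairing s (f.dart d) := by
  rcases d with ⟨x, i⟩ | q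
  · rw [statePairing_inl, f.dart_inl, f.dart_inl, statePairing_inl]
    rfl
  · obtain ⟨q', hq⟩ := f.exists_dart_inr q
    rw [hq, statePairing_inr, ← rot_inr, f.dart_rot, hq, statePairing_inr, ← rot_inr]

theorem stateLoops_eq (f : LabelIso D D') (s : D'.C → Bool) :
    D.stateLoops (s ∘ f.crossing) = D'.stateLoops s :=
  orbitCount_conj_pair _ f.dart_edge (f.dart_statePairing s)

theorem bracket_eq (f : LabelIso D D') (A : ℂ) : D.bracket A = D'.bracket A := by
  rw [bracket, bracket, ← Equiv.sum_comp (f.crossing.arrowCongr (Equiv.refl Bool)).symm]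
  refine Finset.sum_congr rfl fun s _ => ?_
  have hs : (f.crossing.arrowCongr (Equiv.refl Bool)).symm s = s ∘ f.crossing := by
    ext x
    simp
  rw [hs, f.stateLoops_eq, ← Equiv.prod_comp f.crossing]
  rfl

end LabelIso

/-! ### Adding a marked point -/

section Subdivide

variable (D : LinkDiagram) (d : D.Dart)

/-- The half-edges of `D` in the subdivision. -/
def subdivideOld : D.Dart → (D.subdivide d).Dart
  | Sum.inl q => Sum.inl q
  | Sum.inr (b, k) => Sum.inr (some b, k)

/-- The half-edges of the new marked point. -/
def subdivideNew (k : Fin 2) : (D.subdivide d).Dart := Sum.inr (none, k)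

theorem subdivideDart_inl {x : D.Dart} (hx : x ≠ d) :
    D.subdivideDart d (Sum.inl x) = D.subdivideOld d x := by
  rw [subdivideDart, Equiv.trans_apply, Equiv.swap_apply_of_ne_of_ne (by simpa using hx) (by simp)]
  rcases x with q | ⟨b, k⟩ <;> rfl

theorem subdivideDart_inl_self : D.subdivideDart d (Sum.inl d) = D.subdivideNew d 0 := by
  rw [subdivideDart, Equiv.trans_apply, Equiv.swap_apply_left]
  rfl

theorem subdivideDart_inr_zero : D.subdivideDart d (Sum.inr 0) = D.subdivideOld d d := by
  rw [subdivideDart, Equiv.trans_apply, Equiv.swap_apply_right]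
  rcases d with q | ⟨b, k⟩ <;> rfl

theorem subdivideDart_inr_one : D.subdivideDart d (Sum.inr 1) = D.subdivideNew d 1 := by
  rw [subdivideDart, Equiv.trans_apply, Equiv.swap_apply_of_ne_of_ne (by simp) (by simp)]
  rfl

theorem subdivide_edge (z : D.Dart ⊕ Fin 2) : (D.subdivide d).edge (D.subdivideDart d z) =
    D.subdivideDart d (Equiv.sumCongr D.edge (Equiv.swap 0 1) z) := by
  change (D.subdivideDart d).permCongr _ (D.subdivideDart d z) = _
  rw [Equiv.permCongr_apply, Equiv.symm_apply_apply]

theorem subdivide_edge_new_one :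
    (D.subdivide d).edge (D.subdivideNew d 1) = D.subdivideOld d d := by
  rw [← subdivideDart_inr_one, subdivide_edge, ← subdivideDart_inr_zero]
  rfl

theorem subdivide_edge_self :
    (D.subdivide d).edge (D.subdivideOld d d) = D.subdivideNew d 1 := by
  rw [← subdivide_edge_new_one, edge_edge]

theorem subdivide_edge_new_zero :
    (D.subdivide d).edge (D.subdivideNew d 0) = D.subdivideOld d (D.edge d) := by
  rw [← subdivideDart_inl_self, subdivide_edge, ← subdivideDart_inl _ _ (D.edge_ne d)]
  rfl

theorem subdivide_edge_edge :
    (D.subdivide d).edge (D.subdivideOld d (D.edge d)) = D.subdivideNew d 0 := by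
  rw [← subdivide_edge_new_zero, edge_edge]

theorem subdivide_edge_old {x : D.Dart} (hx : x ≠ d) (hx' : x ≠ D.edge d) :
    (D.subdivide d).edge (D.subdivideOld d x) = D.subdivideOld d (D.edge x) := by
  have hx'' : D.edge x ≠ d := fun h => hx' (by rw [← h, edge_edge])
  rw [← subdivideDart_inl _ _ hx, subdivide_edge, ← subdivideDart_inl _ _ hx'']
  rfl

theorem subdivide_rot_old (x : D.Dart) :
    (D.subdivide d).rot (D.subdivideOld d x) = D.subdivideOld d (D.rot x) := by
  rcases x with q | ⟨b, k⟩ <;> rfl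

theorem subdivide_dart_cases (y : (D.subdivide d).Dart) :
    (∃ x, y = D.subdivideOld d x) ∨ y = D.subdivideNew d 0 ∨ y = D.subdivideNew d 1 := by
  rcases y with q | ⟨_ | b, k⟩
  · exact Or.inl ⟨Sum.inl q, rfl⟩
  · right
    fin_cases k
    · exact Or.inl rfl
    · exact Or.inr rfl
  · exact Or.inl ⟨Sum.inr (b, k), rfl⟩

/-- The nearest half-edge of `D`. -/
def subdivideProj : (D.subdivide d).Dart → D.Dart
  | Sum.inl q => Sum.inl q
  | Sum.inr (some b, k) => Sum.inr (b, k)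
  | Sum.inr (none, k) => if k = 0 then d else D.edge d

theorem subdivideProj_old (x : D.Dart) : D.subdivideProj d (D.subdivideOld d x) = x := by
  rcases x with q | ⟨b, k⟩ <;> rfl

theorem subdivideProj_new_zero : D.subdivideProj d (D.subdivideNew d 0) = d := rfl

theorem subdivideProj_new_one : D.subdivideProj d (D.subdivideNew d 1) = D.edge d := rfl

variable {D d} {r : Equiv.Perm D.Dart} {r' : Equiv.Perm (D.subdivide d).Dart}

/-- Stated for any `r'` that extends `r` and exchanges the new half-edges, so that it covers both
the rotation, for components, and the state pairings, for circles. -/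
theorem orbitCount_subdivide_pair (hr : ∀ x, r' (D.subdivideOld d x) = D.subdivideOld d (r x))
    (hr0 : r' (D.subdivideNew d 0) = D.subdivideNew d 1)
    (hr1 : r' (D.subdivideNew d 1) = D.subdivideNew d 0) :
    orbitCount {D.edge, r} = orbitCount {(D.subdivide d).edge, r'} := by
  have l := linked_pair_left (D.subdivide d).edge r'
  have l' := linked_pair_right (D.subdivide d).edge r'
  have m := linked_pair_left D.edge r
  have m' := linked_pair_right D.edge r
  refine orbitCount_congr (D.subdivideOld d) (D.subdivideProj d) ?_ ?_ ?_ ?_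
  · rintro σ (rfl | rfl) x
    · by_cases h1 : x = d
      · subst h1
        have h := l (D.subdivideOld x x)
        rw [subdivide_edge_self] at h
        refine Setoid.trans' _ h (Setoid.trans' _ (l' _) ?_)
        rw [hr1, ← subdivide_edge_new_zero]
        exact l _
      by_cases h2 : x = D.edge d
      · subst h2
        have h := l (D.subdivideOld d (D.edge d))
        rw [subdivide_edge_edge] at h
        refine Setoid.trans' _ h (Setoid.trans' _ (l' _) ?_)
        rw [hr0, D.edge_edge, ← subdivide_edge_new_one]
        exact l _
      rw [← subdivide_edge_old _ _ h1 h2]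
      exact l _
    · rw [← hr]
      exact l' _
  · rintro σ (rfl | rfl) y <;> rcases D.subdivide_dart_cases d y with ⟨x, rfl⟩ | rfl | rfl
    · by_cases h1 : x = d
      · subst h1
        rw [subdivide_edge_self, subdivideProj_old, subdivideProj_new_one]
        exact m _
      by_cases h2 : x = D.edge d
      · subst h2
        rw [subdivide_edge_edge, subdivideProj_old, subdivideProj_new_zero]
        exact Setoid.symm' _ (m _)
      rw [subdivide_edge_old _ _ h1 h2, subdivideProj_old, subdivideProj_old]
      exact m _
    · rw [subdivide_edge_new_zero, subdivideProj_old, subdivideProj_new_zero]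
      exact m _
    · rw [subdivide_edge_new_one, subdivideProj_old, subdivideProj_new_one]
      exact Setoid.symm' _ (m _)
    · rw [hr, subdivideProj_old, subdivideProj_old]
      exact m' _
    · rw [hr0, subdivideProj_new_zero, subdivideProj_new_one]
      exact m _
    · rw [hr1, subdivideProj_new_zero, subdivideProj_new_one]
      exact Setoid.symm' _ (m _)
  · intro x
    rw [subdivideProj_old]
  · intro y
    rcases D.subdivide_dart_cases d y with ⟨x, rfl⟩ | rfl | rfl
    · rw [subdivideProj_old]
    · rw [subdivideProj_new_zero, ← subdivide_edge_new_one, ← hr0]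
      exact Setoid.symm' _ (Setoid.trans' _ (l' _) (l _))
    · rw [subdivideProj_new_one, ← subdivide_edge_new_zero, ← hr1]
      exact Setoid.symm' _ (Setoid.trans' _ (l' _) (l _))

theorem orbitCount_subdivide_mul (hr : ∀ x, r' (D.subdivideOld d x) = D.subdivideOld d (r x))
    (hr0 : r' (D.subdivideNew d 0) = D.subdivideNew d 1)
    (hr1 : r' (D.subdivideNew d 1) = D.subdivideNew d 0) :
    orbitCount {r * D.edge} = orbitCount {r' * (D.subdivide d).edge} := by
  have l := linked_self (r' * (D.subdivide d).edge)
  have m := linked_self (r * D.edge)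
  have e1 : (r' * (D.subdivide d).edge) (D.subdivideOld d d) = D.subdivideNew d 0 := by
    rw [Equiv.Perm.mul_apply, subdivide_edge_self, hr1]
  have e2 : (r' * (D.subdivide d).edge) (D.subdivideNew d 0) =
      D.subdivideOld d (r (D.edge d)) := by
    rw [Equiv.Perm.mul_apply, subdivide_edge_new_zero, hr]
  have e3 : (r' * (D.subdivide d).edge) (D.subdivideOld d (D.edge d)) = D.subdivideNew d 1 := by
    rw [Equiv.Perm.mul_apply, subdivide_edge_edge, hr0]
  have e4 : (r' * (D.subdivide d).edge) (D.subdivideNew d 1) = D.subdivideOld d (r d) := by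
    rw [Equiv.Perm.mul_apply, subdivide_edge_new_one, hr]
  have e5 : ∀ x, x ≠ d → x ≠ D.edge d →
      (r' * (D.subdivide d).edge) (D.subdivideOld d x) = D.subdivideOld d (r (D.edge x)) := by
    intro x h1 h2
    rw [Equiv.Perm.mul_apply, subdivide_edge_old _ _ h1 h2, hr]
  have e6 : (r * D.edge) (D.edge d) = r d := by rw [Equiv.Perm.mul_apply, edge_edge]
  refine orbitCount_congr (D.subdivideOld d) (D.subdivideProj d) ?_ ?_ ?_ ?_
  · rintro σ rfl x
    by_cases h1 : x = d
    · subst h1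
      exact Setoid.trans' _ (e1 ▸ l _) (e2 ▸ l _)
    by_cases h2 : x = D.edge d
    · subst h2
      rw [e6]
      exact Setoid.trans' _ (e3 ▸ l _) (e4 ▸ l _)
    exact e5 x h1 h2 ▸ l _
  · rintro σ rfl y
    rcases D.subdivide_dart_cases d y with ⟨x, rfl⟩ | rfl | rfl
    · by_cases h1 : x = d
      · subst h1
        rw [e1, subdivideProj_old, subdivideProj_new_zero]
      by_cases h2 : x = D.edge d
      · subst h2
        rw [e3, subdivideProj_old, subdivideProj_new_one]
      rw [e5 x h1 h2, subdivideProj_old, subdivideProj_old]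
      exact m _
    · rw [e2, subdivideProj_old, subdivideProj_new_zero]
      exact m _
    · rw [e4, subdivideProj_old, subdivideProj_new_one, ← e6]
      exact m _
  · intro x
    rw [subdivideProj_old]
  · intro y
    rcases D.subdivide_dart_cases d y with ⟨x, rfl⟩ | rfl | rfl
    · rw [subdivideProj_old]
    · rw [subdivideProj_new_zero]
      exact e1 ▸ l _
    · rw [subdivideProj_new_one]
      exact e3 ▸ l _

theorem orbitCount_rot (D : LinkDiagram) : orbitCount {D.rot} = Nat.card (D.C ⊕ D.B) := by
  rw [← orbitCount_one]
  refine orbitCount_congr (Sum.map Prod.fst Prod.fst) (Sum.map (·, 0) (·, 0)) ?_ ?_ ?_ ?_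
  · rintro σ rfl (⟨x, i⟩ | ⟨b, k⟩) <;> exact Setoid.refl' _ _
  · rintro σ rfl y
    exact Setoid.refl' _ _
  · rintro (⟨x, i⟩ | ⟨b, k⟩)
    · change linkedSetoid {D.rot} (Sum.inl (x, 0)) (Sum.inl (x, i))
      have l : ∀ i, linkedSetoid {D.rot} (Sum.inl (x, i)) (Sum.inl (x, i + 1)) := fun i => by
        rw [← rot_inl]
        exact linked_self _ _
      fin_cases i
      · exact Setoid.refl' _ _
      · exact l 0
      · exact Setoid.trans' _ (l 0) (l 1)
      · exact Setoid.trans' _ (Setoid.trans' _ (l 0) (l 1)) (l 2)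
    · change linkedSetoid {D.rot} (Sum.inr (b, 0)) (Sum.inr (b, k))
      fin_cases k
      · exact Setoid.refl' _ _
      · exact linked_self D.rot (Sum.inr (b, 0))
  · rintro (x | b) <;> exact Setoid.refl' _ _

variable (D d)

/-- Vertices and edges both increase by one, faces and components do not change. -/
theorem planar_subdivide_iff : (D.subdivide d).Planar ↔ D.Planar := by
  have h0 : (D.subdivide d).rot (D.subdivideNew d 0) = D.subdivideNew d 1 := rfl
  have h1 : (D.subdivide d).rot (D.subdivideNew d 1) = D.subdivideNew d 0 := rfl
  have hK := orbitCount_subdivide_pair (D.subdivide_rot_old d) h0 h1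
  have hF := orbitCount_subdivide_mul (D.subdivide_rot_old d) h0 h1
  have hV := orbitCount_rot D
  have hV' := orbitCount_rot (D.subdivide d)
  have hE := card_eq_two_mul_orbitCount D.edge_edge D.edge_ne
  have hE' := card_eq_two_mul_orbitCount (D.subdivide d).edge_edge (D.subdivide d).edge_ne
  have c1 : Nat.card (D.subdivide d).B = Nat.card D.B + 1 := by
    change Nat.card (Option D.B) = _
    simp
  have c2 : Nat.card (D.subdivide d).C = Nat.card D.C := rfl
  simp only [Nat.card_sum, Nat.card_prod, Nat.card_eq_fintype_card (α := Fin 4),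
    Nat.card_eq_fintype_card (α := Fin 2), Fintype.card_fin, c1, c2] at hV hV' hE hE'
  rw [Planar, Planar, Set.pair_comm, Set.pair_comm D.rot]
  omega

theorem bracket_subdivide (A : ℂ) : (D.subdivide d).bracket A = D.bracket A := by
  have key : ∀ s : D.C → Bool, (D.subdivide d).stateLoops s = D.stateLoops s := fun s =>
    (orbitCount_subdivide_pair (r := D.statePairing s) (r' := (D.subdivide d).statePairing s)
      (by rintro (q | ⟨b, k⟩) <;> rfl) rfl rfl).symm
  rw [bracket, bracket]
  refine Finset.sum_congr rfl fun s _ => ?_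
  exact congrArg _ (congrArg _ (congrArg (· - 1) (key s)))

end Subdivide

/-- Two diagrams that differ by isomorphisms and by marked points. -/
def MarkEquiv : LinkDiagram → LinkDiagram → Prop :=
  Relation.EqvGen fun D D' => Nonempty (LabelIso D D') ∨ ∃ d, D' = D.subdivide d

namespace MarkEquiv

variable {D D' D'' : LinkDiagram}

theorem of_labelIso (f : LabelIso D D') : MarkEquiv D D' := .rel _ _ (Or.inl ⟨f⟩)

theorem subdivide (D : LinkDiagram) (d : D.Dart) : MarkEquiv D (D.subdivide d) :=
  .rel _ _ (Or.inr ⟨d, rfl⟩)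

theorem symm (h : MarkEquiv D D') : MarkEquiv D' D := Relation.EqvGen.symm _ _ h

theorem trans (h : MarkEquiv D D') (h' : MarkEquiv D' D'') : MarkEquiv D D'' :=
  Relation.EqvGen.trans _ _ _ h h'

theorem planar_iff (h : MarkEquiv D D') : D.Planar ↔ D'.Planar := by
  induction h with
  | rel D D' h =>
    rcases h with ⟨⟨f⟩⟩ | ⟨d, rfl⟩
    · exact f.planar_iff
    · exact (planar_subdivide_iff D d).symm
  | refl D => rfl
  | symm D D' _ ih => exact ih.symm
  | trans D D' D'' _ _ ih ih' => exact ih.trans ih'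

theorem bracket_eq (h : MarkEquiv D D') (A : ℂ) : D.bracket A = D'.bracket A := by
  induction h with
  | rel D D' h =>
    rcases h with ⟨⟨f⟩⟩ | ⟨d, rfl⟩
    · exact f.bracket_eq A
    · exact (bracket_subdivide D d A).symm
  | refl D => rfl
  | symm D D' _ ih => exact ih.symm
  | trans D D' D'' _ _ ih ih' => exact ih.trans ih'

theorem det_eq (h : MarkEquiv D D') : D.det = D'.det := by
  rw [LinkDiagram.det_eq, h.bracket_eq, ← LinkDiagram.det_eq]

theorem sameLink (h : MarkEquiv D D') (hp : D.Planar) : SameLink D D' := by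
  induction h with
  | rel D D' h =>
    have hp' := (planar_iff (Relation.EqvGen.rel _ _ h)).1 hp
    rcases h with ⟨⟨f⟩⟩ | ⟨d, rfl⟩
    · exact .rel _ _ ⟨hp, hp', .iso f.isIso⟩
    · exact .rel _ _ ⟨hp, hp', .subdivide D d⟩
  | refl D => exact .refl D
  | symm D D' h ih => exact .symm _ _ (ih ((MarkEquiv.planar_iff h).2 hp))
  | trans D D' D'' h _ ih ih' => exact .trans _ _ _ (ih hp) (ih' ((MarkEquiv.planar_iff h).1 hp))

end MarkEquiv

end LinkDiagram


/-- The complement of two points `p`, `q` in a set with a fixed point free involution inherits such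
an involution, for which the partners of `p` and `q` are paired. -/
theorem exists_spliced_involution {X Y : Type} [DecidableEq X] {e : Equiv.Perm X}
    (he : ∀ x, e (e x) = x) (hne : ∀ x, e x ≠ x) {p q : X} (hne' : p ≠ q)
    (hpq : e p ≠ q)
    {j : Y → X} (hj : Function.Injective j) (hr : ∀ x, (∃ y, j y = x) ↔ x ≠ p ∧ x ≠ q) :
    ∃ e' : Equiv.Perm Y, (∀ y, e' (e' y) = y) ∧ (∀ y, e' y ≠ y) ∧ ∀ y, j (e' y) =
      if e (j y) = p then e q else if e (j y) = q then e p else e (j y) := by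
  have hqp : e q ≠ p := fun h => hpq (by rw [← h, he])
  have hjp : ∀ y, j y ≠ p ∧ j y ≠ q := fun y => (hr _).1 ⟨y, rfl⟩
  have hex : ∀ y, ∃ z, j z = if e (j y) = p then e q else if e (j y) = q then e p else e (j y) := by
    intro y
    rw [hr]
    split_ifs with h1 h2
    · exact ⟨hqp, hne q⟩
    · exact ⟨hne p, hpq⟩
    · exact ⟨h1, h2⟩
  choose f hf using hex
  have hff : Function.Involutive f := by
    intro y
    apply hj
    rw [hf, hf]
    by_cases h1 : e (j y) = p
    · rw [if_pos h1, he, if_neg hne'.symm, if_pos rfl, ← h1, he]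
    · by_cases h2 : e (j y) = q
      · rw [if_neg h1, if_pos h2, he, if_pos rfl, ← h2, he]
      · rw [if_neg h1, if_neg h2, he, if_neg (hjp y).1, if_neg (hjp y).2]
  refine ⟨hff.toPerm f, hff, fun y hy => ?_, hf⟩
  have h := hf y
  rw [show f y = y from hy] at h
  split_ifs at h with h1 h2
  · exact hne' (by rw [← h1, h, he])
  · exact hne' (by rw [← h2, h, he])
  · exact hne _ h.symm

namespace LinkDiagram

/-! ### Removing marked points -/

section RemoveMark

variable (D : LinkDiagram) (b : D.B)

/-- The half-edges other than those of the marked point `b`. -/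
def keepDart : (D.C × Fin 4) ⊕ ({b' : D.B // b' ≠ b} × Fin 2) → D.Dart :=
  Sum.map id (Prod.map Subtype.val id)

theorem keepDart_injective : Function.Injective (D.keepDart b) :=
  Function.Injective.sumMap Function.injective_id
    (Function.Injective.prodMap Subtype.val_injective Function.injective_id)

theorem exists_keepDart_iff (x : D.Dart) :
    (∃ y, D.keepDart b y = x) ↔ x ≠ Sum.inr (b, 0) ∧ x ≠ Sum.inr (b, 1) := by
  constructor
  · rintro ⟨q | ⟨⟨b', hb⟩, k⟩, rfl⟩
    · exact ⟨Sum.inl_ne_inr, Sum.inl_ne_inr⟩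
    · constructor <;> exact fun h => hb (congrArg Prod.fst (Sum.inr.inj h))
  · rintro ⟨h0, h1⟩
    rcases x with q | ⟨b', k⟩
    · exact ⟨Sum.inl q, rfl⟩
    · have hb : b' ≠ b := by
        rintro rfl
        fin_cases k
        · exact h0 rfl
        · exact h1 rfl
      exact ⟨Sum.inr (⟨b', hb⟩, k), rfl⟩

variable {D b} (h : D.edge (Sum.inr (b, 0)) ≠ Sum.inr (b, 1))

/-- The hypothesis excludes a marked point that is a whole circle by itself, whose removal would
delete a component of the link. -/
theorem exists_removeMark_edge (h : D.edge (Sum.inr (b, 0)) ≠ Sum.inr (b, 1)) :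
    ∃ e' : Equiv.Perm ((D.C × Fin 4) ⊕ ({b' : D.B // b' ≠ b} × Fin 2)),
      (∀ y, e' (e' y) = y) ∧ (∀ y, e' y ≠ y) ∧ ∀ y, D.keepDart b (e' y) =
        if D.edge (D.keepDart b y) = Sum.inr (b, 0) then D.edge (Sum.inr (b, 1))
        else if D.edge (D.keepDart b y) = Sum.inr (b, 1) then D.edge (Sum.inr (b, 0))
        else D.edge (D.keepDart b y) :=
  exists_spliced_involution D.edge_edge D.edge_ne (p := Sum.inr (b, 0)) (q := Sum.inr (b, 1))
    (by simp) h (D.keepDart_injective b) (D.exists_keepDart_iff b)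

/-- `D` without the marked point `b`. -/
noncomputable def removeMark (h : D.edge (Sum.inr (b, 0)) ≠ Sum.inr (b, 1)) : LinkDiagram where
  C := D.C
  B := {b' : D.B // b' ≠ b}
  edge := (exists_removeMark_edge h).choose
  edge_edge := (exists_removeMark_edge h).choose_spec.1
  edge_ne := (exists_removeMark_edge h).choose_spec.2.1

/-- The half-edges that are kept. -/
def removeMarkOld : (removeMark h).Dart → D.Dart := D.keepDart b

theorem removeMarkOld_injective : Function.Injective (removeMarkOld h) := D.keepDart_injective b

theorem removeMarkOld_rot (y : (removeMark h).Dart) :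
    removeMarkOld h ((removeMark h).rot y) = D.rot (removeMarkOld h y) := by
  rcases y with q | ⟨b', k⟩ <;> rfl

theorem removeMarkOld_ne (y : (removeMark h).Dart) (k : Fin 2) :
    removeMarkOld h y ≠ Sum.inr (b, k) := by
  have := (D.exists_keepDart_iff b _).1 ⟨y, rfl⟩
  fin_cases k
  · exact this.1
  · exact this.2

theorem removeMark_dart_cases (x : D.Dart) :
    (∃ y, x = removeMarkOld h y) ∨ ∃ k, x = Sum.inr (b, k) := by
  by_cases hx : ∃ y, D.keepDart b y = x
  · exact Or.inl (hx.imp fun _ => Eq.symm)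
  · right
    by_contra! hk
    exact hx ((D.exists_keepDart_iff b x).2 ⟨hk 0, hk 1⟩)

theorem removeMark_edge_of_mark {y : (removeMark h).Dart} {k : Fin 2}
    (hy : D.edge (removeMarkOld h y) = Sum.inr (b, k)) :
    removeMarkOld h ((removeMark h).edge y) = D.edge (Sum.inr (b, k + 1)) := by
  have h1 := (exists_removeMark_edge h).choose_spec.2.2 y
  change removeMarkOld h ((removeMark h).edge y) =
    if D.edge (removeMarkOld h y) = _ then _ else if D.edge (removeMarkOld h y) = _ then _ else _ at h1
  rw [h1, hy]
  fin_cases k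
  · exact if_pos rfl
  · exact (if_neg (by simp)).trans (if_pos rfl)

theorem removeMark_edge_of_ne {y : (removeMark h).Dart}
    (hy : ∀ k, D.edge (removeMarkOld h y) ≠ Sum.inr (b, k)) :
    removeMarkOld h ((removeMark h).edge y) = D.edge (removeMarkOld h y) := by
  have h1 := (exists_removeMark_edge h).choose_spec.2.2 y
  change removeMarkOld h ((removeMark h).edge y) =
    if D.edge (removeMarkOld h y) = _ then _ else if D.edge (removeMarkOld h y) = _ then _ else _ at h1
  rw [h1, if_neg (hy 0), if_neg (hy 1)]
  rfl

theorem mark_edge_ne (h : D.edge (Sum.inr (b, 0)) ≠ Sum.inr (b, 1)) (k : Fin 2) : D.edge (Sum.inr (b, k)) ≠ Sum.inr (b, k + 1) := by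
  fin_cases k
  · exact h
  · exact fun h' => h (by rw [← D.edge_edge (Sum.inr (b, 1))]; exact congrArg D.edge h'.symm)

theorem exists_removeMarkOld_edge (k : Fin 2) :
    ∃ y, removeMarkOld h y = D.edge (Sum.inr (b, k)) := by
  rcases removeMark_dart_cases h (D.edge (Sum.inr (b, k))) with ⟨y, hy⟩ | ⟨l, hl⟩
  · exact ⟨y, hy.symm⟩
  · exfalso
    by_cases hlk : l = k
    · exact D.edge_ne _ (hlk ▸ hl)
    · have : l = k + 1 := by clear hl; revert k l; decide
      exact mark_edge_ne h k (this ▸ hl)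

/-- The half-edge next to a half-edge of the removed marked point. -/
noncomputable def removeMarkEnd (k : Fin 2) : (removeMark h).Dart :=
  (exists_removeMarkOld_edge h k).choose

theorem removeMarkOld_end (k : Fin 2) :
    removeMarkOld h (removeMarkEnd h k) = D.edge (Sum.inr (b, k)) :=
  (exists_removeMarkOld_edge h k).choose_spec

theorem removeMark_edge_end (k : Fin 2) :
    (removeMark h).edge (removeMarkEnd h k) = removeMarkEnd h (k + 1) := by
  apply removeMarkOld_injective h
  rw [removeMark_edge_of_mark h (k := k), removeMarkOld_end]
  rw [removeMarkOld_end, edge_edge]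

/-- Subdividing the spliced edge restores `b`. A new point has its half-edge `1` joined to the
chosen half-edge, which must therefore be the neighbour of `(b, 1)`. -/
theorem markEquiv_removeMark : MarkEquiv D (removeMark h) := by
  refine MarkEquiv.trans (.of_labelIso ?_)
    (MarkEquiv.subdivide (removeMark h) (removeMarkEnd h 1)).symm
  set E := (removeMark h).subdivide (removeMarkEnd h 1) with hE
  let f : D.Dart ≃ E.Dart := Equiv.sumCongr (Equiv.refl _)
    (Equiv.prodCongr (Equiv.optionSubtypeNe b).symm (Equiv.refl _))
  have fold : ∀ y, f (removeMarkOld h y) = (removeMark h).subdivideOld (removeMarkEnd h 1) y := by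
    rintro (q | ⟨⟨b', hb⟩, k⟩)
    · rfl
    · change Sum.inr ((Equiv.optionSubtypeNe b).symm b', k) = Sum.inr (some ⟨b', hb⟩, k)
      rw [Equiv.optionSubtypeNe_symm_of_ne hb]
  have fnew : ∀ k, f (Sum.inr (b, k)) =
      (removeMark h).subdivideNew (removeMarkEnd h 1) k := fun k => by
    change Sum.inr ((Equiv.optionSubtypeNe b).symm b, k) = Sum.inr (none, k)
    rw [Equiv.optionSubtypeNe_symm_self]
  have hnew : ∀ k, f (D.edge (Sum.inr (b, k))) = E.edge (f (Sum.inr (b, k))) := fun k => by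
    rw [← removeMarkOld_end h, fold, fnew]
    fin_cases k
    · refine Eq.trans ?_ (subdivide_edge_new_zero _ _).symm
      rw [removeMark_edge_end]
      rfl
    · exact (subdivide_edge_new_one _ _).symm
  have hedge : ∀ d, f (D.edge d) = E.edge (f d) := by
    intro d
    rcases removeMark_dart_cases h d with ⟨y, rfl⟩ | ⟨k, rfl⟩
    · rcases removeMark_dart_cases h (D.edge (removeMarkOld h y)) with ⟨z, hz⟩ | ⟨k, hk⟩
      · have hy : ∀ k, D.edge (removeMarkOld h y) ≠ Sum.inr (b, k) := fun k hk =>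
          removeMarkOld_ne h z k (hz ▸ hk)
        have hyk : ∀ k, y ≠ removeMarkEnd h k := by
          rintro k rfl
          exact hy k (by rw [removeMarkOld_end, edge_edge])
        rw [← removeMark_edge_of_ne h hy, fold, fold]
        exact (subdivide_edge_old _ _ (hyk 1) (by rw [removeMark_edge_end]; exact hyk _)).symm
      · have hy : removeMarkOld h y = D.edge (Sum.inr (b, k)) := by rw [← hk, edge_edge]
        rw [hy, hnew, edge_edge, edge_edge]
    · exact hnew k
  exact ⟨Equiv.refl _, f, fun x i => rfl, fun d => by rcases d with q | ⟨b', k⟩ <;> rfl, hedge⟩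

end RemoveMark


/-! ### Removing several marked points -/

/-- `Runs D R u v`: leaving a vertex through the half-edge `u` and passing only through vertices
outside `R`, one arrives at a vertex through the half-edge `v`. -/
inductive Runs (D : LinkDiagram) (R : Set D.Dart) : D.Dart → D.Dart → Prop
  | edge (u : D.Dart) : Runs D R u (D.edge u)
  | pass (u v : D.Dart) : Runs D R u v → v ∉ R → Runs D R u (D.edge (D.rot v))

/-- `D'` is obtained from `D` by removing the half-edges outside the range of `ι`, which belong to
marked points. -/
structure Splices (D D' : LinkDiagram) (φ : D'.C ≃ D.C) (ι : D'.Dart → D.Dart) : Prop where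
  inj : Function.Injective ι
  inl : ∀ x i, ι (Sum.inl (x, i)) = Sum.inl (φ x, i)
  rot : ∀ d, ι (D'.rot d) = D.rot (ι d)
  runs : ∀ d, D.Runs (Set.range ι) (ι d) (ι (D'.edge d))
  reach : ∀ u ∉ Set.range ι, ∃ d, D.Runs (Set.range ι) (ι d) u

namespace Splices

variable {D D' : LinkDiagram} {φ : D'.C ≃ D.C} {ι : D'.Dart → D.Dart}

theorem inl_mem (h : Splices D D' φ ι) (x : D.C) (i : Fin 4) : Sum.inl (x, i) ∈ Set.range ι :=
  ⟨Sum.inl (φ.symm x, i), by rw [h.inl, Equiv.apply_symm_apply]⟩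

theorem exists_of_notMem (h : Splices D D' φ ι) {u : D.Dart} (hu : u ∉ Set.range ι) :
    ∃ b k, u = Sum.inr (b, k) := by
  rcases u with ⟨x, i⟩ | ⟨b, k⟩
  · exact absurd (h.inl_mem x i) hu
  · exact ⟨b, k, rfl⟩

theorem exists_inr (h : Splices D D' φ ι) (q : D'.B × Fin 2) :
    ∃ q', ι (Sum.inr q) = Sum.inr q' := by
  rcases hq : ι (Sum.inr q) with ⟨y, i⟩ | q'
  · obtain ⟨x, rfl⟩ := φ.surjective y
    rw [← h.inl] at hq
    exact absurd (h.inj hq) Sum.inr_ne_inl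
  · exact ⟨q', rfl⟩

theorem rot_notMem (h : Splices D D' φ ι) {b : D.B} {k : Fin 2}
    (hu : Sum.inr (b, k) ∉ Set.range ι) (l : Fin 2) : Sum.inr (b, l) ∉ Set.range ι := by
  by_cases hl : l = k
  · rwa [hl]
  · rintro ⟨d, hd⟩
    refine hu ⟨D'.rot d, ?_⟩
    rw [h.rot, hd, rot_inr, show l + 1 = k by clear hd hu; revert k l; decide]

/-- A marked point closed up on itself is a component of its own, so a run that starts outside
cannot enter it. -/
theorem ne_of_runs {b : D.B} (hb : D.edge (Sum.inr (b, 0)) = Sum.inr (b, 1))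
    {R : Set D.Dart} {u v : D.Dart} (hu : ∀ k, u ≠ Sum.inr (b, k)) (h : D.Runs R u v) :
    ∀ k, v ≠ Sum.inr (b, k) := by
  have key : ∀ (x : D.Dart) (k : Fin 2), D.edge x = Sum.inr (b, k) → ∃ l, x = Sum.inr (b, l) := by
    intro x k hx
    rw [← D.edge_edge x, hx]
    fin_cases k
    · exact ⟨1, hb⟩
    · exact ⟨0, by rw [← D.edge_edge (Sum.inr (b, 0)), hb]; rfl⟩
  induction h with
  | edge => exact fun k hk => (key _ k hk).elim hu
  | pass v _ _ ih =>
    intro k hk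
    obtain ⟨l, hl⟩ := key _ k hk
    rcases v with ⟨x, i⟩ | ⟨b', m⟩
    · rw [rot_inl] at hl
      exact Sum.inl_ne_inr hl
    · rw [rot_inr] at hl
      exact ih m (congrArg Sum.inr (Prod.ext (congrArg Prod.fst (Sum.inr.inj hl) : b' = b) rfl))

/-- A run that arrives at `b` has no endpoint after the removal. The second clause carries it on to
the half-edge beyond `b`, which makes the induction go through. -/
theorem runs_removeMark {b : D.B} (hb : D.edge (Sum.inr (b, 0)) ≠ Sum.inr (b, 1))
    {R : Set D.Dart} {u v : D.Dart} {y : (removeMark hb).Dart} (hy : u = removeMarkOld hb y)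
    (h : D.Runs R u v) :
    (∀ z, v = removeMarkOld hb z → (removeMark hb).Runs (removeMarkOld hb ⁻¹' R) y z) ∧
      ∀ k, v = Sum.inr (b, k) → ∀ z, removeMarkOld hb z = D.edge (Sum.inr (b, k + 1)) →
        (removeMark hb).Runs (removeMarkOld hb ⁻¹' R) y z := by
  have step : ∀ (w : (removeMark hb).Dart) (x : D.Dart), x = removeMarkOld hb w →
      (∀ z, D.edge x = removeMarkOld hb z → z = (removeMark hb).edge w) ∧
      ∀ k, D.edge x = Sum.inr (b, k) → ∀ z, removeMarkOld hb z = D.edge (Sum.inr (b, k + 1)) →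
        z = (removeMark hb).edge w := by
    rintro w _ rfl
    refine ⟨fun z hz => removeMarkOld_injective hb ?_, fun k hk z hz => removeMarkOld_injective hb ?_⟩
    · rw [removeMark_edge_of_ne, hz]
      intro k hk
      exact removeMarkOld_ne hb z k (hz.symm.trans hk)
    · rw [hz, removeMark_edge_of_mark hb hk]
  induction h with
  | edge =>
    refine ⟨fun z hz => ?_, fun k hk z hz => ?_⟩
    · rw [(step y _ hy).1 z hz]
      exact .edge y
    · rw [(step y _ hy).2 k hk z hz]
      exact .edge y
  | pass v hv hvR ih =>
    rcases removeMark_dart_cases hb v with ⟨w, rfl⟩ | ⟨l, rfl⟩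
    · have h1 := Runs.pass _ _ (ih.1 w rfl) hvR
      refine ⟨fun z hz => ?_, fun k hk z hz => ?_⟩
      · rw [(step _ _ (removeMarkOld_rot hb w).symm).1 z hz]
        exact h1
      · rw [(step _ _ (removeMarkOld_rot hb w).symm).2 k hk z hz]
        exact h1
    · rw [rot_inr]
      refine ⟨fun z hz => ih.2 l rfl z hz.symm, fun k hk => ?_⟩
      exfalso
      by_cases hkl : k = l + 1
      · exact D.edge_ne _ (hkl ▸ hk)
      · refine mark_edge_ne hb (l + 1) (hk.trans ?_)
        congr 2
        have : ∀ k l : Fin 2, k ≠ l + 1 → k = l + 1 + 1 := by decide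
        exact this k l hkl

/-- The marked points outside the range of `ι` are removed one at a time; `reach` guarantees that
none of them is a circle by itself. Once all are gone every run is a single edge and `ι` is an
isomorphism. -/
theorem markEquiv (h : Splices D D' φ ι) : MarkEquiv D D' := by
  induction hn : Fintype.card D.B using Nat.strong_induction_on generalizing D with
  | _ n ih =>
    by_cases hs : ∀ u, u ∈ Set.range ι
    · refine (MarkEquiv.of_labelIso ⟨φ, Equiv.ofBijective ι ⟨h.inj, hs⟩, h.inl, h.rot, ?_⟩).symm
      intro d
      change ι (D'.edge d) = D.edge (ι d)
      have := h.runs d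
      generalize ι (D'.edge d) = v at this
      cases this with
      | edge => rfl
      | pass v _ hv => exact absurd (hs v) hv
    · push Not at hs
      obtain ⟨u, hu⟩ := hs
      obtain ⟨b, k, rfl⟩ := h.exists_of_notMem hu
      have hk := h.rot_notMem hu
      have hιk : ∀ d l, ι d ≠ Sum.inr (b, l) := fun d l hd => hk l ⟨d, hd⟩
      have hb : D.edge (Sum.inr (b, 0)) ≠ Sum.inr (b, 1) := by
        intro hb
        obtain ⟨d, hd⟩ := h.reach _ hu
        exact ne_of_runs hb (hιk d) hd k rfl
      have hex : ∀ d, ∃ y, ι d = removeMarkOld hb y := fun d =>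
        (removeMark_dart_cases hb (ι d)).resolve_right fun ⟨l, hl⟩ => hιk d l hl
      choose ι' hι' using hex
      have hR : removeMarkOld hb ⁻¹' Set.range ι = Set.range ι' := by
        ext y
        constructor
        · rintro ⟨d, hd⟩
          exact ⟨d, removeMarkOld_injective hb ((hι' d).symm.trans hd)⟩
        · rintro ⟨d, rfl⟩
          exact ⟨d, hι' d⟩
      refine (markEquiv_removeMark hb).trans
        (ih (Fintype.card (removeMark hb).B) ?_ (φ := φ) (ι := ι') ?_ rfl)
      · rw [← hn]
        exact Fintype.card_subtype_lt (x := b) (by simp)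
      · refine ⟨fun d d' hd => h.inj (by rw [hι', hι', hd]), fun x i => ?_, fun d => ?_,
          fun d => ?_, fun y hy => ?_⟩
        · apply removeMarkOld_injective hb
          rw [← hι', h.inl]
          rfl
        · apply removeMarkOld_injective hb
          rw [← hι', h.rot, hι', removeMarkOld_rot]
        · rw [← hR]
          exact (runs_removeMark hb (hι' d) (h.runs d)).1 _ (hι' _)
        · rw [← hR] at hy ⊢
          obtain ⟨d, hd⟩ := h.reach _ hy
          exact ⟨d, (runs_removeMark hb (hι' d) hd).1 _ rfl⟩

end Splices

end LinkDiagram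


namespace LinkDiagram

variable {D : LinkDiagram} {b : D.B}

/-! ### Colourings and marked points -/

theorem IsColoring.removeMark {o : D.Dart → Bool} (ho : D.IsColoring o)
    (h : D.edge (Sum.inr (b, 0)) ≠ Sum.inr (b, 1)) :
    (LinkDiagram.removeMark h).IsColoring (o ∘ removeMarkOld h) := by
  refine ⟨fun y => ?_, fun y => ?_⟩
  · rw [Function.comp_apply, Function.comp_apply]
    rcases removeMark_dart_cases h (D.edge (removeMarkOld h y)) with ⟨z, hz⟩ | ⟨k, hk⟩
    · rw [removeMark_edge_of_ne, ho.edge]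
      exact fun k hk => removeMarkOld_ne h z k (hz ▸ hk)
    · rw [removeMark_edge_of_mark h hk, ho.edge, ho.inr, ← hk, ho.edge, Bool.not_not]
  · rw [Function.comp_apply, Function.comp_apply, removeMarkOld_rot, ho.rot]

theorem IsAltColoring.removeMark {o : D.Dart → Bool} (ho : D.IsAltColoring o)
    (h : D.edge (Sum.inr (b, 0)) ≠ Sum.inr (b, 1)) :
    (LinkDiagram.removeMark h).IsAltColoring (o ∘ removeMarkOld h) :=
  ⟨ho.toIsColoring.removeMark h, ho.color_over⟩

/-- Each half-edge of `b` receives the colour opposite to that of its neighbour. The two neighbours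
are joined after the removal, so they differ and the colours alternate at `b`. -/
theorem IsAltColoring.of_removeMark (h : D.edge (Sum.inr (b, 0)) ≠ Sum.inr (b, 1))
    {o : (LinkDiagram.removeMark h).Dart → Bool}
    (ho : (LinkDiagram.removeMark h).IsAltColoring o) : ∃ o', D.IsAltColoring o' := by
  let o' : D.Dart → Bool
    | Sum.inl q => o (Sum.inl q)
    | Sum.inr (b', k) =>
        if hb : b' = b then !o (removeMarkEnd h k) else o (Sum.inr (⟨b', hb⟩, k))
  have hold : ∀ y, o' (removeMarkOld h y) = o y := by
    rintro (q | ⟨⟨b', hb⟩, k⟩)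
    · rfl
    · exact dif_neg hb
  have hnew : ∀ k, o' (Sum.inr (b, k)) = !o (removeMarkEnd h k) := fun k => dif_pos rfl
  refine ⟨o', ⟨fun d => ?_, fun d => ?_⟩, ho.color_over⟩
  · rcases removeMark_dart_cases h d with ⟨y, rfl⟩ | ⟨k, rfl⟩
    · rcases removeMark_dart_cases h (D.edge (removeMarkOld h y)) with ⟨z, hz⟩ | ⟨k, hk⟩
      · rw [← removeMark_edge_of_ne h fun k hk => removeMarkOld_ne h z k (hz ▸ hk), hold, hold,
          ho.edge]
      · have hy : y = removeMarkEnd h k := by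
          apply removeMarkOld_injective h
          rw [removeMarkOld_end, ← hk, edge_edge]
        rw [hk, hnew, hold, hy]
    · rw [hnew, ← removeMarkOld_end h, hold, Bool.not_not]
  · rcases removeMark_dart_cases h d with ⟨y, rfl⟩ | ⟨k, rfl⟩
    · rw [← removeMarkOld_rot, hold, hold, ho.rot]
    · rw [rot_inr, hnew, hnew, ← removeMark_edge_end, ho.edge]

theorem joined_of_removeMark (h : D.edge (Sum.inr (b, 0)) ≠ Sum.inr (b, 1))
    {u v : (LinkDiagram.removeMark h).Dart} (huv : (LinkDiagram.removeMark h).Joined u v) :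
    D.Joined (removeMarkOld h u) (removeMarkOld h v) := by
  have step : ∀ w x, (D.Joined x (D.edge (removeMarkOld h w))) →
      D.Joined x (removeMarkOld h ((LinkDiagram.removeMark h).edge w)) := by
    intro w x hx
    rcases removeMark_dart_cases h (D.edge (removeMarkOld h w)) with ⟨z, hz⟩ | ⟨k, hk⟩
    · rwa [removeMark_edge_of_ne]
      exact fun k hk => removeMarkOld_ne h z k (hz ▸ hk)
    · rw [removeMark_edge_of_mark h hk]
      rw [hk] at hx
      exact .pass _ _ _ hx
  induction huv with
  | edge => exact step _ _ (.edge _)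
  | pass b' j _ ih => exact step _ _ (.pass _ b'.1 j ih)

theorem Alternating.removeMark (ha : D.Alternating)
    (h : D.edge (Sum.inr (b, 0)) ≠ Sum.inr (b, 1)) : (LinkDiagram.removeMark h).Alternating :=
  fun x y i j hj => ha x y i j (joined_of_removeMark h hj)

/-- Remove marked points until those left are circles by themselves. Then the edges at crossings
join crossings directly, and being over or under is the colouring; the circles can be coloured
freely. -/
theorem Alternating.exists_coloring (ha : D.Alternating) : ∃ o, D.IsAltColoring o := by
  induction hn : Fintype.card D.B using Nat.strong_induction_on generalizing D with
  | _ n ih =>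
    by_cases h : ∃ b, D.edge (Sum.inr (b, 0)) ≠ Sum.inr (b, 1)
    · obtain ⟨b, h⟩ := h
      obtain ⟨o, ho⟩ := ih (Fintype.card (LinkDiagram.removeMark h).B)
        (by rw [← hn]; exact Fintype.card_subtype_lt (x := b) (by simp)) (ha.removeMark h) rfl
      exact ho.of_removeMark h
    · push Not at h
      have h1 : ∀ b, D.edge (Sum.inr (b, 1)) = Sum.inr (b, 0) := fun b => by
        rw [← h b, edge_edge]
      let o : D.Dart → Bool
        | Sum.inl (x, i) => D.isOver (Sum.inl (x, i))
        | Sum.inr (b, k) => decide (k = 0)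
      refine ⟨o, ⟨?_, ?_⟩, fun x => rfl⟩
      · rintro (⟨x, i⟩ | ⟨b, k⟩)
        · rcases hd : D.edge (Sum.inl (x, i)) with ⟨y, j⟩ | ⟨b, k⟩
          · have := ha x y i j (hd ▸ Joined.edge _)
            exact Bool.eq_not.2 this.symm
          · have hd' : D.edge (Sum.inr (b, k)) = Sum.inl (x, i) := by rw [← hd, edge_edge]
            fin_cases k
            · exact absurd ((h b).symm.trans hd') Sum.inr_ne_inl
            · exact absurd ((h1 b).symm.trans hd') Sum.inr_ne_inl
        · fin_cases k
          · exact (congrArg o (h b)).trans rfl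
          · exact (congrArg o (h1 b)).trans rfl
      · rintro (⟨x, i⟩ | ⟨b, k⟩)
        · rw [rot_inl]
          change decide _ = !decide _
          revert i; decide
        · rw [rot_inr]
          change decide _ = !decide _
          revert k; decide

/-- The half-edges of `D` as half-edges of the diagram after a crossing change. -/
def changeEquiv (D : LinkDiagram) (c : D.C) : D.Dart ≃ (D.changeCrossing c).Dart := D.shiftAt c

theorem changeEquiv_inl (c x : D.C) (i : Fin 4) : D.changeEquiv c (Sum.inl (x, i)) =
    Sum.inl ((show (D.changeCrossing c).C from x), if x = c then i + 1 else i) := by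
  have : D.shiftAt c (Sum.inl (x, i)) = Sum.inl (x, if x = c then i + 1 else i) := by
    by_cases h : x = c <;> simp [shiftAt, h]
  exact this

theorem changeCrossing_edge (c : D.C) (d : D.Dart) :
    (D.changeCrossing c).edge (D.changeEquiv c d) = D.changeEquiv c (D.edge d) := by
  change (D.shiftAt c).permCongr D.edge (D.shiftAt c d) = _
  rw [Equiv.permCongr_apply, Equiv.symm_apply_apply]
  rfl

theorem changeCrossing_rot (c : D.C) (d : D.Dart) :
    (D.changeCrossing c).rot (D.changeEquiv c d) = D.changeEquiv c (D.rot d) := by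
  rcases d with ⟨x, i⟩ | ⟨b, k⟩
  · rw [rot_inl, changeEquiv_inl, changeEquiv_inl]
    refine (rot_inl _ _ _).trans ?_
    split_ifs <;> rfl
  · rfl

/-- The colouring of the changed diagram is pulled back. The change shifts the numbering at `c` by
one, so the over-strand of `D` at `c` gets the colour of an under-strand. -/
theorem IsDealternator.exists_coloring {c : D.C} (hc : D.IsDealternator c) :
    ∃ o, D.IsDealtColoring o c := by
  obtain ⟨o, ho⟩ := Alternating.exists_coloring hc
  refine ⟨o ∘ D.changeEquiv c, ⟨fun d => ?_, fun d => ?_⟩, fun x => ?_⟩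
  · rw [Function.comp_apply, Function.comp_apply, ← changeCrossing_edge, ho.edge]
  · rw [Function.comp_apply, Function.comp_apply, ← changeCrossing_rot, ho.rot]
  · rw [Function.comp_apply, changeEquiv_inl]
    by_cases hx : x = c
    · rw [if_pos hx, decide_eq_false (by simpa using hx)]
      exact (ho.toIsColoring.inl x 2).trans
        ((if_neg (by decide)).trans (congrArg Bool.not (ho.color_over x)))
    · rw [if_neg hx, decide_eq_true hx]
      exact ho.color_over x

/-! ### Smoothings and marked points -/

theorem splitRot_self (c : D.C) (β : Bool) (i : Fin 4) :
    D.splitRot c β (Sum.inl (c, i)) = Sum.inl (c, smoothPairing β i) := by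
  simp [splitRot]

theorem splitRot_of_ne {c x : D.C} (h : x ≠ c) (β : Bool) (i : Fin 4) :
    D.splitRot c β (Sum.inl (x, i)) = Sum.inl (x, i + 1) := by
  simp [splitRot, h]

theorem splitRot_inr (c : D.C) (β : Bool) (b : D.B) (k : Fin 2) :
    D.splitRot c β (Sum.inr (b, k)) = Sum.inr (b, k + 1) := by
  simp [splitRot, swap_zero_one]

theorem Runs.smooth {R : Set D.Dart} (hR : ∀ q, Sum.inl q ∈ R) (c : D.C) (β : Bool)
    {u v : D.Dart} (h : D.Runs R u v) :
    (D.smooth c β).Runs (D.smoothEquiv c β '' R) (D.smoothEquiv c β u) (D.smoothEquiv c β v) := by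
  induction h with
  | edge =>
    rw [← smooth_edge]
    exact .edge _
  | pass v _ hv ih =>
    rcases v with q | ⟨b, k⟩
    · exact absurd (hR q) hv
    · have h1 : D.rot (Sum.inr (b, k)) = D.splitRot c β (Sum.inr (b, k)) := by
        rw [rot_inr, splitRot_inr]
      rw [h1, ← smooth_edge, ← smooth_rot]
      refine .pass _ _ ih ?_
      rwa [(D.smoothEquiv c β).injective.mem_set_image]

/-- The crossings other than `x` under a bijection of the crossings. -/
def smoothCrossingEquiv {D' : LinkDiagram} (φ : D'.C ≃ D.C) (x : D'.C) (β : Bool) :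
    (D'.smooth x β).C ≃ (D.smooth (φ x) β).C :=
  φ.subtypeEquiv fun y => by simp

/-- This is why `Splices` is used instead of `MarkEquiv`: it keeps track of the crossings, and its
runs pass through marked points only, so they are undisturbed by a smoothing. -/
theorem Splices.smooth {D' : LinkDiagram} {φ : D'.C ≃ D.C} {ι : D'.Dart → D.Dart}
    (h : Splices D D' φ ι) (x : D'.C) (β : Bool) :
    Splices (D.smooth (φ x) β) (D'.smooth x β) (smoothCrossingEquiv φ x β)
      (D.smoothEquiv (φ x) β ∘ ι ∘ (D'.smoothEquiv x β).symm) := by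
  have hrange : Set.range (D.smoothEquiv (φ x) β ∘ ι ∘ (D'.smoothEquiv x β).symm) =
      D.smoothEquiv (φ x) β '' Set.range ι := by
    rw [Set.range_comp, (D'.smoothEquiv x β).symm.surjective.range_comp]
  have hsplit : ∀ d, ι (D'.splitRot x β d) = D.splitRot (φ x) β (ι d) := by
    rintro (⟨y, i⟩ | ⟨q, k⟩)
    · by_cases hy : y = x
      · subst hy
        rw [splitRot_self, h.inl, h.inl, splitRot_self]
      · rw [splitRot_of_ne hy, h.inl, h.inl, splitRot_of_ne (by simpa using hy)]
    · obtain ⟨⟨q', k'⟩, hq⟩ := h.exists_inr (q, k)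
      rw [splitRot_inr, ← rot_inr, h.rot, hq, splitRot_inr, rot_inr]
  refine ⟨(D.smoothEquiv (φ x) β).injective.comp (h.inj.comp (D'.smoothEquiv x β).symm.injective),
    ?_, ?_, ?_, ?_⟩
  · rintro ⟨y, hy⟩ i
    change D.smoothEquiv (φ x) β (ι (Sum.inl (y, i))) = _
    rw [h.inl, smoothEquiv_of_ne D (c := φ x) (x := φ y) (by simpa using hy)]
    rfl
  · intro d
    obtain ⟨d, rfl⟩ := (D'.smoothEquiv x β).surjective d
    rw [smooth_rot]
    simp only [Function.comp_apply, Equiv.symm_apply_apply]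
    rw [hsplit, smooth_rot]
  · intro d
    obtain ⟨d, rfl⟩ := (D'.smoothEquiv x β).surjective d
    rw [hrange, smooth_edge]
    simp only [Function.comp_apply, Equiv.symm_apply_apply]
    exact (h.runs d).smooth (fun q => h.inl_mem q.1 q.2) _ _
  · intro u hu
    obtain ⟨u, rfl⟩ := (D.smoothEquiv (φ x) β).surjective u
    rw [hrange] at hu ⊢
    rw [(D.smoothEquiv (φ x) β).injective.mem_set_image] at hu
    obtain ⟨d, hd⟩ := h.reach u hu
    refine ⟨D'.smoothEquiv x β d, ?_⟩
    simp only [Function.comp_apply, Equiv.symm_apply_apply]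
    exact hd.smooth (fun q => h.inl_mem q.1 q.2) _ _

end LinkDiagram


/-! ### Kinks and the first Reidemeister move -/

/-- The restriction of a fixed point free involution to an invariant subset. -/
theorem exists_restricted_involution {X Y : Type} {e : Equiv.Perm X}
    (he : ∀ x, e (e x) = x) (hne : ∀ x, e x ≠ x) {j : Y → X} (hj : Function.Injective j)
    (hr : ∀ y, ∃ z, j z = e (j y)) :
    ∃ e' : Equiv.Perm Y, (∀ y, e' (e' y) = y) ∧ (∀ y, e' y ≠ y) ∧ ∀ y, j (e' y) = e (j y) := by
  choose f hf using hr
  have hff : Function.Involutive f := fun y => hj (by rw [hf, hf, he])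
  refine ⟨hff.toPerm f, hff, fun y hy => hne (j y) ?_, hf⟩
  rw [← hf y]
  exact congrArg j hy

namespace TangleDiagram

variable {E : Type} [Fintype E] [DecidableEq E] (N T : TangleDiagram E)

/-- The half-edges of a tangle, including its ends. -/
abbrev Dart (N : TangleDiagram E) : Type := ((N.C × Fin 4) ⊕ (N.B × Fin 2)) ⊕ E

/-- The half-edges of the first tangle in the glued diagram. -/
def glueLeft : N.Dart → (N.glue T).Dart := fun z => glueDart N T (Sum.inl z)

/-- The half-edges of the second tangle in the glued diagram. -/
def glueRight : T.Dart → (N.glue T).Dart := fun z => glueDart N T (Sum.inr z)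

theorem glue_edge_left (z : N.Dart) :
    (N.glue T).edge (glueLeft N T z) = glueLeft N T (N.edge z) := by
  change (glueDart N T).permCongr _ (glueDart N T (Sum.inl z)) = _
  rw [Equiv.permCongr_apply, Equiv.symm_apply_apply]
  rfl

theorem glue_edge_right (z : T.Dart) :
    (N.glue T).edge (glueRight N T z) = glueRight N T (T.edge z) := by
  change (glueDart N T).permCongr _ (glueDart N T (Sum.inr z)) = _
  rw [Equiv.permCongr_apply, Equiv.symm_apply_apply]
  rfl

theorem glue_rot_left (e : E) :
    (N.glue T).rot (glueLeft N T (Sum.inr e)) = glueRight N T (Sum.inr e) := rfl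

theorem glue_rot_right (e : E) :
    (N.glue T).rot (glueRight N T (Sum.inr e)) = glueLeft N T (Sum.inr e) := rfl

/-- The position, relative to the start of the loop, of the ends of a kink (`k = 0`) and of the
half-edges of the loop which become connected to them when the kink is removed (`k = 1`). -/
def kinkOffset (e k : Fin 2) : Fin 4 :=
  if k = 0 then (if e = 0 then 3 else 2) else (if e = 0 then 0 else 1)

/-- The half-edges of the crossing of a kink. -/
def kinkHalf (o i : Fin 4) : (kink o).Dart := cr 0 i

/-- The connections of a kink. -/
def kinkEdge (o : Fin 4) : Equiv.Perm (((Fin 1 × Fin 4) ⊕ (Empty × Fin 2)) ⊕ Fin 2) :=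
  (kink o).edge

/-- The loop of `kink o` starts at the half-edge `1 + o`; a loop from `a` to `a + 1` therefore needs
`o = a + 3` modulo four. -/
theorem kink_edge_end (a : Fin 4) (e : Fin 2) :
    (kink (a + 3)).edge (Sum.inr e) = kinkHalf (a + 3) (a + kinkOffset e 0) := by
  have : ∀ (a : Fin 4) (e : Fin 2),
      kinkEdge (a + 3) (Sum.inr e) = cr 0 (a + kinkOffset e 0) := by decide
  exact this a e

theorem kink_edge_half (a : Fin 4) (e : Fin 2) :
    (kink (a + 3)).edge (kinkHalf (a + 3) (a + kinkOffset e 0)) = Sum.inr e := by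
  rw [← kink_edge_end, TangleDiagram.edge_edge]

theorem kink_edge_loop (a : Fin 4) :
    (kink (a + 3)).edge (kinkHalf (a + 3) a) = kinkHalf (a + 3) (a + 1) := by
  have : ∀ a : Fin 4, kinkEdge (a + 3) (cr 0 a) = cr 0 (a + 1) := by decide
  exact this a

theorem strand_edge (e : Fin 2) : strand.edge (Sum.inr e) = Sum.inr (e + 1) := by
  revert e; decide

end TangleDiagram

namespace LinkDiagram

open TangleDiagram

section Kink

variable (D : LinkDiagram) (x : D.C) (a : Fin 4)

/-- The half-edges outside a kink at `x`. -/
def outsideKink : (({y : D.C // y ≠ x} × Fin 4) ⊕ (D.B × Fin 2)) ⊕ Fin 2 → D.Dart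
  | Sum.inl (Sum.inl (y, i)) => Sum.inl (y.1, i)
  | Sum.inl (Sum.inr q) => Sum.inr q
  | Sum.inr e => Sum.inl (x, a + kinkOffset e 0)

theorem outsideKink_injective : Function.Injective (D.outsideKink x a) := by
  have h0 : ∀ e e' : Fin 2, kinkOffset e 0 = kinkOffset e' 0 → e = e' := by decide
  rintro ((⟨⟨y, hy⟩, i⟩ | q) | e) ((⟨⟨y', hy'⟩, i'⟩ | q') | e') h
  all_goals simp only [outsideKink, Sum.inl.injEq, Sum.inr.injEq, Prod.mk.injEq, reduceCtorEq,
    true_and, add_right_inj] at h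
  · obtain ⟨rfl, rfl⟩ := h
    rfl
  · exact absurd h.1 hy
  · rw [h]
  · exact absurd h.1.symm hy'
  · rw [h0 _ _ h]

theorem outsideKink_cases (d : D.Dart) : (∃ z, d = D.outsideKink x a z) ∨
    d = Sum.inl (x, a) ∨ d = Sum.inl (x, a + 1) := by
  rcases d with ⟨y, i⟩ | q
  · by_cases hy : y = x
    · subst hy
      have : ∀ a i : Fin 4, (i = a + kinkOffset 0 0 ∨ i = a + kinkOffset 1 0) ∨ i = a ∨
        i = a + 1 := by decide
      rcases this a i with (rfl | rfl) | rfl | rfl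
      · exact Or.inl ⟨Sum.inr 0, rfl⟩
      · exact Or.inl ⟨Sum.inr 1, rfl⟩
      · exact Or.inr (Or.inl rfl)
      · exact Or.inr (Or.inr rfl)
    · exact Or.inl ⟨Sum.inl (Sum.inl (⟨y, hy⟩, i)), rfl⟩
  · exact Or.inl ⟨Sum.inl (Sum.inr q), rfl⟩

theorem outsideKink_ne (z) : D.outsideKink x a z ≠ Sum.inl (x, a) ∧
    D.outsideKink x a z ≠ Sum.inl (x, a + 1) := by
  rcases z with (⟨⟨y, hy⟩, i⟩ | q) | e
  · constructor <;> exact fun h => hy (congrArg Prod.fst (Sum.inl.inj h))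
  · exact ⟨Sum.inr_ne_inl, Sum.inr_ne_inl⟩
  · have : ∀ (a : Fin 4) (e : Fin 2), a + kinkOffset e 0 ≠ a ∧ a + kinkOffset e 0 ≠ a + 1 := by
      decide
    exact ⟨fun h => (this a e).1 (congrArg Prod.snd (Sum.inl.inj h)),
      fun h => (this a e).2 (congrArg Prod.snd (Sum.inl.inj h))⟩

variable {D x a}

theorem exists_outsideKink_edge (h : D.edge (Sum.inl (x, a)) = Sum.inl (x, a + 1)) :
    ∃ e' : Equiv.Perm ((({y : D.C // y ≠ x} × Fin 4) ⊕ (D.B × Fin 2)) ⊕ Fin 2),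
      (∀ z, e' (e' z) = z) ∧ (∀ z, e' z ≠ z) ∧
        ∀ z, D.outsideKink x a (e' z) = D.edge (D.outsideKink x a z) :=
  exists_restricted_involution D.edge_edge D.edge_ne (D.outsideKink_injective x a) fun y => by
    have h' : D.edge (Sum.inl (x, a + 1)) = Sum.inl (x, a) := by rw [← h, edge_edge]
    rcases D.outsideKink_cases x a (D.edge (D.outsideKink x a y)) with ⟨z, hz⟩ | hz | hz
    · exact ⟨z, hz.symm⟩
    · exact absurd (by rw [← h, ← hz, edge_edge]) (D.outsideKink_ne x a y).2
    · exact absurd (by rw [← h', ← hz, edge_edge]) (D.outsideKink_ne x a y).1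

/-- The tangle outside a kink. -/
noncomputable def kinkTangle (h : D.edge (Sum.inl (x, a)) = Sum.inl (x, a + 1)) :
    TangleDiagram (Fin 2) where
  C := {y : D.C // y ≠ x}
  B := D.B
  edge := (exists_outsideKink_edge h).choose
  edge_edge := (exists_outsideKink_edge h).choose_spec.1
  edge_ne := (exists_outsideKink_edge h).choose_spec.2.1

/-- The half-edges of the tangle outside a kink as half-edges of `D`. -/
def kinkTangleDart (h : D.edge (Sum.inl (x, a)) = Sum.inl (x, a + 1)) :
    (kinkTangle h).Dart → D.Dart := D.outsideKink x a

theorem kinkTangleDart_edge (h : D.edge (Sum.inl (x, a)) = Sum.inl (x, a + 1))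
    (z : (kinkTangle h).Dart) :
    kinkTangleDart h ((kinkTangle h).edge z) = D.edge (kinkTangleDart h z) :=
  (exists_outsideKink_edge h).choose_spec.2.2 z

/-- The crossings of a diagram with a kink. -/
def kinkCrossing (h : D.edge (Sum.inl (x, a)) = Sum.inl (x, a + 1)) :
    D.C ≃ ((kinkTangle h).glue (kink (a + 3))).C where
  toFun y := if hy : y = x then Sum.inr (0 : Fin 1) else Sum.inl (⟨y, hy⟩ : {y : D.C // y ≠ x})
  invFun := Sum.elim (fun y : {y : D.C // y ≠ x} => y.1) fun _ : Fin 1 => x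
  left_inv y := by
    by_cases hy : y = x
    · exact (congrArg (Sum.elim _ _) (dif_pos hy)).trans hy.symm
    · exact congrArg (Sum.elim (fun y : {y : D.C // y ≠ x} => y.1) _) (dif_neg hy)
  right_inv := by
    rintro (⟨y, hy⟩ | k)
    · exact dif_neg hy
    · refine (dif_pos rfl).trans ?_
      exact congrArg _ (Subsingleton.elim (0 : Fin 1) k)

/-- The half-edges of `D` in the glued diagram. -/
def kinkDart (h : D.edge (Sum.inl (x, a)) = Sum.inl (x, a + 1)) :
    D.Dart → ((kinkTangle h).glue (kink (a + 3))).Dart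
  | Sum.inl (y, i) => Sum.inl (kinkCrossing h y, i)
  | Sum.inr (b, k) => Sum.inr (Sum.inl (Sum.inl b), k)

theorem kinkDart_self (h : D.edge (Sum.inl (x, a)) = Sum.inl (x, a + 1)) (i : Fin 4) :
    kinkDart h (Sum.inl (x, i)) = glueRight (kinkTangle h) (kink (a + 3)) (kinkHalf (a + 3) i) :=
  congrArg (fun y => Sum.inl (y, i)) (dif_pos rfl)

theorem kinkDart_inside (h : D.edge (Sum.inl (x, a)) = Sum.inl (x, a + 1)) (z) :
    kinkDart h (kinkTangleDart h (Sum.inl z)) =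
      glueLeft (kinkTangle h) (kink (a + 3)) (Sum.inl z) := by
  rcases z with ⟨⟨y, hy⟩, i⟩ | q
  · exact congrArg (fun y => Sum.inl (y, i)) (dif_neg hy)
  · rfl

/-- Cutting `D` around the kink and gluing again only adds a marked point at each of the two ends;
all other half-edges come from `D`. -/
theorem splices_kink (h : D.edge (Sum.inl (x, a)) = Sum.inl (x, a + 1)) :
    Splices ((kinkTangle h).glue (kink (a + 3))) D (kinkCrossing h) (kinkDart h) := by
  set K := (kinkTangle h).glue (kink (a + 3)) with hK
  have eL : ∀ z, K.edge (glueLeft (kinkTangle h) (kink (a + 3)) z) = _ := glue_edge_left _ _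
  have eR : ∀ z, K.edge (glueRight (kinkTangle h) (kink (a + 3)) z) = _ := glue_edge_right _ _
  have rL : ∀ e, K.rot (glueLeft (kinkTangle h) (kink (a + 3)) (Sum.inr e)) = _ :=
    glue_rot_left _ _
  have rR : ∀ e, K.rot (glueRight (kinkTangle h) (kink (a + 3)) (Sum.inr e)) = _ :=
    glue_rot_right _ _
  let R : Set K.Dart := Set.range (kinkDart h)
  have out : ∀ e k, (Sum.inr (Sum.inr e, k) : K.Dart) ∉ R := by
    rintro e k ⟨⟨y, i⟩ | ⟨b, l⟩, hd⟩
    · exact Sum.inl_ne_inr hd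
    · exact Sum.inl_ne_inr (congrArg Prod.fst (Sum.inr.inj hd))
  have depart : ∀ z, K.Runs R (kinkDart h (kinkTangleDart h z))
      (glueLeft (kinkTangle h) (kink (a + 3)) ((kinkTangle h).edge z)) := by
    rintro (z | e)
    · rw [kinkDart_inside, ← eL]
      exact .edge _
    · have h1 := Runs.edge (D := K) (R := R) (kinkDart h (kinkTangleDart h (Sum.inr e)))
      rw [show kinkTangleDart h (Sum.inr e) = Sum.inl (x, a + kinkOffset e 0) from rfl,
        kinkDart_self, eR, kink_edge_half] at h1
      have h2 := Runs.pass _ _ h1 (out e 1)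
      rw [rR, eL] at h2
      rw [show kinkTangleDart h (Sum.inr e) = Sum.inl (x, a + kinkOffset e 0) from rfl,
        kinkDart_self]
      exact h2
  have arrive : ∀ u z, K.Runs R u (glueLeft (kinkTangle h) (kink (a + 3)) z) →
      K.Runs R u (kinkDart h (kinkTangleDart h z)) := by
    rintro u (z | e) hu
    · rwa [kinkDart_inside]
    · have h2 := Runs.pass _ _ hu (out e 0)
      rw [rL, eR, kink_edge_end] at h2
      rw [show kinkTangleDart h (Sum.inr e) = Sum.inl (x, a + kinkOffset e 0) from rfl,
        kinkDart_self]
      exact h2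
  refine ⟨?_, fun y i => rfl, ?_, ?_, ?_⟩
  · rintro (⟨y, i⟩ | ⟨b, k⟩) (⟨y', i'⟩ | ⟨b', k'⟩) hd
    · have h1 := Sum.inl.inj hd
      have h2 : y = y' := (kinkCrossing h).injective (congrArg Prod.fst h1)
      have h3 : i = i' := congrArg Prod.snd h1
      rw [h2, h3]
    · exact absurd hd Sum.inl_ne_inr
    · exact absurd hd Sum.inr_ne_inl
    · have h1 := Sum.inr.inj hd
      have h2 : b = b' := Sum.inl.inj (Sum.inl.inj (congrArg Prod.fst h1))
      have h3 : k = k' := congrArg Prod.snd h1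
      rw [h2, h3]
  · rintro (⟨y, i⟩ | ⟨b, k⟩) <;> rfl
  · intro d
    have loop : K.Runs R (kinkDart h (Sum.inl (x, a))) (kinkDart h (Sum.inl (x, a + 1))) := by
      have h1 := Runs.edge (D := K) (R := R) (kinkDart h (Sum.inl (x, a)))
      rw [kinkDart_self, eR, kink_edge_loop] at h1
      rwa [kinkDart_self, kinkDart_self]
    have loop' : K.Runs R (kinkDart h (Sum.inl (x, a + 1))) (kinkDart h (Sum.inl (x, a))) := by
      have h1 := Runs.edge (D := K) (R := R) (kinkDart h (Sum.inl (x, a + 1)))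
      rw [kinkDart_self, eR, ← kink_edge_loop, TangleDiagram.edge_edge, kink_edge_loop] at h1
      rwa [kinkDart_self, kinkDart_self]
    rcases D.outsideKink_cases x a d with ⟨z, rfl⟩ | rfl | rfl
    · have h1 := arrive _ _ (depart z)
      have h2 := kinkTangleDart_edge h z
      rw [h2] at h1
      exact h1
    · rw [h]
      exact loop
    · rw [← h, edge_edge, h]
      exact loop'
  · intro u hu
    rcases u with ⟨y, i⟩ | ⟨(b | b) | e, k⟩
    · obtain ⟨y, rfl⟩ := (kinkCrossing h).surjective y
      exact absurd ⟨Sum.inl (y, i), rfl⟩ hu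
    · exact absurd ⟨Sum.inr (b, k), rfl⟩ hu
    · exact b.elim
    · have hk : k = 0 ∨ k = 1 := by clear hu; revert k; decide
      rcases hk with rfl | rfl
      · refine ⟨kinkTangleDart h ((kinkTangle h).edge (Sum.inr e)), ?_⟩
        have := depart ((kinkTangle h).edge (Sum.inr e))
        rwa [TangleDiagram.edge_edge] at this
      · refine ⟨Sum.inl (x, a + kinkOffset e 0), ?_⟩
        have h1 := Runs.edge (D := K) (R := R) (kinkDart h (Sum.inl (x, a + kinkOffset e 0)))
        rw [kinkDart_self, eR, kink_edge_half] at h1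
        rw [kinkDart_self]
        exact h1

/-- The half-edges of the diagram without the kink as half-edges of `D`. -/
def strandDart (h : D.edge (Sum.inl (x, a)) = Sum.inl (x, a + 1)) :
    ((kinkTangle h).glue strand).Dart → D.Dart
  | Sum.inl (Sum.inl y, i) => kinkTangleDart h (Sum.inl (Sum.inl (y, i)))
  | Sum.inr (Sum.inl (Sum.inl b), k) => Sum.inr (b, k)
  | Sum.inr (Sum.inr e, k) => Sum.inl (x, a + kinkOffset e k)

theorem strandDart_left (h : D.edge (Sum.inl (x, a)) = Sum.inl (x, a + 1)) (z) :
    strandDart h (glueLeft (kinkTangle h) strand z) = kinkTangleDart h z := by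
  rcases z with (⟨y, i⟩ | q) | e <;> rfl

theorem strandDart_bijective (h : D.edge (Sum.inl (x, a)) = Sum.inl (x, a + 1)) :
    Function.Bijective (strandDart h) := by
  have hoff : ∀ e k e' k' : Fin 2, kinkOffset e k = kinkOffset e' k' → e = e' ∧ k = k' := by
    decide
  constructor
  · rintro (⟨⟨y, hy⟩ | y, i⟩ | ⟨(b | b) | e, k⟩) (⟨⟨y', hy'⟩ | y', i'⟩ | ⟨(b' | b') | e', k'⟩) hd
    all_goals first
      | exact y.elim
      | exact y'.elim
      | exact b.elim
      | exact b'.elim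
      | skip
    · have h1 := Sum.inl.inj hd
      have h2 : y = y' := congrArg Prod.fst h1
      have h3 : i = i' := congrArg Prod.snd h1
      subst h2 h3
      rfl
    · exact absurd hd Sum.inl_ne_inr
    · exact absurd (congrArg Prod.fst (Sum.inl.inj hd)) hy
    · exact absurd hd Sum.inr_ne_inl
    · have h2 : b = b' := congrArg Prod.fst (Sum.inr.inj hd)
      have h3 : k = k' := congrArg Prod.snd (Sum.inr.inj hd)
      subst h2 h3
      rfl
    · exact absurd hd Sum.inr_ne_inl
    · exact absurd (congrArg Prod.fst (Sum.inl.inj hd)).symm hy'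
    · exact absurd hd Sum.inl_ne_inr
    · have h1 := hoff _ _ _ _ (add_left_cancel (congrArg Prod.snd (Sum.inl.inj hd)))
      rw [h1.1, h1.2]
  · intro d
    rcases D.outsideKink_cases x a d with ⟨z, rfl⟩ | rfl | rfl
    · exact ⟨_, strandDart_left h z⟩
    · exact ⟨Sum.inr (Sum.inr 0, 1), congrArg (fun i => Sum.inl (x, i)) (add_zero a)⟩
    · exact ⟨Sum.inr (Sum.inr 1, 1), rfl⟩

/-- The condition on `β` selects the smoothing that opens the loop into the strand; the other one
would cut the loop off as a circle. -/
theorem smoothPairing_kink {β : Bool} (hβ : smoothPairing β (a + 1) = a + 2) (e k : Fin 2) :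
    smoothPairing β (a + kinkOffset e k) = a + kinkOffset e (k + 1) := by
  revert a β e k; decide

/-- Removing a kink amounts to smoothing its crossing. -/
noncomputable def strandIso (h : D.edge (Sum.inl (x, a)) = Sum.inl (x, a + 1)) {β : Bool}
    (hβ : smoothPairing β (a + 1) = a + 2) :
    LabelIso ((kinkTangle h).glue strand) (D.smooth x β) where
  crossing := Equiv.sumEmpty {y : D.C // y ≠ x} Empty
  dart := (Equiv.ofBijective _ (strandDart_bijective h)).trans (D.smoothEquiv x β)
  dart_inl := by
    rintro (⟨y, hy⟩ | y) i
    · exact D.smoothEquiv_of_ne hy β i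
    · exact y.elim
  dart_rot := by
    intro d
    change D.smoothEquiv x β (strandDart h _) = (D.smooth x β).rot (D.smoothEquiv x β _)
    rw [smooth_rot]
    congr 1
    rcases d with ⟨⟨y, hy⟩ | y, i⟩ | ⟨(b | b) | e, k⟩
    · exact (congrArg (strandDart h) (rot_inl _ _ i)).trans (splitRot_of_ne hy β i).symm
    · exact y.elim
    · exact (congrArg (strandDart h) (rot_inr _ _ k)).trans (splitRot_inr x β b k).symm
    · exact b.elim
    · refine (congrArg (strandDart h) (rot_inr _ _ k)).trans (Eq.trans ?_
        (splitRot_self x β (a + kinkOffset e k)).symm)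
      rw [smoothPairing_kink hβ]
      rfl
  dart_edge := by
    intro d
    change D.smoothEquiv x β (strandDart h _) = (D.smooth x β).edge (D.smoothEquiv x β _)
    rw [smooth_edge]
    congr 1
    have hr : ∀ e : Fin 2, strandDart h (((kinkTangle h).glue strand).edge
        (glueRight (kinkTangle h) strand (Sum.inr e))) =
        D.edge (strandDart h (glueRight (kinkTangle h) strand (Sum.inr e))) := by
      intro e
      rw [glue_edge_right, strand_edge]
      change Sum.inl (x, a + kinkOffset (e + 1) 1) = D.edge (Sum.inl (x, a + kinkOffset e 1))
      have he : e = 0 ∨ e = 1 := by revert e; decide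
      rcases he with rfl | rfl
      · exact Eq.trans h.symm (congrArg (fun i => D.edge (Sum.inl (x, i))) (add_zero a).symm)
      · refine Eq.trans ?_ (congrArg D.edge h)
        rw [edge_edge]
        exact congrArg (fun i => Sum.inl (x, i)) (add_zero a)
    have hl : ∀ z, strandDart h (((kinkTangle h).glue strand).edge
        (glueLeft (kinkTangle h) strand z)) =
        D.edge (strandDart h (glueLeft (kinkTangle h) strand z)) := by
      intro z
      rw [glue_edge_left, strandDart_left, strandDart_left, kinkTangleDart_edge]
    rcases d with ⟨y | y, i⟩ | ⟨(b | b) | e, k⟩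
    · exact hl (Sum.inl (Sum.inl (y, i)))
    · exact y.elim
    · exact hl (Sum.inl (Sum.inr (b, k)))
    · exact b.elim
    · have hk : k = 0 ∨ k = 1 := by revert k; decide
      rcases hk with rfl | rfl
      · exact hl (Sum.inr e)
      · exact hr e

/-- The first Reidemeister move. -/
theorem sameLink_smooth_of_kink (hp : D.Planar) (h : D.edge (Sum.inl (x, a)) = Sum.inl (x, a + 1))
    {β : Bool} (hβ : smoothPairing β (a + 1) = a + 2) : SameLink D (D.smooth x β) := by
  have h1 := (splices_kink h).markEquiv.symm
  have hK := h1.planar_iff.1 hp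
  have hS := (strandIso h hβ).planar_iff.2 (hp.smooth x β)
  exact .trans _ _ _ (h1.sameLink hp) (.trans _ _ _ (.rel _ _ ⟨hK, hS, .reidemeister1 _ _⟩)
    ((MarkEquiv.of_labelIso (strandIso h hβ)).sameLink hS))

end Kink

end LinkDiagram


/-! ### Alternating diagrams of nonzero determinant are quasi-alternating -/

namespace LinkDiagram

variable {D : LinkDiagram} {o : D.Dart → Bool}

theorem IsColoring.swap_eq (h : D.IsColoring o) {x : D.C} {i : Fin 4} {a b : {d // o d = true}}
    (ha : a.1 = Sum.inl (x, i)) (hb : b.1 = Sum.inl (x, i + 2)) :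
    Equiv.swap a b = Equiv.swap (h.endA x) (h.endB x) := by
  have hi : o (Sum.inl (x, i)) = true := ha ▸ a.2
  rcases h.eq_colorEnd hi with rfl | rfl
  · rw [show a = h.endA x from Subtype.ext ha, show b = h.endB x from Subtype.ext hb]
  · have hb' : b = h.endA x := Subtype.ext (hb.trans (by
      rw [add_assoc, show (2 : Fin 4) + 2 = 0 by decide, add_zero]
      rfl))
    rw [show a = h.endB x from Subtype.ext ha, hb', Equiv.swap_comm]

/-- The chord diagram of a circle of a state without interlaced chords has an isolated chord. -/
theorem IsColoring.exists_isolated_chord (h : D.IsColoring o)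
    (hm : ∀ b, D.edge (Sum.inr (b, 0)) = Sum.inr (b, 1)) {s : D.C → Bool}
    (hs : D.stateLoops s = 1) (huniq : ∀ t, D.stateLoops t = 1 → t = s) (x₀ : D.C) :
    ∃ x i, D.edge (Sum.inl (x, i)) = D.statePairing s (Sum.inl (x, i + 2)) := by
  classical
  set σ := h.statePerm s with hσ
  have hne : Nonempty {d // o d = true} := ⟨h.endA x₀⟩
  have hσ1 : orbitCount {σ} = 1 := by rw [hσ, ← h.stateLoops_eq, hs]
  have hl := orbitCount_eq_one_iff.1 hσ1
  -- Each crossing is a chord of the circle, joining its ends of colour `true`. Among all chords and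
  -- both directions, take the shortest arc from one end to the other.
  have hex : ∃ k, 0 < k ∧ ∃ x i, ∃ a b : {d // o d = true}, a.1 = Sum.inl (x, i) ∧
      b.1 = Sum.inl (x, i + 2) ∧ (σ ^ k) a = b := by
    obtain ⟨k, hk⟩ := exists_pow_of_linked (hl (h.endA x₀) (h.endB x₀))
    refine ⟨k, Nat.pos_of_ne_zero ?_, x₀, _, h.endA x₀, h.endB x₀, rfl, rfl, hk⟩
    rintro rfl
    exact h.endA_ne_endB x₀ hk
  obtain ⟨hk0, x, i, a, b, ha, hb, hk⟩ := Nat.find_spec hex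
  have hmin : ∀ l, 0 < l → l < Nat.find hex → ∀ x i (a b : {d // o d = true}),
      a.1 = Sum.inl (x, i) → b.1 = Sum.inl (x, i + 2) → (σ ^ l) a ≠ b :=
    fun l hl0 hlk x i a b ha hb hab => Nat.find_min hex hlk ⟨hl0, x, i, a, b, ha, hb, hab⟩
  generalize Nat.find hex = k at *
  have hi2 : ∀ i : Fin 4, i ≠ i + 2 := by decide
  have hab : a ≠ b := fun e => by
    have h1 := congrArg Subtype.val e
    rw [ha, hb] at h1
    exact hi2 i (congrArg Prod.snd (Sum.inl.inj h1))
  have hσa : (σ a).1 = D.statePairing s (D.edge (Sum.inl (x, i))) := by rw [← ha]; rfl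
  by_cases hk1 : k = 1
  · refine ⟨x, i, ?_⟩
    rw [hk1, pow_one] at hk
    rw [← hb, ← hk, hσa, statePairing_statePairing]
  exfalso
  -- If the arc is longer than one step, look at the next point after `a`. By `hm` marked points lie
  -- on circles of their own, so it belongs to a crossing.
  obtain ⟨y, j, hyj⟩ : ∃ y j, (σ a).1 = Sum.inl (y, j) := by
    rw [hσa]
    rcases hd : D.edge (Sum.inl (x, i)) with ⟨y, j⟩ | ⟨b, l⟩
    · exact ⟨y, _, D.statePairing_inl s y j⟩
    · have hd' : D.edge (Sum.inr (b, l)) = Sum.inl (x, i) := by rw [← hd, edge_edge]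
      have hl : l = 0 ∨ l = 1 := by clear hd hd'; revert l; decide
      rcases hl with rfl | rfl
      · rw [hm] at hd'
        exact absurd hd' Sum.inr_ne_inl
      · rw [← hm, edge_edge] at hd'
        exact absurd hd' Sum.inr_ne_inl
  have hyx : y ≠ x := by
    rintro rfl
    have hi := ha ▸ a.2
    have hj := hyj ▸ (σ a).2
    by_cases hij : j = i
    · have hfix : σ a = a := Subtype.ext (by rw [hyj, ha, hij])
      have : ∀ l : ℕ, (σ ^ l) a = a := fun l => by
        induction l with
        | zero => rfl
        | succ l ih => rw [pow_succ, Equiv.Perm.mul_apply, hfix, ih]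
      exact hab ((this k).symm.trans hk)
    · refine hmin 1 one_pos (by omega) y i a b ha hb ?_
      rw [pow_one]
      refine Subtype.ext ?_
      rw [hyj, hb]
      congr 2
      have : ∀ c i j : Fin 4, (i = c ∨ i = c + 2) → (j = c ∨ j = c + 2) → j ≠ i → j = i + 2 := by
        decide
      exact this _ i j (h.eq_colorEnd hi) (h.eq_colorEnd hj) hij
  let d : {d // o d = true} := ⟨Sum.inl (y, j + 2), by rw [h.add_two, ← hyj]; exact (σ a).2⟩
  -- By minimality the other end `d` of the chord `y` is not on the arc from `a` to `b`: the chords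
  -- interlace. Switching `x` cuts the circle in two, with `σ a` and `d` on different parts.
  have harc : ¬ linkedSetoid {Equiv.swap a b * σ} (σ a) d := by
    refine not_linked_of_arc hk ⟨1, by omega, by rw [pow_one]⟩ ?_ ?_
    · intro l hlk hld
      rcases l with _ | _ | l
      · have h1 := congrArg Subtype.val hld
        rw [pow_zero, Equiv.Perm.one_apply, ha] at h1
        exact hyx (congrArg Prod.fst (Sum.inl.inj h1)).symm
      · have h1 := congrArg Subtype.val hld
        rw [zero_add, pow_one, hyj] at h1
        exact hi2 j (congrArg Prod.snd (Sum.inl.inj h1))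
      · rw [pow_succ, Equiv.Perm.mul_apply] at hld
        exact hmin (l + 1) (by omega) (by omega) y j (σ a) d hyj rfl hld
    · intro l hl0 hlk
      refine ⟨hmin l hl0 hlk x i a b ha hb, fun hla => ?_⟩
      refine hmin (k - l) (by omega) (by omega) x i a b ha hb ?_
      rw [← hk]
      conv_rhs => rw [show k = k - l + l by omega, pow_add, Equiv.Perm.mul_apply, hla]
  have h1 := orbitCount_swap_mul_of_linked hab (hl a b)
  have h2 := orbitCount_swap_mul_of_not_linked harc
  set s' := Function.update s x (!s x) with hs'
  set t := Function.update s' y (!s' y) with ht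
  -- Switching `y` as well joins the two parts again, giving a second tree state against uniqueness.
  have h3 : h.statePerm t = Equiv.swap (σ a) d * (Equiv.swap a b * σ) := by
    rw [ht, h.statePerm_update, hs', h.statePerm_update, h.swap_eq ha hb, h.swap_eq hyj rfl]
  have h4 : D.stateLoops t = 1 := by
    rw [h.stateLoops_eq, h3]
    omega
  have h5 := congrFun (huniq t h4) x
  rw [ht, Function.update_of_ne hyx.symm, hs', Function.update_self] at h5
  exact Bool.not_ne_self _ h5

/-- The state pairing sends `i + 2` to a neighbour of `i`, so the edge at `i` ends at `i + 1` or `i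
+ 3`; the loop starts at `i` or at `i + 3` accordingly. -/
theorem exists_kink_of_isolated_chord {s : D.C → Bool} {x : D.C} {i : Fin 4}
    (h : D.edge (Sum.inl (x, i)) = D.statePairing s (Sum.inl (x, i + 2))) :
    ∃ a, D.edge (Sum.inl (x, a)) = Sum.inl (x, a + 1) ∧
      smoothPairing (!s x) (a + 1) = a + 2 := by
  rw [statePairing_inl] at h
  have key : ∀ (v : Bool) (i : Fin 4),
      (smoothPairing v (i + 2) = i + 1 ∧ smoothPairing v (i + 1) = i + 2) ∨
      (smoothPairing v (i + 2) = i + 3 ∧ smoothPairing v (i + 3 + 1) = i + 3 + 2) := by decide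
  rcases key (!s x) i with ⟨h1, h2⟩ | ⟨h1, h2⟩
  · exact ⟨i, by rw [h, h1], h2⟩
  · refine ⟨i + 3, ?_, h2⟩
    rw [← h1, ← h, edge_edge, h1, add_assoc, show (3 : Fin 4) + 1 = 0 by decide, add_zero]

/-- A diagram without crossings and with a single circle is a diagram of the unknot. -/
theorem nonempty_labelIso_circle [IsEmpty D.C]
    (hm : ∀ b, D.edge (Sum.inr (b, 0)) = Sum.inr (b, 1)) {s : D.C → Bool}
    (hs : D.stateLoops s = 1) : Nonempty (LabelIso circle D) := by
  have hm' : ∀ b, D.edge (Sum.inr (b, 1)) = Sum.inr (b, 0) := fun b => by rw [← hm, edge_edge]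
  have hne : Nonempty D.Dart := by
    by_contra hne
    rw [not_nonempty_iff] at hne
    rw [stateLoops, orbitCount_eq_card] at hs
    have : IsEmpty (Quotient (linkedSetoid {D.edge, D.statePairing s})) :=
      ⟨fun q => Quotient.inductionOn q fun x => hne.elim x⟩
    rw [Nat.card_of_isEmpty] at hs
    omega
  obtain ⟨⟨x, -⟩ | ⟨b, -⟩⟩ := hne
  · exact isEmptyElim x
  have hne : Nonempty D.Dart := ⟨Sum.inr (b, 0)⟩
  have hl := orbitCount_eq_one_iff.1 hs
  have hb : ∀ b', b' = b := by
    intro b'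
    have h1 := mem_of_linked (U := {Sum.inr (b, 0), Sum.inr (b, 1)}) ?_
      (hl (Sum.inr (b, 0)) (Sum.inr (b', 0))) (Or.inl rfl)
    · rcases h1 with h1 | h1
      · exact congrArg Prod.fst (Sum.inr.inj h1)
      · exact congrArg Prod.fst (Sum.inr.inj h1)
    · rintro _ (rfl | rfl) _ (rfl | rfl)
      · exact Or.inr (hm b)
      · exact Or.inl (hm' b)
      · exact Or.inr (D.statePairing_inr s b 0)
      · exact Or.inl (D.statePairing_inr s b 1)
  let u : Unit ≃ D.B := ⟨fun _ => b, fun _ => (), fun _ => rfl, fun b' => (hb b').symm⟩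
  have hC : IsEmpty circle.C := inferInstanceAs (IsEmpty Empty)
  refine ⟨⟨Equiv.equivOfIsEmpty _ _, Equiv.sumCongr (Equiv.equivOfIsEmpty _ _)
    (Equiv.prodCongr u (Equiv.refl _)), fun x => isEmptyElim x, ?_, ?_⟩⟩
  · rintro (⟨x, -⟩ | ⟨⟨⟩, k⟩)
    · exact isEmptyElim x
    · have hk : k = 0 ∨ k = 1 := by revert k; decide
      rcases hk with rfl | rfl <;> rfl
  · rintro (⟨x, -⟩ | ⟨⟨⟩, k⟩)
    · exact isEmptyElim x
    · have hk : k = 0 ∨ k = 1 := by revert k; decide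
      rcases hk with rfl | rfl
      · exact (hm b).symm
      · exact (hm' b).symm

/-- Links with an alternating diagram of nonzero determinant are quasi-alternating. -/
theorem IsAltColoring.linkIsQuasiAlternating (h : D.IsAltColoring o) (hp : D.Planar)
    (ht : D.treeStates.Nonempty) : D.LinkIsQuasiAlternating := by
  -- A smoothing trades one crossing for two marked points, so with weight three per crossing both
  -- smoothing and removing a marked point decrease the measure.
  induction hn : 3 * Fintype.card D.C + Fintype.card D.B using Nat.strong_induction_on
    generalizing D with
  | _ n ih =>
    have hsm : ∀ (x : D.C) (β : Bool), (D.smooth x β).treeStates.Nonempty →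
        (D.smooth x β).LinkIsQuasiAlternating := by
      intro x β hβ
      refine ih _ ?_ (h.smooth x β) (hp.smooth x β) hβ rfl
      have h1 : Fintype.card (D.smooth x β).C < Fintype.card D.C :=
        Fintype.card_subtype_lt (x := x) (by simp)
      have h2 : Fintype.card (D.smooth x β).B = Fintype.card D.B + 2 :=
        Fintype.card_sum.trans (by rw [Fintype.card_fin])
      omega
    by_cases hm : ∃ b, D.edge (Sum.inr (b, 0)) ≠ Sum.inr (b, 1)
    · obtain ⟨b, hb⟩ := hm
      have he := markEquiv_removeMark hb
      have hp' := he.planar_iff.1 hp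
      have : Nonempty D.Dart := ⟨Sum.inr (b, 0)⟩
      have : Nonempty (LinkDiagram.removeMark hb).Dart := ⟨removeMarkEnd hb 0⟩
      have hdet := he.det_eq
      rw [h.det_eq_card hp, (h.removeMark hb).det_eq_card hp', Nat.cast_inj] at hdet
      refine .sameLink _ _ (he.symm.sameLink hp') (ih _ ?_ (h.removeMark hb) hp' ?_ rfl)
      · have h1 : Fintype.card (LinkDiagram.removeMark hb).B < Fintype.card D.B :=
          Fintype.card_subtype_lt (x := b) (by simp)
        have h2 : Fintype.card (LinkDiagram.removeMark hb).C = Fintype.card D.C := rfl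
        omega
      · rw [← Finset.card_pos] at ht ⊢
        omega
    push Not at hm
    obtain ⟨s, hs⟩ := ht
    rcases isEmpty_or_nonempty D.C with hC | ⟨⟨x₀⟩⟩
    · obtain ⟨f⟩ := nonempty_labelIso_circle hm (D.mem_treeStates.1 hs)
      exact .sameLink _ _ ((MarkEquiv.of_labelIso f).sameLink (f.planar_iff.2 hp)) .unknot
    by_cases hx : ∃ x, (D.smoothZero x).treeStates.Nonempty ∧ (D.smoothInfty x).treeStates.Nonempty
    · obtain ⟨x, h0, h1⟩ := hx
      exact .crossing D x hp (hsm x false h0) (hsm x true h1) (h.det_eq_add hp x)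
    -- Two tree states that differ at `x` restrict to tree states of both smoothings at `x`, which
    -- `hx` forbids.
    have huniq : ∀ t, D.stateLoops t = 1 → t = s := by
      intro t ht
      rw [← mem_treeStates] at ht
      ext1 x
      by_contra htx
      refine hx ⟨x, ?_⟩
      cases h1 : t x <;> cases h2 : s x
      · exact absurd (h1.trans h2.symm) htx
      · exact ⟨D.treeStates_smooth_nonempty hs (b := false) h2,
          D.treeStates_smooth_nonempty ht (b := true) h1⟩
      · exact ⟨D.treeStates_smooth_nonempty ht (b := false) h1,
          D.treeStates_smooth_nonempty hs (b := true) h2⟩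
      · exact absurd (h1.trans h2.symm) htx
    obtain ⟨x, i, hxi⟩ := h.toIsColoring.exists_isolated_chord hm (D.mem_treeStates.1 hs) huniq x₀
    obtain ⟨a, ha, hβ⟩ := exists_kink_of_isolated_chord hxi
    refine .sameLink _ _ (.symm _ _ (sameLink_smooth_of_kink hp ha hβ)) (hsm x (!s x) ?_)
    exact D.treeStates_smooth_nonempty hs (by rw [Bool.not_not])

end LinkDiagram


theorem LinkDiagram.smoothPairing_smoothPairing (β : Bool) (i : Fin 4) :
    smoothPairing β (smoothPairing β i) = i := by
  revert β i; decide

theorem LinkDiagram.smoothPairing_ne (β : Bool) (i : Fin 4) : smoothPairing β i ≠ i := by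
  revert β i; decide

namespace LinkDiagram

/-! ### Replacing a crossing by two crossings -/

section Extend

variable (D : LinkDiagram) (c : D.C) (b : Bool) (moved : Fin 4 → Bool)

/-- `D` with the crossing `c` replaced by two crossings, joined in such a way that the smoothing
`b` of one of them makes the other one a kink. -/
def double : LinkDiagram :=
  D.extend c moved (smoothPairing (!b)) (smoothPairing_smoothPairing _) (smoothPairing_ne _)

/-- The crossing at which the ends that are not moved are. -/
def nearCrossing : (D.double c b moved).C := (some c : Option D.C)

/-- The crossing at which the moved ends are. -/
def farCrossing : (D.double c b moved).C := (none : Option D.C)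

/-- The other crossings. -/
def keptCrossing (x : D.C) : (D.double c b moved).C := (some x : Option D.C)

/-- The half-edges of `D`. -/
def outer (d : D.Dart) : (D.double c b moved).Dart := D.extendDart c moved (Sum.inl d)

/-- The half-edges on the arcs that join the two crossings. -/
def inner (i : Fin 4) : (D.double c b moved).Dart := D.extendDart c moved (Sum.inr i)

theorem far_ne_near : D.farCrossing c b moved ≠ D.nearCrossing c b moved :=
  (Option.some_ne_none c).symm

theorem keptCrossing_ne {x : D.C} (h : x ≠ c) :
    D.keptCrossing c b moved x ≠ D.nearCrossing c b moved :=
  fun h' => h (Option.some.inj h')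

variable {moved} in
theorem outer_moved {i : Fin 4} (h : moved i = true) :
    D.outer c b moved (Sum.inl (c, i)) = Sum.inl (D.farCrossing c b moved, i) :=
  if_pos ⟨rfl, h⟩

variable {moved} in
theorem outer_unmoved {i : Fin 4} (h : moved i = false) :
    D.outer c b moved (Sum.inl (c, i)) = Sum.inl (D.nearCrossing c b moved, i) :=
  if_neg fun h' => by rw [h] at h'; exact Bool.false_ne_true h'.2

variable {c} in
theorem outer_of_ne {x : D.C} (h : x ≠ c) (i : Fin 4) :
    D.outer c b moved (Sum.inl (x, i)) = Sum.inl (D.keptCrossing c b moved x, i) :=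
  if_neg fun h' => h h'.1

variable {moved} in
theorem inner_moved {i : Fin 4} (h : moved i = true) :
    D.inner c b moved i = Sum.inl (D.nearCrossing c b moved, i) :=
  if_pos h

variable {moved} in
theorem inner_unmoved {i : Fin 4} (h : moved i = false) :
    D.inner c b moved i = Sum.inl (D.farCrossing c b moved, i) :=
  if_neg fun h' => by rw [h] at h'; exact Bool.false_ne_true h'

theorem outer_ne_inner (d : D.Dart) (i : Fin 4) : D.outer c b moved d ≠ D.inner c b moved i :=
  fun h => Sum.inl_ne_inr ((D.extendDart c moved).injective h)

theorem double_edge (z : D.Dart ⊕ Fin 4) :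
    (D.double c b moved).edge (D.extendDart c moved z) =
      D.extendDart c moved (Equiv.sumCongr D.edge (smoothPairing (!b)) z) := by
  change (D.extendDart c moved).permCongr _ (D.extendDart c moved z) = _
  rw [Equiv.permCongr_apply, Equiv.symm_apply_apply]

theorem double_edge_outer (d : D.Dart) :
    (D.double c b moved).edge (D.outer c b moved d) = D.outer c b moved (D.edge d) :=
  D.double_edge c b moved (Sum.inl d)

theorem double_edge_inner (i : Fin 4) :
    (D.double c b moved).edge (D.inner c b moved i) =
      D.inner c b moved (smoothPairing (!b) i) :=
  D.double_edge c b moved (Sum.inr i)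

variable {D c b moved} in
theorem double_crossing_cases (x : (D.double c b moved).C) : x = D.nearCrossing c b moved ∨
    x = D.farCrossing c b moved ∨ ∃ y, y ≠ c ∧ x = D.keptCrossing c b moved y := by
  rcases x with _ | y
  · exact Or.inr (Or.inl rfl)
  · by_cases hy : y = c
    · exact Or.inl (congrArg some hy)
    · exact Or.inr (Or.inr ⟨y, hy, rfl⟩)

variable {D c b moved} in
theorem double_dart_cases (u : (D.double c b moved).Dart) :
    (∃ d, u = D.outer c b moved d) ∨ ∃ i, u = D.inner c b moved i := by
  obtain ⟨d | i, rfl⟩ := (D.extendDart c moved).surjective u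
  · exact Or.inl ⟨d, rfl⟩
  · exact Or.inr ⟨i, rfl⟩

/-- The exchange of the two crossings. -/
def doubleSwapCrossing : (D.double c b moved).C ≃ (D.double c b fun i => !moved i).C :=
  Equiv.swap (some c : Option D.C) none

/-- The half-edges after the exchange of the two crossings. -/
def doubleSwapDart : (D.double c b moved).Dart ≃ (D.double c b fun i => !moved i).Dart :=
  (D.extendDart c moved).symm.trans (D.extendDart c fun i => !moved i)

theorem doubleSwapDart_outer (d : D.Dart) : D.doubleSwapDart c b moved (D.outer c b moved d) =
    D.outer c b (fun i => !moved i) d :=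
  congrArg (D.extendDart c fun i => !moved i) ((D.extendDart c moved).symm_apply_apply _)

theorem doubleSwapDart_inner (i : Fin 4) : D.doubleSwapDart c b moved (D.inner c b moved i) =
    D.inner c b (fun i => !moved i) i :=
  congrArg (D.extendDart c fun i => !moved i) ((D.extendDart c moved).symm_apply_apply _)

theorem doubleSwapDart_inl (x : (D.double c b moved).C) (i : Fin 4) :
    D.doubleSwapDart c b moved (Sum.inl (x, i)) =
      Sum.inl (D.doubleSwapCrossing c b moved x, i) := by
  rcases double_crossing_cases x with rfl | rfl | ⟨y, hy, rfl⟩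
  · have h1 : D.doubleSwapCrossing c b moved (D.nearCrossing c b moved) =
      D.farCrossing c b fun i => !moved i := Equiv.swap_apply_left _ _
    rw [h1]
    rcases h : moved i with _ | _
    · rw [← outer_unmoved D c b h, doubleSwapDart_outer, outer_moved D c b (by simp [h])]
    · rw [← inner_moved D c b h, doubleSwapDart_inner, inner_unmoved D c b (by simp [h])]
  · have h1 : D.doubleSwapCrossing c b moved (D.farCrossing c b moved) =
      D.nearCrossing c b fun i => !moved i := Equiv.swap_apply_right _ _
    rw [h1]
    rcases h : moved i with _ | _
    · rw [← inner_unmoved D c b h, doubleSwapDart_inner, inner_moved D c b (by simp [h])]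
    · rw [← outer_moved D c b h, doubleSwapDart_outer, outer_unmoved D c b (by simp [h])]
  · have h1 : D.doubleSwapCrossing c b moved (D.keptCrossing c b moved y) =
      D.keptCrossing c b (fun i => !moved i) y :=
        Equiv.swap_apply_of_ne_of_ne (fun h => hy (Option.some.inj h)) (Option.some_ne_none y)
    rw [h1, ← outer_of_ne D b moved hy, doubleSwapDart_outer, outer_of_ne D b _ hy]

/-- Exchanging the roles of the two crossings. -/
def doubleSwap : LabelIso (D.double c b moved) (D.double c b fun i => !moved i) where
  crossing := D.doubleSwapCrossing c b moved
  dart := D.doubleSwapDart c b moved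
  dart_inl := D.doubleSwapDart_inl c b moved
  dart_rot := by
    rintro (⟨x, i⟩ | ⟨q, k⟩)
    · rw [rot_inl, doubleSwapDart_inl, doubleSwapDart_inl, rot_inl]
    · rw [rot_inr]
      exact (rot_inr _ _ _).symm
  dart_edge := by
    intro d
    rcases double_dart_cases d with ⟨d, rfl⟩ | ⟨i, rfl⟩
    · rw [double_edge_outer, doubleSwapDart_outer, doubleSwapDart_outer, double_edge_outer]
    · rw [double_edge_inner, doubleSwapDart_inner, doubleSwapDart_inner, double_edge_inner]

theorem doubleSwap_far : (D.doubleSwap c b moved).crossing (D.farCrossing c b moved) =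
    D.nearCrossing c b fun i => !moved i := Equiv.swap_apply_right _ _

theorem LabelIso.splices {D D' : LinkDiagram} (f : LabelIso D D') :
    Splices D' D f.crossing f.dart where
  inj := f.dart.injective
  inl := f.dart_inl
  rot := f.dart_rot
  runs d := by
    rw [f.dart_edge]
    exact .edge _
  reach u hu := absurd (f.dart.surjective u) hu

theorem LabelIso.isQuasiAlternatingAt {D D' : LinkDiagram} (f : LabelIso D D') {x : D.C}
    (h : D'.IsQuasiAlternatingAt (f.crossing x)) : D.IsQuasiAlternatingAt x := by
  obtain ⟨hp, h0, h1, hd⟩ := h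
  have m := fun β => (f.splices.smooth x β).markEquiv
  refine ⟨f.planar_iff.2 hp, .sameLink _ _ ((m false).sameLink (hp.smooth _ _)) h0,
    .sameLink _ _ ((m true).sameLink (hp.smooth _ _)) h1, ?_⟩
  rw [(MarkEquiv.of_labelIso f).det_eq, hd]
  exact congrArg₂ _ (m false).det_eq (m true).det_eq

variable {D c b moved}

theorem double_edge_far {i : Fin 4} (hf : ∀ i, moved (smoothPairing (!b) i) = !moved i)
    (h : moved i = false) : (D.double c b moved).edge (Sum.inl (D.farCrossing c b moved, i)) =
      Sum.inl (D.nearCrossing c b moved, smoothPairing (!b) i) := by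
  rw [← inner_unmoved D c b h, double_edge_inner, inner_moved D c b (by rw [hf, h]; rfl)]

theorem double_edge_near {i : Fin 4} (hf : ∀ i, moved (smoothPairing (!b) i) = !moved i)
    (h : moved i = true) : (D.double c b moved).edge (Sum.inl (D.nearCrossing c b moved, i)) =
      Sum.inl (D.farCrossing c b moved, smoothPairing (!b) i) := by
  rw [← inner_moved D c b h, double_edge_inner, inner_unmoved D c b (by rw [hf, h]; rfl)]

theorem smooth_rot_self (x : D.C) (β : Bool) (i : Fin 4) :
    (D.smooth x β).rot (D.smoothEquiv x β (Sum.inl (x, i))) =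
      D.smoothEquiv x β (Sum.inl (x, smoothPairing β i)) := by
  rw [smooth_rot, splitRot_self]

/-- Planarity has to be recovered from a smoothing, so two split vertices are joined again; this is
harmless if the joined corners share a face of the smoothing. Were that not so, joining would put
them on a common face of the doubled diagram, but there one of them lies on the bigon between the
two crossings, which does not contain the other. -/
theorem planar_double (hf : ∀ i, moved (smoothPairing (!b) i) = !moved i)
    (hm : ∀ i, moved (smoothPairing b i) = moved i)
    (hp : ((D.double c b moved).smooth (D.nearCrossing c b moved) (!b)).Planar) :
    (D.double c b moved).Planar := by
  set E := D.double c b moved with hE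
  set n : E.C := D.nearCrossing c b moved with hn
  set f : E.C := D.farCrossing c b moved with hff
  rw [planar_smooth_iff_splitRot] at hp
  have hrot := E.rot_eq_swap_mul_splitRot n (!b)
  rw [planar_iff_mapDefect, hrot, ← hp]
  set u := splitCorner (!b) with hu
  have hu2 : ∀ b : Bool, splitCorner (!b) + 2 = smoothPairing b (smoothPairing (!b) (splitCorner (!b))) := by
    decide
  have hne : (Sum.inl (n, u) : E.Dart) ≠ Sum.inl (n, u + 2) := fun h =>
    absurd (congrArg Prod.snd (Sum.inl.inj h)) (by have : ∀ u : Fin 4, u ≠ u + 2 := by decide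
                                                   exact this u)
  refine mapDefect_swap_mul_of_linked hne (E.not_linked_splitRot n (!b)) ?_
  by_contra hnl
  have hl := linked_swap_mul hnl
  rw [← mul_assoc, ← hrot] at hl
  -- the bigon between the two crossings
  have face : ∀ k, (k = u ∨ k = u + 2) → moved k = true →
      ¬ linkedSetoid {E.rot * E.edge} (Sum.inl (n, k)) (Sum.inl (n, k + 2)) := by
    intro k hk hmk hl
    have e1 : ∀ (b : Bool) (k : Fin 4), (k = splitCorner (!b) ∨ k = splitCorner (!b) + 2) →
      smoothPairing (!b) k + 1 = k + 2 ∧ smoothPairing (!b) (k + 2) + 1 = k ∧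
        k + 2 = smoothPairing b (smoothPairing (!b) k) ∧ k + 2 ≠ k := by decide
    obtain ⟨e1, e2, e3, e4⟩ := e1 b k hk
    have := mem_of_linked (U := {Sum.inl (n, k), Sum.inl (f, k + 2)}) ?_ hl (Or.inl rfl)
    · rcases this with h | h
      · exact e4 (congrArg Prod.snd (Sum.inl.inj h))
      · exact D.far_ne_near c b moved (congrArg Prod.fst (Sum.inl.inj h)).symm
    · rintro σ rfl x (rfl | rfl)
      · right
        rw [Equiv.Perm.mul_apply, double_edge_near hf hmk, rot_inl, e1]
        rfl
      · left
        rw [Equiv.Perm.mul_apply, double_edge_far hf (by rw [e3, hm, hf, hmk]; rfl), rot_inl, e2]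
  rcases hmu : moved u with _ | _
  · refine face (u + 2) (Or.inr rfl) ?_ ?_
    · rw [hu, hu2, hm, hf, ← hu, hmu]
      rfl
    · rw [add_assoc, show (2 : Fin 4) + 2 = 0 by decide, add_zero]
      exact Setoid.symm' _ hl
  · exact face u (Or.inl rfl) hmu hl

/-- The crossings of `D` after smoothing the near crossing. -/
def doubleSmoothCrossing :
    D.C ≃ ((D.double c b moved).smooth (D.nearCrossing c b moved) (!b)).C where
  toFun x := if h : x = c then oldCrossing _ (D.far_ne_near c b moved) _ else
    oldCrossing _ (D.keptCrossing_ne c b moved h) _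
  invFun y := (show Option D.C from y.1).getD c
  left_inv x := by
    by_cases h : x = c
    · subst h
      simp only [dite_true]
      rfl
    · simp only [dif_neg h]
      rfl
  right_inv y := by
    obtain ⟨y, hy⟩ := y
    rcases double_crossing_cases y with rfl | rfl | ⟨y, hc, rfl⟩
    · exact absurd rfl hy
    · exact dif_pos rfl
    · exact dif_neg hc

end Extend

end LinkDiagram


namespace LinkDiagram

section Double

variable {D : LinkDiagram} {c : D.C} {b : Bool} {moved : Fin 4 → Bool}

/-- The half-edges of `D` after smoothing the near crossing. -/
def doubleSmoothDart (D : LinkDiagram) (c : D.C) (b : Bool) (moved : Fin 4 → Bool) :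
    D.Dart → ((D.double c b moved).smooth (D.nearCrossing c b moved) (!b)).Dart
  | Sum.inl (x, i) => Sum.inl (D.doubleSmoothCrossing x, i)
  | Sum.inr (q, k) => Sum.inr (oldMark _ _ _ q, k)

theorem doubleSmoothDart_self (i : Fin 4) : D.doubleSmoothDart c b moved (Sum.inl (c, i)) =
    smoothEquiv _ _ _ (Sum.inl (D.farCrossing c b moved, i)) := by
  rw [smoothEquiv_of_ne _ (D.far_ne_near c b moved)]
  exact congrArg (fun y => Sum.inl (y, i)) (dif_pos rfl)

theorem doubleSmoothDart_of_ne {x : D.C} (hx : x ≠ c) (i : Fin 4) :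
    D.doubleSmoothDart c b moved (Sum.inl (x, i)) =
      smoothEquiv _ _ _ (D.outer c b moved (Sum.inl (x, i))) := by
  rw [outer_of_ne _ _ _ hx, smoothEquiv_of_ne _ (D.keptCrossing_ne c b moved hx)]
  exact congrArg (fun y => Sum.inl (y, i)) (dif_neg hx)

theorem doubleSmoothDart_inr (q : D.B × Fin 2) : D.doubleSmoothDart c b moved (Sum.inr q) =
    smoothEquiv _ _ _ (D.outer c b moved (Sum.inr q)) := rfl

theorem doubleSmoothDart_cases (d : D.Dart) :
    D.doubleSmoothDart c b moved d = smoothEquiv _ _ _ (D.outer c b moved d) ∨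
      ∃ i, moved i = false ∧ d = Sum.inl (c, i) := by
  rcases d with ⟨x, i⟩ | q
  · by_cases hx : x = c
    · subst hx
      rcases h : moved i with _ | _
      · exact Or.inr ⟨i, h, rfl⟩
      · rw [doubleSmoothDart_self, outer_moved _ _ _ h]
        exact Or.inl rfl
    · exact Or.inl (doubleSmoothDart_of_ne hx i)
  · exact Or.inl (doubleSmoothDart_inr q)

/-- Smoothing one of the two crossings gives back `D`. -/
theorem splices_double (hf : ∀ i, moved (smoothPairing (!b) i) = !moved i) :
    Splices ((D.double c b moved).smooth (D.nearCrossing c b moved) (!b)) D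
      D.doubleSmoothCrossing (D.doubleSmoothDart c b moved) := by
  set E := D.double c b moved with hE
  set n : E.C := D.nearCrossing c b moved with hn
  set F := E.smooth n (!b) with hF
  let R : Set F.Dart := Set.range (D.doubleSmoothDart c b moved)
  have out : ∀ i, E.smoothEquiv n (!b) (Sum.inl (n, i)) ∉ R := by
    rintro i ⟨⟨x, j⟩ | ⟨q, k⟩, hd⟩
    · rw [smoothEquiv_self] at hd
      exact Sum.inl_ne_inr hd
    · rw [smoothEquiv_self] at hd
      exact Sum.inl_ne_inr (congrArg Prod.fst (Sum.inr.inj hd))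
  have depart : ∀ d, F.Runs R (D.doubleSmoothDart c b moved d)
      (E.smoothEquiv n (!b) (D.outer c b moved (D.edge d))) := by
    intro d
    rcases doubleSmoothDart_cases (c := c) (b := b) (moved := moved) d with h | ⟨i, hi, rfl⟩
    · rw [h, ← double_edge_outer, ← smooth_edge]
      exact .edge _
    · have h1 := Runs.edge (D := F) (R := R) (D.doubleSmoothDart c b moved (Sum.inl (c, i)))
      rw [doubleSmoothDart_self, smooth_edge, double_edge_far hf hi] at h1
      have h2 := Runs.pass _ _ h1 (out _)
      rw [smooth_rot_self, smoothPairing_smoothPairing, smooth_edge, ← outer_unmoved D c b hi,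
        double_edge_outer] at h2
      rw [doubleSmoothDart_self]
      exact h2
  have arrive : ∀ u d, F.Runs R u (E.smoothEquiv n (!b) (D.outer c b moved d)) →
      F.Runs R u (D.doubleSmoothDart c b moved d) := by
    intro u d hu
    rcases doubleSmoothDart_cases (c := c) (b := b) (moved := moved) d with h | ⟨i, hi, rfl⟩
    · rwa [h]
    · rw [outer_unmoved D c b hi] at hu
      have h2 := Runs.pass _ _ hu (out _)
      rw [smooth_rot_self, smooth_edge, double_edge_near hf (by rw [hf, hi]; rfl),
        smoothPairing_smoothPairing] at h2
      rwa [doubleSmoothDart_self]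
  refine ⟨?_, fun x i => rfl, ?_, fun d => arrive _ _ (depart d), ?_⟩
  · rintro (⟨y, i⟩ | ⟨q, k⟩) (⟨y', i'⟩ | ⟨q', k'⟩) hd
    · have h1 := Sum.inl.inj hd
      have h2 : y = y' := D.doubleSmoothCrossing.injective (congrArg Prod.fst h1)
      have h3 : i = i' := congrArg Prod.snd h1
      rw [h2, h3]
    · exact absurd hd Sum.inl_ne_inr
    · exact absurd hd Sum.inr_ne_inl
    · have h1 := Sum.inr.inj hd
      have h2 : q = q' := Sum.inl.inj (congrArg Prod.fst h1)
      have h3 : k = k' := congrArg Prod.snd h1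
      rw [h2, h3]
  · rintro (⟨y, i⟩ | ⟨q, k⟩) <;> rfl
  · intro u hu
    rcases u with ⟨y, i⟩ | ⟨q | q, k⟩
    · obtain ⟨y, rfl⟩ := D.doubleSmoothCrossing.surjective y
      exact absurd ⟨Sum.inl (y, i), rfl⟩ hu
    · exact absurd ⟨Sum.inr (q, k), rfl⟩ hu
    · obtain ⟨i, hi⟩ : ∃ i, E.smoothEquiv n (!b) (Sum.inl (n, i)) = Sum.inr (Sum.inr q, k) := by
        refine ⟨(arcEquiv (!b)).symm (q, k), ?_⟩
        rw [smoothEquiv_self, Equiv.apply_symm_apply]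
        rfl
      have hi' : ∀ d, F.Runs R d (E.smoothEquiv n (!b) (Sum.inl (n, i))) →
          F.Runs R d (Sum.inr (Sum.inr q, k)) := fun d h => hi ▸ h
      rcases h : moved i with _ | _
      · refine ⟨D.edge (Sum.inl (c, i)), ?_⟩
        have h1 := depart (D.edge (Sum.inl (c, i)))
        rw [edge_edge, outer_unmoved D c b h] at h1
        exact hi' _ h1
      · refine ⟨Sum.inl (c, smoothPairing (!b) i), ?_⟩
        have h1 := Runs.edge (D := F) (R := R)
          (D.doubleSmoothDart c b moved (Sum.inl (c, smoothPairing (!b) i)))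
        rw [doubleSmoothDart_self, smooth_edge, double_edge_far hf (by rw [hf, h]; rfl),
          smoothPairing_smoothPairing] at h1
        rw [doubleSmoothDart_self]
        exact hi' _ h1

end Double

/-! ### The order of two smoothings -/

section SmoothSmooth

variable (D : LinkDiagram) {x y : D.C} (h : y ≠ x) (β γ : Bool)

/-- Smoothing two crossings. -/
def smoothTwo : LinkDiagram := (D.smooth x β).smooth (D.oldCrossing h β) γ

/-- The half-edges after smoothing two crossings. -/
def smoothTwoEquiv : D.Dart ≃ (D.smoothTwo h β γ).Dart :=
  (D.smoothEquiv x β).trans ((D.smooth x β).smoothEquiv (D.oldCrossing h β) γ)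

theorem smoothTwo_edge (d : D.Dart) : (D.smoothTwo h β γ).edge (D.smoothTwoEquiv h β γ d) =
    D.smoothTwoEquiv h β γ (D.edge d) :=
  (smooth_edge _ _ _ _).trans (congrArg _ (smooth_edge _ _ _ _))

/-- The rotation with two crossings split. -/
def splitTwoRot (x y : D.C) (β γ : Bool) : D.Dart → D.Dart
  | Sum.inl (z, i) => Sum.inl (z, if z = x then smoothPairing β i else
      if z = y then smoothPairing γ i else i + 1)
  | Sum.inr (q, k) => Sum.inr (q, k + 1)

theorem smoothTwo_rot (d : D.Dart) : (D.smoothTwo h β γ).rot (D.smoothTwoEquiv h β γ d) =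
    D.smoothTwoEquiv h β γ (D.splitTwoRot x y β γ d) := by
  refine (smooth_rot _ _ _ _).trans (congrArg ((D.smooth x β).smoothEquiv (D.oldCrossing h β) γ) ?_)
  rcases d with ⟨z, i⟩ | ⟨q, k⟩
  · by_cases hx : z = x
    · subst hx
      rw [splitTwoRot, if_pos rfl, smoothEquiv_self, smoothEquiv_self, arcEquiv_smoothPairing,
        splitRot_inr, swap_zero_one]
    · rw [splitTwoRot, if_neg hx, smoothEquiv_of_ne _ hx, smoothEquiv_of_ne _ hx]
      by_cases hy : z = y
      · subst hy
        rw [if_pos rfl]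
        exact splitRot_self _ _ _
      · rw [if_neg hy]
        exact splitRot_of_ne (fun h' => hy (congrArg Subtype.val h')) _ _
  · exact splitRot_inr _ _ _ _

theorem splitTwoRot_comm {x y : D.C} (h : y ≠ x) (β γ : Bool) (d : D.Dart) :
    D.splitTwoRot x y β γ d = D.splitTwoRot y x γ β d := by
  rcases d with ⟨z, i⟩ | ⟨q, k⟩
  · refine congrArg (fun j => Sum.inl (z, j)) ?_
    by_cases hx : z = x
    · subst hx
      rw [if_pos rfl, if_neg h.symm, if_pos rfl]
    · rw [if_neg hx, if_neg hx]
  · rfl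

/-- The crossings after smoothing two crossings in both orders. -/
def smoothTwoCrossing : (D.smoothTwo h β γ).C ≃ (D.smoothTwo h.symm γ β).C where
  toFun z := ⟨⟨z.1.1, fun e => z.2 (Subtype.ext e)⟩, fun e => z.1.2 (congrArg Subtype.val e)⟩
  invFun z := ⟨⟨z.1.1, fun e => z.2 (Subtype.ext e)⟩, fun e => z.1.2 (congrArg Subtype.val e)⟩
  left_inv _ := rfl
  right_inv _ := rfl

/-- The order in which two crossings are smoothed does not matter. -/
def smoothTwoComm : LabelIso (D.smoothTwo h β γ) (D.smoothTwo h.symm γ β) where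
  crossing := D.smoothTwoCrossing h β γ
  dart := (D.smoothTwoEquiv h β γ).symm.trans (D.smoothTwoEquiv h.symm γ β)
  dart_inl := by
    rintro ⟨⟨z, hx⟩, hy⟩ i
    have hy' : z ≠ y := fun e => hy (Subtype.ext e)
    have key : ∀ {x y : D.C} (h : y ≠ x) (β γ : Bool) (hx : z ≠ x) (hy : z ≠ y),
        D.smoothTwoEquiv h β γ (Sum.inl (z, i)) =
          Sum.inl ((⟨⟨z, hx⟩, fun e => hy (congrArg Subtype.val e)⟩ : (D.smoothTwo h β γ).C), i) :=
      fun h β γ hx hy => (congrArg _ (smoothEquiv_of_ne D hx _ _)).trans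
        (smoothEquiv_of_ne _ (fun e => hy (congrArg Subtype.val e)) _ _)
    refine Eq.trans ?_ (key h.symm γ β hy' hx)
    refine congrArg (D.smoothTwoEquiv h.symm γ β) ?_
    rw [Equiv.symm_apply_eq]
    exact (key h β γ hx hy').symm
  dart_rot := by
    intro d
    obtain ⟨d, rfl⟩ := (D.smoothTwoEquiv h β γ).surjective d
    rw [smoothTwo_rot, Equiv.trans_apply, Equiv.symm_apply_apply, Equiv.trans_apply,
      Equiv.symm_apply_apply, smoothTwo_rot, splitTwoRot_comm D h]
  dart_edge := by
    intro d
    obtain ⟨d, rfl⟩ := (D.smoothTwoEquiv h β γ).surjective d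
    rw [smoothTwo_edge, Equiv.trans_apply, Equiv.symm_apply_apply, Equiv.trans_apply,
      Equiv.symm_apply_apply, smoothTwo_edge]

end SmoothSmooth

end LinkDiagram


/-! ### The extensions of a dealternator are quasi-alternating -/

namespace LinkDiagram

theorem Splices.markEquiv_smooth {D D' : LinkDiagram} {φ : D'.C ≃ D.C} {ι : D'.Dart → D.Dart}
    (h : Splices D D' φ ι) (x : D'.C) {y : D.C} (hy : φ x = y) (β : Bool) :
    MarkEquiv (D.smooth y β) (D'.smooth x β) := by
  subst hy
  exact (h.smooth x β).markEquiv

theorem LabelIso.markEquiv_smoothTwo {D D' : LinkDiagram} (f : LabelIso D D') {x y : D.C}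
    {x' y' : D'.C} (hx : f.crossing x = x') (hy : f.crossing y = y') (h : y ≠ x) (h' : y' ≠ x')
    (β γ : Bool) : MarkEquiv (D'.smoothTwo h' β γ) (D.smoothTwo h β γ) := by
  subst hx hy
  exact (f.splices.smooth x β).markEquiv_smooth (D.oldCrossing h β) rfl γ

/-- The crossings are not affected by the removal of a marked point. -/
def removeMarkCrossing {D : LinkDiagram} {b : D.B} (h : D.edge (Sum.inr (b, 0)) ≠ Sum.inr (b, 1)) :
    (removeMark h).C ≃ D.C := Equiv.refl D.C

theorem splices_removeMark {D : LinkDiagram} {b : D.B}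
    (h : D.edge (Sum.inr (b, 0)) ≠ Sum.inr (b, 1)) :
    Splices D (removeMark h) (removeMarkCrossing h) (removeMarkOld h) where
  inj := removeMarkOld_injective h
  inl _ _ := rfl
  rot := removeMarkOld_rot h
  runs d := by
    by_cases hd : ∃ k, D.edge (removeMarkOld h d) = Sum.inr (b, k)
    · obtain ⟨k, hk⟩ := hd
      rw [removeMark_edge_of_mark h hk, ← rot_inr]
      refine .pass _ _ (hk ▸ .edge _) ?_
      rintro ⟨y, hy⟩
      exact removeMarkOld_ne h y k hy
    · push Not at hd
      rw [removeMark_edge_of_ne h hd]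
      exact .edge _
  reach u hu := by
    rcases removeMark_dart_cases h u with ⟨y, rfl⟩ | ⟨k, rfl⟩
    · exact absurd ⟨y, rfl⟩ hu
    · refine ⟨removeMarkEnd h k, ?_⟩
      have h1 := Runs.edge (D := D) (R := Set.range (removeMarkOld h))
        (removeMarkOld h (removeMarkEnd h k))
      rw [removeMarkOld_end, edge_edge] at h1
      rw [removeMarkOld_end]
      exact h1

variable {D : LinkDiagram} {c : D.C} {b : Bool} {moved : Fin 4 → Bool}

theorem doubleSwap_near : (D.doubleSwap c b moved).crossing (D.nearCrossing c b moved) =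
    D.farCrossing c b fun i => !moved i := Equiv.swap_apply_left _ _

/-- The smoothings of the two crossings that give a smoothing of `D`. -/
theorem markEquiv_smoothTwo_double (hf : ∀ i, moved (smoothPairing (!b) i) = !moved i) :
    MarkEquiv ((D.double c b moved).smoothTwo (D.far_ne_near c b moved) b (!b)) (D.smooth c b) := by
  -- Change the order of the smoothings and exchange the two crossings: then the smoothing `!b`
  -- comes first, at a near crossing, and gives back `D`, where `b` is applied to `c`.
  have h1 := MarkEquiv.of_labelIso
    ((D.double c b moved).smoothTwoComm (D.far_ne_near c b moved) b (!b))
  have h2 := ((D.doubleSwap c b moved).markEquiv_smoothTwo (D.doubleSwap_far c b moved)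
    doubleSwap_near (D.far_ne_near c b moved).symm (D.far_ne_near c b _) (!b) b).symm
  have hf' : ∀ i, (fun i => !moved i) (smoothPairing (!b) i) = !(fun i => !moved i) i :=
    fun i => congrArg Bool.not (hf i)
  exact h1.trans (h2.trans ((splices_double hf').markEquiv_smooth c (dif_pos rfl) b))

/-- After the smoothing `b` of the near crossing, the far crossing is a kink. -/
theorem sameLink_smooth_double (hp : (D.double c b moved).Planar)
    (hf : ∀ i, moved (smoothPairing (!b) i) = !moved i)
    (hm : ∀ i, moved (smoothPairing b i) = moved i) :
    SameLink ((D.double c b moved).smooth (D.nearCrossing c b moved) b) (D.smooth c b) := by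
  set E := D.double c b moved with hE
  set n : E.C := D.nearCrossing c b moved with hn
  set f : E.C := D.farCrossing c b moved with hff
  have hfn : f ≠ n := D.far_ne_near c b moved
  set G := E.smooth n b with hG
  -- `a` is to be the start of the kink's loop: an inner end of the far crossing that the pairing
  -- `b` sends to the next end. Of two opposite candidates exactly one is not moved.
  have key : ∀ b, ∃ a, smoothPairing b a = a + 1 ∧ smoothPairing b (a + 2) = a + 2 + 1 ∧
      a + 2 = smoothPairing (!b) (smoothPairing b a) := by decide
  obtain ⟨a, ha, hma⟩ : ∃ a, smoothPairing b a = a + 1 ∧ moved a = false := by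
    obtain ⟨a, h1, h2, h3⟩ := key b
    rcases h : moved a with _ | _
    · exact ⟨a, h1, h⟩
    · exact ⟨a + 2, h2, by rw [h3, hf, hm, h]; rfl⟩
  set i := smoothPairing (!b) a with hi
  have hmi : moved i = true := by rw [hi, hf, hma]; rfl
  have hmi' : moved (smoothPairing b i) = true := by rw [hm, hmi]
  have hii : smoothPairing (!b) (smoothPairing b i) = a + 1 := by
    have : ∀ (b : Bool) (a : Fin 4),
      smoothPairing (!b) (smoothPairing b (smoothPairing (!b) a)) = smoothPairing b a := by decide
    rw [hi, this, ha]
  have hfar : ∀ j, E.smoothEquiv n b (Sum.inl (f, j)) = Sum.inl (E.oldCrossing hfn b, j) :=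
    E.smoothEquiv_of_ne hfn b
  -- The smoothing leaves a marked point on the loop; without it the loop is a single edge, as the
  -- first Reidemeister move requires.
  let m : G.B := E.arcMark n b (arcEquiv b i).1
  have hmark : ∀ k, ∃ j, moved j = true ∧ E.smoothEquiv n b (Sum.inl (n, j)) = Sum.inr (m, k) := by
    intro k
    have arc : ∀ (b : Bool) (i : Fin 4) (k : Fin 2),
      arcEquiv b i = ((arcEquiv b i).1, k) ∨
        arcEquiv b (smoothPairing b i) = ((arcEquiv b i).1, k) := by decide
    rcases arc b i k with h | h
    · refine ⟨i, hmi, ?_⟩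
      rw [smoothEquiv_self, h]
    · refine ⟨smoothPairing b i, hmi', ?_⟩
      rw [smoothEquiv_self, h]
  have hm0 : G.edge (Sum.inr (m, 0)) ≠ Sum.inr (m, 1) := by
    obtain ⟨j, hj, hj'⟩ := hmark 0
    rw [← hj', smooth_edge, double_edge_near hf hj, hfar]
    exact Sum.inl_ne_inr
  have hkink : (removeMark hm0).edge (Sum.inl (E.oldCrossing hfn b, a)) =
      Sum.inl (E.oldCrossing hfn b, a + 1) := by
    apply removeMarkOld_injective hm0
    have h1 : G.edge (removeMarkOld hm0 (Sum.inl (E.oldCrossing hfn b, a))) =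
        Sum.inr (m, (arcEquiv b i).2) := by
      refine (congrArg G.edge (hfar a).symm).trans ?_
      rw [smooth_edge, double_edge_far hf hma, smoothEquiv_self]
    rw [removeMark_edge_of_mark hm0 h1, ← rot_inr]
    refine (congrArg (fun d => G.edge (G.rot d)) (E.smoothEquiv_self n b i).symm).trans ?_
    rw [smooth_rot_self, smooth_edge, double_edge_near hf hmi', hii]
    exact hfar _
  have hpG : G.Planar := hp.smooth n b
  have h1 := markEquiv_removeMark hm0
  have hpH := h1.planar_iff.1 hpG
  have hβ : smoothPairing (!b) (a + 1) = a + 2 := by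
    have : ∀ (b : Bool) (a : Fin 4), smoothPairing b a = a + 1 →
      smoothPairing (!b) (a + 1) = a + 2 := by decide
    exact this b a ha
  have h2 := sameLink_smooth_of_kink hpH hkink hβ
  have h3 := ((splices_removeMark hm0).markEquiv_smooth (E.oldCrossing hfn b)
    (y := E.oldCrossing hfn b) rfl (!b)).symm.trans (markEquiv_smoothTwo_double hf)
  exact .trans _ _ _ (h1.sameLink hpG) (.trans _ _ _ h2 (h3.sameLink (hpH.smooth _ _)))

/-- The smoothing of both crossings that gives an additional circle. -/
theorem treeStates_smoothTwo_eq_empty (hm : ∀ i, moved (smoothPairing b i) = moved i) :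
    ((D.double c b moved).smoothTwo (D.far_ne_near c b moved) b b).treeStates = ∅ := by
  set E := D.double c b moved with hE
  rw [Finset.eq_empty_iff_forall_notMem]
  intro s hs
  obtain ⟨t, ht, htf, -⟩ := exists_state_of_smooth _ hs
  obtain ⟨r, hr, hrn, hrt⟩ := exists_state_of_smooth _
    (((E.smooth (D.nearCrossing c b moved) b).mem_treeStates).2 ht)
  have hrf : r (D.farCrossing c b moved) = !b :=
    (hrt ⟨_, D.far_ne_near c b moved⟩).trans htf
  have := E.nonempty_dart_of_crossing (D.nearCrossing c b moved)
  have hl := orbitCount_eq_one_iff.1 hr (D.inner c b moved 0) (D.outer c b moved (Sum.inl (c, 0)))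
  -- With both crossings smoothed by `b`, the inner half-edges are closed under the edges and the
  -- state pairing, so they carry a circle disjoint from the rest.
  have hmem := mem_of_linked (U := Set.range (D.inner c b moved)) ?_ hl ⟨0, rfl⟩
  · obtain ⟨j, hj⟩ := hmem
    exact D.outer_ne_inner c b moved _ j hj.symm
  · rintro σ (rfl | rfl) x ⟨i, rfl⟩
    · exact ⟨_, (D.double_edge_inner c b moved i).symm⟩
    · refine ⟨smoothPairing b i, ?_⟩
      rcases h : moved i with _ | _
      · rw [inner_unmoved D c b h, inner_unmoved D c b ((hm i).trans h), statePairing_inl, hrf,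
          Bool.not_not]
      · rw [inner_moved D c b h, inner_moved D c b ((hm i).trans h), statePairing_inl, hrn,
          Bool.not_not]

theorem bracket_root_eq_zero {D : LinkDiagram} [Nonempty D.Dart] (h : D.treeStates = ∅) :
    D.bracket bracketRoot = 0 := by
  rw [bracket_root_eq_sum, h, Finset.sum_empty]

theorem bracket_smoothTwo_eq_zero (hm : ∀ i, moved (smoothPairing b i) = moved i) :
    ((D.double c b moved).smoothTwo (D.far_ne_near c b moved) b b).bracket bracketRoot = 0 := by
  have : Nonempty ((D.double c b moved).smoothTwo (D.far_ne_near c b moved) b b).Dart :=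
    nonempty_dart_smooth ((D.double c b moved).smooth (D.nearCrossing c b moved) b)
    (oldCrossing _ (D.far_ne_near c b moved) b) b
  exact bracket_root_eq_zero (treeStates_smoothTwo_eq_empty hm)

/-- Both crossings that replace `c` are quasi-alternating if the determinant is additive. -/
theorem isQuasiAlternatingAt_near (hf : ∀ i, moved (smoothPairing (!b) i) = !moved i)
    (hm : ∀ i, moved (smoothPairing b i) = moved i) (hp : D.Planar)
    (hQ : D.LinkIsQuasiAlternating) (hS : (D.smooth c b).LinkIsQuasiAlternating)
    (hdet : ‖bracketRoot ^ (if b then 1 else -1 : ℤ) * D.bracket bracketRoot +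
      (D.smooth c b).bracket bracketRoot‖ = D.det + (D.smooth c b).det) :
    (D.double c b moved).IsQuasiAlternatingAt (D.nearCrossing c b moved) := by
  set E := D.double c b moved with hE
  set n : E.C := D.nearCrossing c b moved with hn
  have hz := bracketRoot_ne_zero
  have m1 := (splices_double (D := D) (c := c) hf).markEquiv
  have hF : (E.smooth n (!b)).Planar := m1.planar_iff.2 hp
  have hEp : E.Planar := planar_double hf hm hF
  have q1 : (E.smooth n (!b)).LinkIsQuasiAlternating :=
    .sameLink _ _ (m1.symm.sameLink hp) hQ
  have q2 : (E.smooth n b).LinkIsQuasiAlternating :=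
    .sameLink _ _ (.symm _ _ (sameLink_smooth_double hEp hf hm)) hS
  have b1 : (E.smooth n (!b)).bracket bracketRoot = _ := m1.bracket_eq _
  have b2 := (markEquiv_smoothTwo_double (D := D) (c := c) hf).bracket_eq bracketRoot
  have b3 := bracket_smoothTwo_eq_zero (D := D) (c := c) hm
  have sk := (E.smooth n b).bracket_skein (E.oldCrossing (D.far_ne_near c b moved) b) bracketRoot
  have sk' := E.bracket_skein n bracketRoot
  -- Of the two smoothings of the kink, one splits off a circle and contributes zero; the other is
  -- the smoothing of `D`, multiplied by a unit.
  have hdS : (E.smooth n b).det = (D.smooth c b).det := by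
    rw [det_eq, det_eq]
    cases b
    · refine (congrArg norm (sk.trans (congrArg₂ (fun p q => bracketRoot * p + bracketRoot⁻¹ * q)
        b3 b2))).trans ?_
      rw [mul_zero, zero_add, norm_mul, norm_inv, norm_bracketRoot, inv_one, one_mul]
    · refine (congrArg norm (sk.trans (congrArg₂ (fun p q => bracketRoot * p + bracketRoot⁻¹ * q)
        b2 b3))).trans ?_
      rw [mul_zero, add_zero, norm_mul, norm_bracketRoot, one_mul]
  have hdF : (E.smooth n (!b)).det = D.det := m1.det_eq
  -- The unit from the kink cancels the coefficient of the skein relation at the near crossing,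
  -- which leaves `⟨D_b⟩ + A^(±1) ⟨D⟩`, the expression in `hdet`.
  have hdE : E.det = D.det + (D.smooth c b).det := by
    rw [← hdet, det_eq]
    congr 1
    cases b
    · have e1 := sk.trans (congrArg₂ (fun p q => bracketRoot * p + bracketRoot⁻¹ * q) b3 b2)
      refine (sk'.trans (congrArg₂ (fun p q => bracketRoot * p + bracketRoot⁻¹ * q) e1 b1)).trans ?_
      simp only [Bool.false_eq_true, if_false, zpow_neg_one, mul_zero, zero_add]
      rw [mul_inv_cancel_left₀ hz, add_comm]
    · have e1 := sk.trans (congrArg₂ (fun p q => bracketRoot * p + bracketRoot⁻¹ * q) b2 b3)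
      refine (sk'.trans (congrArg₂ (fun p q => bracketRoot * p + bracketRoot⁻¹ * q) b1 e1)).trans ?_
      simp only [if_true, zpow_one, mul_zero, add_zero]
      rw [inv_mul_cancel_left₀ hz]
  cases b
  · exact ⟨hEp, q2, q1, by rw [hdE, add_comm, ← hdF, ← hdS]; rfl⟩
  · exact ⟨hEp, q1, q2, by rw [hdE, ← hdF, ← hdS]; rfl⟩

/-- Exchanging the two crossings complements `moved`, and the hypotheses are invariant under this.
-/
theorem isQuasiAlternatingAt_far (hf : ∀ i, moved (smoothPairing (!b) i) = !moved i)
    (hm : ∀ i, moved (smoothPairing b i) = moved i) (hp : D.Planar)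
    (hQ : D.LinkIsQuasiAlternating) (hS : (D.smooth c b).LinkIsQuasiAlternating)
    (hdet : ‖bracketRoot ^ (if b then 1 else -1 : ℤ) * D.bracket bracketRoot +
      (D.smooth c b).bracket bracketRoot‖ = D.det + (D.smooth c b).det) :
    (D.double c b moved).IsQuasiAlternatingAt (D.farCrossing c b moved) := by
  refine (D.doubleSwap c b moved).isQuasiAlternatingAt ?_
  rw [doubleSwap_far]
  exact isQuasiAlternatingAt_near (moved := fun i => !moved i)
    (fun i => congrArg Bool.not (hf i)) (fun i => congrArg Bool.not (hm i)) hp hQ hS hdet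

theorem det_nonneg (D : LinkDiagram) : 0 ≤ D.det := norm_nonneg _

/-- The link of a smoothing of a dealternator is quasi-alternating if its determinant is not
zero. -/
theorem IsDealtColoring.smooth_linkIsQuasiAlternating {o : D.Dart → Bool}
    (h : D.IsDealtColoring o c) (hp : D.Planar) (β : Bool) (hpos : 0 < (D.smooth c β).det) :
    (D.smooth c β).LinkIsQuasiAlternating := by
  have := D.nonempty_dart_smooth c β
  refine (h.smooth β).linkIsQuasiAlternating (hp.smooth c β) ?_
  rw [(h.smooth β).det_eq_card (hp.smooth c β)] at hpos
  exact Finset.card_pos.1 (by exact_mod_cast hpos)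

/-- The determinants related to a dealternator. -/
theorem IsDealtColoring.norm_add_eq {o : D.Dart → Bool}
    (h : D.IsDealtColoring o c) (hp : D.Planar) {β : Bool}
    (hlt : (D.smooth c (!β)).det < (D.smooth c β).det) :
    ‖bracketRoot ^ (if β then 1 else -1 : ℤ) * D.bracket bracketRoot +
      (D.smooth c β).bracket bracketRoot‖ = D.det + (D.smooth c β).det := by
  obtain ⟨u, hu, h0, h1⟩ := h.bracket_smooth hp
  set p := (D.smoothInfty c).det with hpd
  set q := (D.smoothZero c).det with hqd
  have hp0 : 0 ≤ p := det_nonneg _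
  have hq0 : 0 ≤ q := det_nonneg _
  have hz4 := bracketRoot_pow_four
  have hzn := norm_bracketRoot
  -- The skein sum is `q u A^3 + A^(-1) p u`, and `A^(-1) = -A^3` because `A^4 = -1`.
  have hD : D.bracket bracketRoot = ((p - q : ℝ) : ℂ) * (-(u * bracketRoot ^ 3)) := by
    rw [D.bracket_skein c, h0, h1, inv_bracketRoot]
    push_cast
    ring
  have hdet : D.det = |p - q| := by
    rw [det_eq, hD, norm_mul, norm_neg, norm_mul, norm_pow, hu, hzn, one_pow, mul_one, mul_one,
      Complex.norm_real, Real.norm_eq_abs]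
  cases β
  · have hlt' : p < q := hlt
    -- Both summands are nonnegative multiples of `u A^2`, namely `q - p` and `q`, so their absolute
    -- values add. In the other case the common phase is `u`.
    have e : bracketRoot ^ (if false = true then 1 else -1 : ℤ) * D.bracket bracketRoot +
        (D.smooth c false).bracket bracketRoot =
        ((2 * q - p : ℝ) : ℂ) * (u * bracketRoot ^ 2) := by
      rw [if_neg (by decide), zpow_neg_one, hD, inv_bracketRoot, h0]
      push_cast
      linear_combination ((p : ℂ) - q) * u * bracketRoot ^ 2 * hz4
    rw [e, hdet, norm_mul, norm_mul, norm_pow, hu, hzn, one_pow, mul_one, mul_one,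
      Complex.norm_real, Real.norm_eq_abs, abs_of_pos (by linarith), abs_of_neg (by linarith)]
    change _ = _ + q
    ring
  · have hlt' : q < p := hlt
    have e : bracketRoot ^ (if true = true then 1 else -1 : ℤ) * D.bracket bracketRoot +
        (D.smooth c true).bracket bracketRoot = ((2 * p - q : ℝ) : ℂ) * u := by
      rw [if_pos rfl, zpow_one, hD, h1]
      push_cast
      linear_combination -((p : ℂ) - q) * u * hz4
    rw [e, hdet, norm_mul, hu, mul_one,
      Complex.norm_real, Real.norm_eq_abs, abs_of_pos (by linarith), abs_of_pos (by linarith)]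
    change _ = _ + p
    ring

end LinkDiagram

theorem theorem3p2 (D : LinkDiagram) (hD : D.Planar) (c : D.C) (hc : D.IsDealternator c)
    (hQ : D.LinkIsQuasiAlternating) :
    ((D.smoothInfty c).det < (D.smoothZero c).det →
      (D.extendNegHalf c).IsQuasiAlternatingAt (some c : Option D.C) ∧
      (D.extendNegHalf c).IsQuasiAlternatingAt (none : Option D.C)) ∧
    ((D.smoothZero c).det < (D.smoothInfty c).det →
      (D.extendNegTwo c).IsQuasiAlternatingAt (some c : Option D.C) ∧
      (D.extendNegTwo c).IsQuasiAlternatingAt (none : Option D.C)) := by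
  obtain ⟨o, ho⟩ := hc.exists_coloring
  constructor
  · intro hlt
    have hS := ho.smooth_linkIsQuasiAlternating hD false
      ((LinkDiagram.det_nonneg _).trans_lt hlt)
    have hdet := ho.norm_add_eq hD (β := false) hlt
    -- The extension unfolds to `double` with `b = false`. The decided conditions say that the
    -- pairing `∞` exchanges the ends at the two crossings and the pairing `0` keeps them; for the
    -- extension by `-2` the roles are reversed.
    exact ⟨LinkDiagram.isQuasiAlternatingAt_near (b := false)
      (moved := fun i => decide (i = 2 ∨ i = 3)) (by decide) (by decide) hD hQ hS hdet,
      LinkDiagram.isQuasiAlternatingAt_far (b := false)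
      (moved := fun i => decide (i = 2 ∨ i = 3)) (by decide) (by decide) hD hQ hS hdet⟩
  · intro hlt
    have hS := ho.smooth_linkIsQuasiAlternating hD true
      ((LinkDiagram.det_nonneg _).trans_lt hlt)
    have hdet := ho.norm_add_eq hD (β := true) hlt
    exact ⟨LinkDiagram.isQuasiAlternatingAt_near (b := true)
      (moved := fun i => decide (i = 0 ∨ i = 3)) (by decide) (by decide) hD hQ hS hdet,
      LinkDiagram.isQuasiAlternatingAt_far (b := true)
      (moved := fun i => decide (i = 0 ∨ i = 3)) (by decide) (by decide) hD hQ hS hdet⟩
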